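/- Let $\mathbb T^2=\mathbb R^2/\mathbb Z^2$ be the flat torus, $T>0$, $\theta\in(0,1)$ and $H(p)=\sqrt{1+|p|^2}$ for $p\in\mathbb R^2$. Let $\varepsilon_n\in(0,1)$ with $\varepsilon_n\to0$, and let $(\Omega,\mathscr F,(\mathscr F_t),\mathbb P)$ be a filtered probability space with a real-valued $(\mathscr F_t)$-Wiener process $W$ on $[0,T]$. For each $n$ let $u^n$ be a strong solution on $[0,T]\times\mathbb T^2$ of the viscous approximation $$\mathrm du=\Big(\tfrac12+\varepsilon_n\Big)\Delta u\,\mathrm dt+\tfrac12H(\nabla u)\,\mathrm{div}\Big(\frac{\nabla u}{H(\nabla u)}\Big)\mathrm dt+H(\nabla u)\,\mathrm dW,\qquad u(0)=u^n_0,$$ that is: $u^n$ is an adapted process with almost surely continuous paths in $L^2(\mathbb T^2)$, it belongs to $L^2(\Omega\times[0,T],\mathcal P,\mathrm d\mathbb P\otimes\mathrm dt;H^2(\mathbb T^2))$, where $\mathcal P$ is the predictable $\sigma$-algebra, $u^n_0$ is an $\mathscr F_0$-measurable $H^1(\mathbb T^2)$-valued random variable, and for every $t\in[0,T]$ the equation,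 integrated over $[0,t]$ with the $L^2(\mathbb T^2)$-valued It\^o integral, holds almost surely in $L^2(\mathbb T^2)$. Assume $\sup_n\mathbb E\|\nabla u_0^n\|_{L^2(\mathbb T^2)}^2<\infty$. Put $$v^n=\mathrm{div}\Big(\frac{\nabla u^n}{H(\nabla u^n)}\Big),\quad \nu^n=\frac{\nabla u^n}{H(\nabla u^n)},\quad V^n=v^n\sqrt{H(\nabla u^n)},\quad I^n=\int_0^{\cdot}\|H(\nabla u^n)\|_{L^1(\mathbb T^2)}^{1+\theta}\,\mathrm ds,$$ and regard $(u^n,v^n,\nu^n,V^n,I^n,u^n_0,W)$ as a random variable in the path space $$\mathcal X=L^2_tL^2_x\times(L^2_tL^2_x,w)\times(L^2_t L^2_x(\mathbb R^2),w)\times(L^2_tL^2_x,w)\times C([0,T];\mathbb R)\times H^1(\mathbb T^2)\times C([0,T];\mathbb R)$$ with its Borel $\sigma$-algebra, where $L^2_tL^2_x=L^2(0,T;L^2(\mathbb T^2))$, $L^2_tL^2_x(\mathbb R^2)=L^2(0,T;L^2(\mathbb T^2;\mathbb R^2))$ and $w$ denotes the weak topology. Suppose that a Skorokhod representation is given: on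 a probability space $(\tilde\Omega,\tilde{\mathscr F},\tilde{\mathbb P})$ there are $\mathcal X$-valued random variables $(\tilde u^n,\tilde v^n,\tilde\nu^n,\tilde V^n,\tilde I^n,\tilde u^n_0,\tilde W^n)$, $n\in\mathbb N$, and $(\tilde u,\tilde v,\tilde\nu,\tilde V,\tilde I,\tilde u_0,\tilde W)$ such that for every $n$ the law of $(\tilde u^n,\dots,\tilde W^n)$ under $\tilde{\mathbb P}$ equals the law of $(u^n,\dots,W)$ under $\mathbb P$, and $(\tilde u^n,\dots,\tilde W^n)\to(\tilde u,\dots,\tilde W)$ in $\mathcal X$, $\tilde{\mathbb P}$-almost surely. Then the spatial weak gradients $\nabla\tilde u^n$ and $\nabla\tilde u$ exist in $L^2(\tilde\Omega\times[0,T]\times\mathbb T^2;\mathbb R^2)$, and for every $p\in[1,2)$ $$\nabla\tilde u^n\to\nabla\tilde u\quad\text{in }L^p(\tilde\Omega\times[0,T]\times\mathbb T^2;\mathbb R^2).$$ -/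

import Mathlib

open MeasureTheory Filter Topology
open scoped NNReal ENNReal

noncomputable section

/-! ### Function spaces on the flat torus -/

/-- The two-dimensional flat torus of unit volume; `volume` on it is Lebesgue measure. -/
abbrev Torus2 : Type := UnitAddTorus (Fin 2)

/-- The Euclidean plane. -/
abbrev Plane : Type := EuclideanSpace ℝ (Fin 2)

/-- The Lebesgue space `L²(𝕋²; E)`. -/
abbrev L2 (E : Type) [NormedAddCommGroup E] : Type := Lp E 2 (volume : Measure Torus2)

/-- The class in `L²(𝕋²; E)` of a square integrable function. -/
def toL2 {E : Type} [NormedAddCommGroup E] (f : Torus2 → E) : L2 E :=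
  open Classical in if h : MemLp f 2 volume then h.toLp f else 0

/-- `φ ∈ C^∞(𝕋²)`: the periodic lift of `φ` to the plane is smooth. -/
def IsSmoothOnTorus (φ : Torus2 → ℝ) : Prop :=
  ContDiff ℝ ((⊤ : ℕ∞) : WithTop ℕ∞) (fun y : Fin 2 → ℝ => φ (fun i => (y i : UnitAddCircle)))

/-- The `i`-th partial derivative of a function on the torus. -/
def torusPartial (i : Fin 2) (φ : Torus2 → ℝ) (x : Torus2) : ℝ :=
  deriv (fun s : ℝ => φ (x + Pi.single i (s : UnitAddCircle))) 0

/-- `g` is the weak gradient of `f` on the torus (for square integrable `f`, `g`). -/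
def IsWeakGradient (f : Torus2 → ℝ) (g : Torus2 → Plane) : Prop :=
  ∀ φ : Torus2 → ℝ, IsSmoothOnTorus φ → ∀ i : Fin 2,
    ∫ x, f x * torusPartial i φ x = - ∫ x, g x i * φ x

/-- `v` is the weak divergence of `F` on the torus (for square integrable `F`, `v`). -/
def IsWeakDivergence (F : Torus2 → Plane) (v : Torus2 → ℝ) : Prop :=
  ∀ φ : Torus2 → ℝ, IsSmoothOnTorus φ →
    ∫ x, ∑ i, F x i * torusPartial i φ x = - ∫ x, v x * φ x

/-- The weak divergence of a vector field, as an element of `L²(𝕋²)` (it is unique if it exists;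
the value is `0` if there is no square integrable weak divergence). -/
def weakDiv (F : Torus2 → Plane) : L2 ℝ :=
  open Classical in if h : ∃ v : L2 ℝ, IsWeakDivergence F v then h.choose else 0

/-- The Sobolev space `H¹(𝕋²)`: pairs of an `L²` function and its `L²` weak gradient, with the
topology of `L² × L²`, which is the `H¹` topology. -/
def H1 : Type := {z : L2 ℝ × L2 Plane // IsWeakGradient z.1 z.2}

instance : TopologicalSpace H1 := instTopologicalSpaceSubtype

/-- The underlying `L²` function. -/
def H1.fn (z : H1) : L2 ℝ := z.1.1

/-- The weak gradient. -/
def H1.grad (z : H1) : L2 Plane := z.1.2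

/-- The Sobolev space `H²(𝕋²)`: an `L²` function, its weak gradient, and the rows of its weak
Hessian (row `i` is the weak gradient of the `i`-th partial derivative), with the topology of the
product of the `L²` spaces, which is the `H²` topology. -/
def H2 : Type :=
  {z : L2 ℝ × L2 Plane × (Fin 2 → L2 Plane) //
    IsWeakGradient z.1 z.2.1 ∧ ∀ i, IsWeakGradient (fun x => z.2.1 x i) (z.2.2 i)}

instance : TopologicalSpace H2 := instTopologicalSpaceSubtype

namespace H2

/-- The underlying `L²` function. -/
def fn (z : H2) : L2 ℝ := z.1.1

/-- The weak gradient. -/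
def grad (z : H2) : L2 Plane := z.1.2.1

/-- The `i`-th row of the weak Hessian. -/
def hess (z : H2) (i : Fin 2) : L2 Plane := z.1.2.2 i

/-- The squared `H²` norm. -/
def sqNorm (z : H2) : ℝ≥0∞ := ‖z.fn‖ₑ ^ 2 + ‖z.grad‖ₑ ^ 2 + ∑ i, ‖z.hess i‖ₑ ^ 2

/-- The Laplacian `Δz`. -/
def lap (z : H2) : L2 ℝ := toL2 (fun x => ∑ i, z.hess i x i)

/-- The area density `H(∇z) = √(1 + |∇z|²)`. -/
def area (z : H2) (x : Torus2) : ℝ := √(1 + ‖z.grad x‖ ^ 2)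

/-- The field `∇z / H(∇z)`. -/
def normal (z : H2) (x : Torus2) : Plane := (z.area x)⁻¹ • z.grad x

/-- The mean curvature `div (∇z / H(∇z))`. -/
def curv (z : H2) : L2 ℝ := weakDiv z.normal

end H2

/-! ### Time, Wiener process, stochastic integral -/

/-- Lebesgue measure on the time interval `[0, T]`. -/
def timeMeasure (T : ℝ≥0) : Measure ℝ≥0 :=
  (Measure.comap ((↑) : ℝ≥0 → ℝ) volume).restrict (Set.Iic T)

section Stochastic

variable {Ω : Type*} {mΩ : MeasurableSpace Ω}

/-- `W` is a real Wiener process on `[0, T]` relative to the filtration `F`. -/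
structure IsWienerProcess (P : Measure Ω) (F : Filtration ℝ≥0 mΩ) (T : ℝ≥0)
    (W : ℝ≥0 → Ω → ℝ) : Prop where
  start : ∀ᵐ ω ∂P, W 0 ω = 0
  adapted : ∀ t ≤ T, Measurable[F t] (W t)
  continuous : ∀ᵐ ω ∂P, ContinuousOn (fun t => W t ω) (Set.Iic T)
  law : ∀ s t, s ≤ t → t ≤ T →
    P.map (fun ω => W t ω - W s ω) = ProbabilityTheory.gaussianReal 0 (t - s)
  indep : ∀ s t, s ≤ t → t ≤ T →
    ProbabilityTheory.Indep
      (MeasurableSpace.comap (fun ω => W t ω - W s ω) inferInstance) (F s) P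

/-- An elementary process `∑ᵢ ξᵢ 1_{(tᵢ, tᵢ₊₁]}` with bounded `F tᵢ`-measurable `ξᵢ`. -/
structure ElementaryProcess (F : Filtration ℝ≥0 mΩ) (E : Type*) [NormedAddCommGroup E] where
  /-- the number of intervals -/
  size : ℕ
  /-- the partition points -/
  time : ℕ → ℝ≥0
  time_mono : Monotone time
  /-- the random coefficients -/
  coeff : ℕ → Ω → E
  coeff_meas : ∀ i, StronglyMeasurable[F (time i)] (coeff i)
  coeff_bdd : ∀ i, ∃ C : ℝ, ∀ ω, ‖coeff i ω‖ ≤ C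

namespace ElementaryProcess

variable {F : Filtration ℝ≥0 mΩ} {E : Type*} [NormedAddCommGroup E] [NormedSpace ℝ E]

/-- The value at time `t`. -/
def val (S : ElementaryProcess F E) (t : ℝ≥0) (ω : Ω) : E :=
  ∑ i ∈ Finset.range S.size,
    (Set.Ioc (S.time i) (S.time (i + 1))).indicator (fun _ => S.coeff i ω) t

/-- The elementary stochastic integral over `[0, t]`. -/
def integral (S : ElementaryProcess F E) (W : ℝ≥0 → Ω → ℝ) (t : ℝ≥0) (ω : Ω) : E :=
  ∑ i ∈ Finset.range S.size,
    (W (min t (S.time (i + 1))) ω - W (min t (S.time i)) ω) • S.coeff i ω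

end ElementaryProcess

/-- `M` is (a version of) the Itô integral process `∫₀ᵗ g dW`, `t ∈ [0, T]`, of the predictable
process `g`:
the limit of elementary integrals along elementary processes that converge to `g` in
`L²(Ω × [0, T]; E)`. -/
def IsItoIntegral (P : Measure Ω) (F : Filtration ℝ≥0 mΩ) (T : ℝ≥0) (W : ℝ≥0 → Ω → ℝ)
    {E : Type*} [NormedAddCommGroup E] [NormedSpace ℝ E] (g M : ℝ≥0 → Ω → E) : Prop :=
  IsStronglyPredictable F g ∧ (∀ t ≤ T, AEStronglyMeasurable (M t) P) ∧
  ∃ S : ℕ → ElementaryProcess F E,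
    Tendsto (fun k => ∫⁻ ω, ∫⁻ t, ‖(S k).val t ω - g t ω‖ₑ ^ 2 ∂timeMeasure T ∂P)
      atTop (𝓝 0) ∧
    ∀ t ≤ T, Tendsto (fun k => ∫⁻ ω, ‖(S k).integral W t ω - M t ω‖ₑ ^ 2 ∂P) atTop (𝓝 0)

/-! ### The viscous approximation -/

/-- `u` is a strong solution on `[0, T]`, with initial value `u₀` and with respect to the Wiener
process `W` and the filtration `F`, of
`du = (1/2 + ε) Δu dt + 1/2 H(∇u) div(∇u / H(∇u)) dt + H(∇u) dW`.
Here `U` is the predictable representative of `u` in `L²(Ω × [0, T]; H²(𝕋²))`. -/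
structure IsViscousSolution (P : Measure Ω) (F : Filtration ℝ≥0 mΩ) (T : ℝ≥0)
    (W : ℝ≥0 → Ω → ℝ) (ε : ℝ) (u₀ : Ω → H1) (u : ℝ≥0 → Ω → L2 ℝ) (U : ℝ≥0 → Ω → H2) :
    Prop where
  wiener : IsWienerProcess P F T W
  adapted : ∀ t ≤ T, StronglyMeasurable[F t] (u t)
  continuous : ∀ᵐ ω ∂P, ContinuousOn (fun t => u t ω) (Set.Iic T)
  predictable : IsStronglyPredictable F U
  sq_integrable : ∫⁻ ω, ∫⁻ t, (U t ω).sqNorm ∂timeMeasure T ∂P < ∞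
  representative : ∀ᵐ ω ∂P, ∀ᵐ t ∂timeMeasure T, u t ω = (U t ω).fn
  initial_meas : StronglyMeasurable[F 0] u₀
  initial : ∀ᵐ ω ∂P, u 0 ω = (u₀ ω).fn
  equation : ∃ M : ℝ≥0 → Ω → L2 ℝ,
    IsItoIntegral P F T W (fun t ω => toL2 (U t ω).area) M ∧
    ∀ t ≤ T, ∀ᵐ ω ∂P,
      u t ω = u 0 ω + (1 / 2 + ε) • ∫ s, (U s ω).lap ∂timeMeasure t
        + (1 / 2 : ℝ) • ∫ s, toL2 (fun x => (U s ω).area x * (U s ω).curv x) ∂timeMeasure t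
        + M t ω

end Stochastic

/-! ### The path space -/

/-- The Bochner space `L²(0, T; L²(𝕋²; E))`. -/
abbrev L2L2 (T : ℝ≥0) (E : Type) [NormedAddCommGroup E] : Type := Lp (L2 E) 2 (timeMeasure T)

/-- The path space of the variables `(u, v, ν, V, I, u₀, W)`: norm topology for `u`, weak topology
for `v`, `ν`, `V`, uniform topology for `I` and `W`, and the `H¹` topology for `u₀`. -/
def PathSpace (T : ℝ≥0) : Type :=
  L2L2 T ℝ × WeakSpace ℝ (L2L2 T ℝ) × WeakSpace ℝ (L2L2 T Plane) × WeakSpace ℝ (L2L2 T ℝ) ×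
    C(Set.Iic T, ℝ) × H1 × C(Set.Iic T, ℝ)

instance (T : ℝ≥0) : TopologicalSpace (PathSpace T) :=
  inferInstanceAs (TopologicalSpace
    (L2L2 T ℝ × WeakSpace ℝ (L2L2 T ℝ) × WeakSpace ℝ (L2L2 T Plane) × WeakSpace ℝ (L2L2 T ℝ) ×
      C(Set.Iic T, ℝ) × H1 × C(Set.Iic T, ℝ)))

instance (T : ℝ≥0) : MeasurableSpace (PathSpace T) := borel _

instance (T : ℝ≥0) : BorelSpace (PathSpace T) := ⟨rfl⟩

namespace PathSpace

variable {T : ℝ≥0}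

/-- The component `u`. -/
def u (X : PathSpace T) : L2L2 T ℝ := X.1

/-- The component `v`. -/
def v (X : PathSpace T) : L2L2 T ℝ := (toWeakSpace ℝ _).symm X.2.1

/-- The component `ν`. -/
def ν (X : PathSpace T) : L2L2 T Plane := (toWeakSpace ℝ _).symm X.2.2.1

/-- The component `V`. -/
def V (X : PathSpace T) : L2L2 T ℝ := (toWeakSpace ℝ _).symm X.2.2.2.1

/-- The component `I`. -/
def I (X : PathSpace T) : C(Set.Iic T, ℝ) := X.2.2.2.2.1

/-- The component `u₀`. -/
def u₀ (X : PathSpace T) : H1 := X.2.2.2.2.2.1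

/-- The component `W`. -/
def W (X : PathSpace T) : C(Set.Iic T, ℝ) := X.2.2.2.2.2.2

end PathSpace

/-- `X` collects the solution path `u`, its mean curvature `v = div(∇u / H(∇u))`,
`ν = ∇u / H(∇u)`, `V = div(∇u / H(∇u)) √H(∇u)`, `I = ∫₀^· ‖H(∇u)‖_{L¹}^{1+θ} ds`, the initial value
and the path of the Wiener process. -/
structure IsPathVector {T : ℝ≥0} (θ : ℝ) (W : ℝ≥0 → ℝ) (u₀ : H1) (u : ℝ≥0 → L2 ℝ)
    (U : ℝ≥0 → H2) (X : PathSpace T) : Prop where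
  u_eq : ∀ᵐ t ∂timeMeasure T, X.u t = u t
  v_eq : ∀ᵐ t ∂timeMeasure T, X.v t = (U t).curv
  ν_eq : ∀ᵐ t ∂timeMeasure T, X.ν t = toL2 (U t).normal
  V_eq : ∀ᵐ t ∂timeMeasure T, X.V t = toL2 (fun x => (U t).curv x * √((U t).area x))
  I_eq : ∀ t : Set.Iic T, X.I t = ∫ s, (∫ x, (U s).area x) ^ (1 + θ) ∂timeMeasure (t : ℝ≥0)
  u₀_eq : X.u₀ = u₀
  W_eq : ∀ t : Set.Iic T, X.W t = W t

/-- The product measure `P ⊗ dt ⊗ dx` on `Ω × [0, T] × 𝕋²`. -/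
def spaceTimeMeasure {Ω : Type*} {mΩ : MeasurableSpace Ω} (P : Measure Ω) (T : ℝ≥0) :
    Measure (Ω × ℝ≥0 × Torus2) :=
  P.prod ((timeMeasure T).prod volume)

/-- `G ∈ L²(Ω × [0, T] × 𝕋²; ℝ²)` is the spatial weak gradient of the random path `u`. -/
structure IsSpatialGradient {Ω : Type*} {mΩ : MeasurableSpace Ω} (P : Measure Ω) (T : ℝ≥0)
    (u : Ω → L2L2 T ℝ) (G : Ω × ℝ≥0 × Torus2 → Plane) : Prop where
  memLp : MemLp G 2 (spaceTimeMeasure P T)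
  weakGradient : ∀ᵐ ω ∂P, ∀ᵐ t ∂timeMeasure T, IsWeakGradient (u ω t) (fun x => G (ω, t, x))

end

/-!
The normal `ν = ∇u / H(∇u)` is a strictly monotone function of the gradient, and its divergence `v`
is bounded along almost surely convergent sequences, because weakly convergent sequences are
bounded. Strong convergence of `u` and this bound pass the monotonicity form
`⟨∇uⁿ - ∇u, νⁿ - ν⟩` to zero; strict monotonicity then gives strong convergence of the gradients.
What has to be supplied is a uniform bound `E ∫ ‖∇uⁿ‖² < ∞` on the original probability space, its
transfer to the new one, and measurability.

*Weak derivatives.* On the torus, weak derivatives are multipliers on Fourier coefficients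
(`isWeakGradient_iff`, `isWeakDivergence_iff`), and equivalently `L²` limits of difference quotients
(`tendsto_diffQuot`, `isWeakPartial_of_tendsto`). The latter gives the chain rules for `H(∇z)` and
`∇z / H(∇z)` with `z` in `H²` (`isWeakPartial_area`, `isWeakPartial_normal`), and thereby
`H(∇z) div (∇z / H(∇z)) = Δz - D²z(ν, ν)` (`area_mul_curv_ae_eq`).

*Energy estimate.* No Itô formula in infinite dimensions is needed. Pairing the equation with a
Fourier mode gives a scalar Itô process, whose second moment satisfies `integral_sq_process`: the
square of drift plus martingale is expanded, and the cross term is computed from the martingale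
property. Weighting the resulting `integral_norm_coef_sq` by `|2πk|²` and summing over `k` produces
`E ‖∇u(t)‖² - E ‖∇u(0)‖²` on one side, and on the other the time integral of the expectation of
`∫ (-2 Δz · drift + |∇ H(∇z)|²) dx`. This is nonpositive (`tsum_energyTerm_nonpos`): the integrand
is at most `-3 det D²z` pointwise (`pointwise_energy`), and `∫ det D²z dx = 0`
(`integral_det_hess`). Hence the bound `lintegral_grad_le`, uniform in the viscosity.

*Transfer.* The gradient relation is a closed subset of a product of Polish spaces and the graph of
a partial function `gradOp`, so `gradOp` is Borel measurable by the Lusin–Souslin theorem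
(`measurable_gradOp`). Therefore the path vectors with `ν = ∇u / H(∇u)` and `v = div ν` form a
measurable set (`measurableSet_isConsistent`), and these relations as well as the energy bound are
inherited through equality of laws (`ae_isConsistent_of_law`). Lower semicontinuity of the Dirichlet
energy and Fatou's lemma give the gradient of the limit (`ae_exists_gradRel_limit`).

*Limit.* Only the mean of `‖∇uⁿ‖²` is bounded, not the individual paths, so the monotonicity form is
divided by `1 + ‖∇uⁿ‖`. It splits into `⟨∇(uⁿ - u), νⁿ⟩ = -⟨uⁿ - u, vⁿ⟩`, which is small by strong
convergence of `u`, and `⟨∇(uⁿ - u), ν(∇u)⟩`, which is small after normalisation by weak compactness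
(`tendsto_inner_normalPath_sub`). The quotient is dominated by a multiple of `1 + ‖∇u‖`, so its
expectation tends to zero (`tendsto_lintegral_monotone`). By the quantitative monotonicity
`norm_sub_sq_le_monoForm` the gradients converge in measure, and the `L²` bound upgrades this to
`L^p` for `p < 2` (`tendsto_eLpNorm_of_monoForm`). The jointly measurable gradients that the theorem
asks for are provided by `exists_path_representative`.
-/

namespace GraphMCF

open ComplexConjugate

/-! ### Fourier coefficients of real functions on the torus -/

theorem volume_torus_eq_pi :
    (volume : Measure Torus2) = Measure.pi fun _ => AddCircle.haarAddCircle := by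
  rw [volume_pi]
  congr 1
  funext i
  simp [AddCircle.volume_eq_smul_haarAddCircle]

instance : IsProbabilityMeasure (volume : Measure Torus2) := by
  rw [volume_torus_eq_pi]; infer_instance

/-- The Fourier coefficient `∫ f(x) e^{-2πi k·x} dx` of a real function on the torus. -/
noncomputable def coef (f : Torus2 → ℝ) (k : Fin 2 → ℤ) : ℂ :=
  ∫ x, UnitAddTorus.mFourier (-k) x * (f x : ℂ)

theorem coef_congr {f g : Torus2 → ℝ} (h : f =ᵐ[volume] g) (k : Fin 2 → ℤ) :
    coef f k = coef g k := by
  refine integral_congr_ae ?_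
  filter_upwards [h] with x hx
  rw [hx]

/-- Mathlib states Parseval's identity for the product of the Haar probability measures on the
circle, which agrees with `volume` only propositionally. -/
theorem hasSum_coef_complex_of_eq_pi {μ : Measure Torus2}
    (hμ : μ = Measure.pi fun _ => AddCircle.haarAddCircle)
    {f g : Torus2 → ℂ} (hf : MemLp f 2 μ) (hg : MemLp g 2 μ) :
    HasSum (fun k => conj (∫ x, UnitAddTorus.mFourier (-k) x * f x ∂μ) *
      (∫ x, UnitAddTorus.mFourier (-k) x * g x ∂μ)) (∫ x, conj (f x) * g x ∂μ) := by
  subst hμ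
  have h := UnitAddTorus.hasSum_prod_mFourierCoeff (d := Fin 2) (hf.toLp f) (hg.toLp g)
  have e1 : ∀ k, UnitAddTorus.mFourierCoeff (hf.toLp f) k =
      ∫ x, UnitAddTorus.mFourier (-k) x * f x ∂Measure.pi fun _ => AddCircle.haarAddCircle := by
    intro k
    refine integral_congr_ae ?_
    filter_upwards [hf.coeFn_toLp] with x hx
    rw [hx, smul_eq_mul]
  have e2 : ∀ k, UnitAddTorus.mFourierCoeff (hg.toLp g) k =
      ∫ x, UnitAddTorus.mFourier (-k) x * g x ∂Measure.pi fun _ => AddCircle.haarAddCircle := by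
    intro k
    refine integral_congr_ae ?_
    filter_upwards [hg.coeFn_toLp] with x hx
    rw [hx, smul_eq_mul]
  have e3 : (∫ x, conj (hf.toLp f x) * hg.toLp g x
      ∂Measure.pi fun _ => AddCircle.haarAddCircle) =
      ∫ x, conj (f x) * g x ∂Measure.pi fun _ => AddCircle.haarAddCircle := by
    refine integral_congr_ae ?_
    filter_upwards [hf.coeFn_toLp, hg.coeFn_toLp] with x hx hx'
    rw [hx, hx']
  simp only [e1, e2] at h
  rw [← e3]
  exact h

theorem hasSum_coef_mul {f g : Torus2 → ℝ} (hf : MemLp f 2 volume) (hg : MemLp g 2 volume) :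
    HasSum (fun k => conj (coef f k) * coef g k) ((∫ x, f x * g x : ℝ) : ℂ) := by
  have h := hasSum_coef_complex_of_eq_pi volume_torus_eq_pi (hf.ofReal (K := ℂ))
    (hg.ofReal (K := ℂ))
  have e : ((∫ x, f x * g x : ℝ) : ℂ) = ∫ x, conj (f x : ℂ) * (g x : ℂ) := by
    rw [← integral_complex_ofReal]
    congr 1
    funext x
    simp
  rw [e]
  exact h

theorem hasSum_re_coef_mul {f g : Torus2 → ℝ} (hf : MemLp f 2 volume) (hg : MemLp g 2 volume) :
    HasSum (fun k => (conj (coef f k) * coef g k).re) (∫ x, f x * g x) := by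
  simpa using Complex.hasSum_re (hasSum_coef_mul hf hg)

theorem hasSum_normSq_coef {f : Torus2 → ℝ} (hf : MemLp f 2 volume) :
    HasSum (fun k => ‖coef f k‖ ^ 2) (∫ x, f x ^ 2) := by
  have h := hasSum_re_coef_mul hf hf
  simp only [← pow_two] at h
  convert h using 2
  rw [← Complex.normSq_eq_conj_mul_self, Complex.ofReal_re, Complex.normSq_eq_norm_sq]

theorem integrable_mFourier_mul {f : Torus2 → ℝ} (hf : MemLp f 2 volume) (k : Fin 2 → ℤ) :
    Integrable (fun x => UnitAddTorus.mFourier k x * (f x : ℂ)) := by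
  refine ((hf.integrable one_le_two).ofReal (𝕜 := ℂ)).bdd_mul (c := 1)
    (by fun_prop) (Eventually.of_forall fun x => ?_)
  exact ((UnitAddTorus.mFourier k).norm_coe_le_norm x).trans UnitAddTorus.mFourier_norm.le

theorem coef_add {f g : Torus2 → ℝ} (hf : MemLp f 2 volume) (hg : MemLp g 2 volume)
    (k : Fin 2 → ℤ) : coef (fun x => f x + g x) k = coef f k + coef g k := by
  unfold coef
  rw [← integral_add (integrable_mFourier_mul hf _) (integrable_mFourier_mul hg _)]
  congr 1
  funext x
  push_cast
  ring

theorem coef_const_mul (c : ℝ) (f : Torus2 → ℝ) (k : Fin 2 → ℤ) :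
    coef (fun x => c * f x) k = c * coef f k := by
  unfold coef
  rw [← integral_const_mul]
  congr 1
  funext x
  push_cast
  ring

theorem coef_sub {f g : Torus2 → ℝ} (hf : MemLp f 2 volume) (hg : MemLp g 2 volume)
    (k : Fin 2 → ℤ) : coef (fun x => f x - g x) k = coef f k - coef g k := by
  unfold coef
  rw [← integral_sub (integrable_mFourier_mul hf _) (integrable_mFourier_mul hg _)]
  congr 1
  funext x
  push_cast
  ring

theorem ae_eq_of_coef_eq {f g : Torus2 → ℝ} (hf : MemLp f 2 volume) (hg : MemLp g 2 volume)
    (h : ∀ k, coef f k = coef g k) : f =ᵐ[volume] g := by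
  have hs := hasSum_normSq_coef (hf.sub hg)
  have h0 : ∫ x, (f - g) x ^ 2 = 0 := by
    refine hs.unique ?_
    convert hasSum_zero with k
    have : coef (f - g) k = 0 := by
      have := coef_sub hf hg k
      rw [h k, sub_self] at this
      exact this
    rw [this]; simp
  rw [integral_eq_zero_iff_of_nonneg (fun x => sq_nonneg _) (hf.sub hg).integrable_sq] at h0
  filter_upwards [h0] with x hx
  have : (f - g) x = 0 := by simpa using hx
  simpa [sub_eq_zero] using this

theorem norm_coef_le {f : Torus2 → ℝ} (hf : MemLp f 2 volume) (k : Fin 2 → ℤ) :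
    ‖coef f k‖ ^ 2 ≤ ∫ x, f x ^ 2 :=
  le_hasSum (hasSum_normSq_coef hf) k fun _ _ => sq_nonneg _

end GraphMCF

namespace GraphMCF

open ComplexConjugate

/-! ### Translations, smooth functions and weak derivatives -/

/-- Translation of the torus by `s` in the `i`-th coordinate direction. -/
noncomputable def shift (i : Fin 2) (s : ℝ) (x : Torus2) : Torus2 :=
  x + Pi.single i (s : UnitAddCircle)

theorem measurePreserving_shift (i : Fin 2) (s : ℝ) :
    MeasurePreserving (shift i s) volume volume :=
  measurePreserving_add_right volume _

theorem integral_shift {E : Type*} [NormedAddCommGroup E] [NormedSpace ℝ E]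
    (i : Fin 2) (s : ℝ) (f : Torus2 → E) :
    ∫ x, f (shift i s x) = ∫ x, f x :=
  integral_add_right_eq_self f _

theorem mFourier_shift (k : Fin 2 → ℤ) (i : Fin 2) (s : ℝ) (x : Torus2) :
    UnitAddTorus.mFourier k (shift i s x) =
      Complex.exp (2 * Real.pi * Complex.I * k i * s) * UnitAddTorus.mFourier k x := by
  have h1 : ∀ j, fourier (k j) (shift i s x j) =
      fourier (k j) ((Pi.single i (s : UnitAddCircle) : Torus2) j) * fourier (k j) (x j) := by
    intro j
    simp only [shift, Pi.add_apply, fourier_apply, smul_add, AddCircle.toCircle_add,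
      Circle.coe_mul]
    ring
  simp only [UnitAddTorus.mFourier, ContinuousMap.coe_mk, h1, Finset.prod_mul_distrib]
  congr 1
  rw [Finset.prod_eq_single i]
  · rw [Pi.single_eq_same, fourier_coe_apply]
    simp
  · intro j _ hj
    rw [Pi.single_eq_of_ne hj]
    simp
  · simp

theorem coef_shift (f : Torus2 → ℝ) (i : Fin 2) (s : ℝ) (k : Fin 2 → ℤ) :
    coef (fun x => f (shift i s x)) k =
      Complex.exp (2 * Real.pi * Complex.I * k i * s) * coef f k := by
  unfold coef
  rw [← integral_const_mul,
    ← integral_shift i s (fun x => Complex.exp (2 * Real.pi * Complex.I * k i * s) *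
      (UnitAddTorus.mFourier (-k) x * (f x : ℂ)))]
  congr 1
  funext x
  rw [mFourier_shift, ← mul_assoc, ← mul_assoc, ← Complex.exp_add]
  simp

/-- The canonical projection of the plane onto the torus. -/
noncomputable def torusMk (y : Fin 2 → ℝ) : Torus2 := fun i => (y i : UnitAddCircle)

theorem isQuotientMap_torusMk : IsQuotientMap torusMk := by
  have : IsOpenQuotientMap torusMk :=
    IsOpenQuotientMap.piMap (fun _ : Fin 2 => QuotientAddGroup.isOpenQuotientMap_mk)
  exact this.isQuotientMap

theorem shift_torusMk (i : Fin 2) (s : ℝ) (y : Fin 2 → ℝ) :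
    shift i s (torusMk y) = torusMk (y + s • Pi.single i 1) := by
  funext j
  by_cases h : j = i
  · subst h; simp [shift, torusMk]
  · simp [shift, torusMk, h]

theorem hasDerivAt_smooth {φ : Torus2 → ℝ} (hφ : IsSmoothOnTorus φ) (i : Fin 2)
    (y : Fin 2 → ℝ) (s : ℝ) :
    HasDerivAt (fun s : ℝ => φ (shift i s (torusMk y)))
      (fderiv ℝ (fun y => φ (torusMk y)) (y + s • Pi.single i 1) (Pi.single i 1)) s := by
  have h1 : HasDerivAt (fun s : ℝ => y + s • (Pi.single i 1 : Fin 2 → ℝ)) (Pi.single i 1) s := by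
    simpa using ((hasDerivAt_id s).smul_const (Pi.single i 1 : Fin 2 → ℝ)).const_add y
  have h2 := (ContDiff.differentiable hφ (by simp)).differentiableAt
    (x := y + s • (Pi.single i 1 : Fin 2 → ℝ)) |>.hasFDerivAt
  simp only [shift_torusMk]
  exact h2.comp_hasDerivAt s h1

theorem torusPartial_torusMk {φ : Torus2 → ℝ} (hφ : IsSmoothOnTorus φ) (i : Fin 2)
    (y : Fin 2 → ℝ) :
    torusPartial i φ (torusMk y) = fderiv ℝ (fun y => φ (torusMk y)) y (Pi.single i 1) := by
  have := (hasDerivAt_smooth hφ i y 0).deriv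
  rw [zero_smul, add_zero] at this
  exact this

theorem continuous_of_smooth {φ : Torus2 → ℝ} (hφ : IsSmoothOnTorus φ) : Continuous φ :=
  isQuotientMap_torusMk.continuous_iff.2 hφ.continuous

theorem continuous_torusPartial {φ : Torus2 → ℝ} (hφ : IsSmoothOnTorus φ) (i : Fin 2) :
    Continuous (torusPartial i φ) := by
  refine isQuotientMap_torusMk.continuous_iff.2 ?_
  have : torusPartial i φ ∘ torusMk =
      fun y => fderiv ℝ (fun y => φ (torusMk y)) y (Pi.single i 1) :=
    funext fun y => torusPartial_torusMk hφ i y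
  rw [this]
  exact (hφ.continuous_fderiv (by simp)).clm_apply continuous_const

theorem hasDerivAt_shift {φ : Torus2 → ℝ} (hφ : IsSmoothOnTorus φ) (i : Fin 2) (x : Torus2)
    (s : ℝ) :
    HasDerivAt (fun s : ℝ => φ (shift i s x)) (torusPartial i φ (shift i s x)) s := by
  obtain ⟨y, rfl⟩ := isQuotientMap_torusMk.surjective x
  rw [shift_torusMk, torusPartial_torusMk hφ]
  exact hasDerivAt_smooth hφ i y s

theorem memLp_of_continuous {E : Type*} [NormedAddCommGroup E] [SecondCountableTopology E]
    {f : Torus2 → E} (hf : Continuous f) (p : ℝ≥0∞) : MemLp f p volume := by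
  borelize E
  obtain ⟨C, hC⟩ := (isCompact_range hf).isBounded.exists_norm_le
  exact .of_bound hf.aestronglyMeasurable C (Eventually.of_forall fun x => hC _ ⟨x, rfl⟩)

/-- The symbol `2πi kᵢ` of the `i`-th partial derivative. -/
noncomputable def symb (i : Fin 2) (k : Fin 2 → ℤ) : ℂ := 2 * Real.pi * Complex.I * k i

theorem conj_symb (i : Fin 2) (k : Fin 2 → ℤ) : conj (symb i k) = -symb i k := by
  simp [symb, Complex.conj_ofNat]

theorem symb_neg (i : Fin 2) (k : Fin 2 → ℤ) : symb i (-k) = -symb i k := by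
  simp [symb]

/-- `h` is the `i`-th weak partial derivative of `f`, expressed by Fourier coefficients. -/
def IsWeakPartial (i : Fin 2) (f h : Torus2 → ℝ) : Prop :=
  ∀ k, coef h k = symb i k * coef f k

/-- The Fourier multiplier of the difference quotient with increment `s`. -/
noncomputable def quotSymb (i : Fin 2) (k : Fin 2 → ℤ) (s : ℝ) : ℂ :=
  (s : ℂ)⁻¹ * (Complex.exp (symb i k * s) - 1)

theorem tendsto_quotSymb (i : Fin 2) (k : Fin 2 → ℤ) :
    Tendsto (quotSymb i k) (𝓝[≠] 0) (𝓝 (symb i k)) := by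
  have h : HasDerivAt (fun s : ℝ => Complex.exp (symb i k * s)) (symb i k) 0 := by
    have h1 : HasDerivAt (fun s : ℝ => symb i k * (s : ℂ)) (symb i k) 0 := by
      simpa using (Complex.ofRealCLM.hasDerivAt (x := (0 : ℝ))).const_mul (symb i k)
    simpa using h1.cexp
  have h2 := h.tendsto_slope_zero
  refine h2.congr fun s => ?_
  simp [quotSymb]

theorem norm_quotSymb_le (i : Fin 2) (k : Fin 2 → ℤ) (s : ℝ) :
    ‖quotSymb i k s‖ ≤ ‖symb i k‖ := by
  have h1 : symb i k * s = Complex.I * ((2 * Real.pi * k i * s : ℝ) : ℂ) := by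
    simp only [symb]; push_cast; ring
  have h2 : ‖symb i k‖ = ‖(2 * Real.pi * k i : ℝ)‖ := by
    simp [symb]
  unfold quotSymb
  rw [h1, norm_mul, norm_inv, Complex.norm_real, h2]
  rcases eq_or_ne s 0 with rfl | hs
  · simp
  · rw [inv_mul_le_iff₀ (norm_pos_iff.2 hs)]
    refine (Real.norm_exp_I_mul_ofReal_sub_one_le).trans ?_
    rw [norm_mul]
    exact (mul_comm _ _).le

/-- The difference quotient of `f` in the `i`-th direction with increment `s`. -/
noncomputable def diffQuot (i : Fin 2) (s : ℝ) (f : Torus2 → ℝ) (x : Torus2) : ℝ :=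
  s⁻¹ * (f (shift i s x) - f x)

theorem memLp_shift {E : Type*} [NormedAddCommGroup E] {f : Torus2 → E} {p : ℝ≥0∞}
    (hf : MemLp f p volume) (i : Fin 2) (s : ℝ) :
    MemLp (fun x => f (shift i s x)) p volume :=
  hf.comp_measurePreserving (measurePreserving_shift i s)

theorem memLp_diffQuot {f : Torus2 → ℝ} {p : ℝ≥0∞}
    (hf : MemLp f p volume) (i : Fin 2) (s : ℝ) : MemLp (diffQuot i s f) p volume :=
  ((memLp_shift hf i s).sub hf).const_mul _

theorem coef_diffQuot {f : Torus2 → ℝ} (hf : MemLp f 2 volume) (i : Fin 2) (s : ℝ)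
    (k : Fin 2 → ℤ) : coef (diffQuot i s f) k = quotSymb i k s * coef f k := by
  unfold diffQuot
  rw [coef_const_mul, coef_sub (memLp_shift hf i s) hf, coef_shift]
  unfold quotSymb symb
  push_cast
  ring

theorem tendsto_diffQuot_smooth {φ : Torus2 → ℝ} (hφ : IsSmoothOnTorus φ) (i : Fin 2)
    (x : Torus2) :
    Tendsto (fun s => diffQuot i s φ x) (𝓝[≠] 0) (𝓝 (torusPartial i φ x)) := by
  have h := (hasDerivAt_shift hφ i x 0).tendsto_slope_zero
  have h0 : shift i 0 x = x := by simp [shift]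
  simpa [diffQuot, h0] using h

theorem abs_diffQuot_smooth_le {φ : Torus2 → ℝ} (hφ : IsSmoothOnTorus φ) (i : Fin 2) :
    ∃ C, ∀ s x, ‖diffQuot i s φ x‖ ≤ C := by
  obtain ⟨C, hC⟩ := (isCompact_range (continuous_torusPartial hφ i)).isBounded.exists_norm_le
  have hC0 : 0 ≤ C := (norm_nonneg _).trans (hC _ ⟨0, rfl⟩)
  refine ⟨C, fun s x => ?_⟩
  have h := convex_univ.norm_image_sub_le_of_norm_hasDerivWithin_le (C := C)
    (fun t _ => (hasDerivAt_shift hφ i x t).hasDerivWithinAt)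
    (fun t _ => hC _ ⟨_, rfl⟩) (Set.mem_univ (0 : ℝ)) (Set.mem_univ s)
  have h0 : shift i 0 x = x := by simp [shift]
  rw [h0, sub_zero] at h
  unfold diffQuot
  rw [norm_mul, norm_inv]
  rcases eq_or_ne s 0 with rfl | hs
  · simpa using hC0
  · rw [inv_mul_le_iff₀ (norm_pos_iff.2 hs), mul_comm]
    exact h

theorem isWeakPartial_torusPartial {φ : Torus2 → ℝ} (hφ : IsSmoothOnTorus φ) (i : Fin 2) :
    IsWeakPartial i φ (torusPartial i φ) := by
  intro k
  have hm : MemLp φ 2 volume := memLp_of_continuous (continuous_of_smooth hφ) 2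
  obtain ⟨C, hC⟩ := abs_diffQuot_smooth_le hφ i
  have h1 : Tendsto (fun s => coef (diffQuot i s φ) k) (𝓝[≠] 0)
      (𝓝 (coef (torusPartial i φ) k)) := by
    refine tendsto_integral_filter_of_dominated_convergence (fun _ => C) ?_ ?_
      (integrable_const C) ?_
    · exact Eventually.of_forall fun s =>
        (integrable_mFourier_mul (memLp_diffQuot hm i s) _).aestronglyMeasurable
    · refine Eventually.of_forall fun s => Eventually.of_forall fun x => ?_
      rw [norm_mul, Complex.norm_real]
      calc _ ≤ 1 * ‖diffQuot i s φ x‖ := by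
            gcongr
            exact ((UnitAddTorus.mFourier (-k)).norm_coe_le_norm x).trans
              UnitAddTorus.mFourier_norm.le
        _ ≤ C := by rw [one_mul]; exact hC s x
    · refine Eventually.of_forall fun x => ?_
      exact ((Complex.continuous_ofReal.tendsto _).comp
        (tendsto_diffQuot_smooth hφ i x)).const_mul _
  refine tendsto_nhds_unique h1 ?_
  simp only [coef_diffQuot hm]
  exact (tendsto_quotSymb i k).mul_const _

theorem IsWeakPartial.integral_mul {i : Fin 2} {f h φ ψ : Torus2 → ℝ} (hf : MemLp f 2 volume)
    (hh : MemLp h 2 volume) (hφ : MemLp φ 2 volume) (hψ : MemLp ψ 2 volume)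
    (hfh : IsWeakPartial i f h) (hφψ : IsWeakPartial i φ ψ) :
    ∫ x, f x * ψ x = - ∫ x, h x * φ x := by
  refine (hasSum_re_coef_mul hf hψ).unique ?_
  refine (hasSum_re_coef_mul hh hφ).neg.congr_fun fun k => ?_
  rw [hfh k, hφψ k, map_mul, conj_symb, ← Complex.neg_re]
  congr 1
  ring

theorem isSmoothOnTorus_mFourier (k : Fin 2 → ℤ) :
    IsSmoothOnTorus (fun x => (UnitAddTorus.mFourier k x).re) ∧
    IsSmoothOnTorus (fun x => (UnitAddTorus.mFourier k x).im) := by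
  have h : ContDiff ℝ ((⊤ : ℕ∞) : WithTop ℕ∞)
      (fun y : Fin 2 → ℝ => UnitAddTorus.mFourier k (fun i => (y i : UnitAddCircle))) := by
    simp only [UnitAddTorus.mFourier, ContinuousMap.coe_mk, fourier_coe_apply]
    refine contDiff_prod fun j _ => ContDiff.cexp ?_
    refine ContDiff.div_const (contDiff_const.mul ?_) _
    exact Complex.ofRealCLM.contDiff.comp (contDiff_apply ℝ ℝ j)
  exact ⟨Complex.reCLM.contDiff.comp h, Complex.imCLM.contDiff.comp h⟩

theorem hasDerivAt_mFourier_shift (k : Fin 2 → ℤ) (i : Fin 2) (x : Torus2) :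
    HasDerivAt (fun s : ℝ => UnitAddTorus.mFourier k (shift i s x))
      (symb i k * UnitAddTorus.mFourier k x) 0 := by
  simp only [mFourier_shift]
  have h1 : HasDerivAt (fun s : ℝ => symb i k * (s : ℂ)) (symb i k) 0 := by
    simpa using (Complex.ofRealCLM.hasDerivAt (x := (0 : ℝ))).const_mul (symb i k)
  simpa [symb] using h1.cexp.mul_const (UnitAddTorus.mFourier k x)

theorem torusPartial_mFourier (k : Fin 2 → ℤ) (i : Fin 2) (x : Torus2) :
    torusPartial i (fun x => (UnitAddTorus.mFourier k x).re) x =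
      (symb i k * UnitAddTorus.mFourier k x).re ∧
    torusPartial i (fun x => (UnitAddTorus.mFourier k x).im) x =
      (symb i k * UnitAddTorus.mFourier k x).im := by
  have h := hasDerivAt_mFourier_shift k i x
  exact ⟨(Complex.reCLM.hasFDerivAt.comp_hasDerivAt (0 : ℝ) h).deriv,
    (Complex.imCLM.hasFDerivAt.comp_hasDerivAt (0 : ℝ) h).deriv⟩

theorem coef_eq_of_tests {f : Torus2 → ℝ} (hf : MemLp f 2 volume) (k : Fin 2 → ℤ) :
    (coef f k).re = ∫ x, f x * (UnitAddTorus.mFourier (-k) x).re ∧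
    (coef f k).im = ∫ x, f x * (UnitAddTorus.mFourier (-k) x).im := by
  have hi := integrable_mFourier_mul hf (-k)
  constructor
  · rw [coef, ← RCLike.re_eq_complex_re, ← integral_re hi]
    exact integral_congr_ae (Eventually.of_forall fun x => by simp [mul_comm])
  · rw [coef, ← RCLike.im_eq_complex_im, ← integral_im hi]
    exact integral_congr_ae (Eventually.of_forall fun x => by simp [mul_comm])

theorem integral_mul_torusPartial_mFourier {f : Torus2 → ℝ} (hf : MemLp f 2 volume)
    (k : Fin 2 → ℤ) (i : Fin 2) :
    (∫ x, f x * torusPartial i (fun x => (UnitAddTorus.mFourier (-k) x).re) x) =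
      -(symb i k * coef f k).re ∧
    (∫ x, f x * torusPartial i (fun x => (UnitAddTorus.mFourier (-k) x).im) x) =
      -(symb i k * coef f k).im := by
  have hi := (integrable_mFourier_mul hf (-k)).const_mul (-symb i k)
  simp only [fun x => (torusPartial_mFourier (-k) i x).1,
    fun x => (torusPartial_mFourier (-k) i x).2, symb_neg]
  rw [← Complex.neg_re, ← Complex.neg_im, ← neg_mul, coef, ← integral_const_mul]
  constructor
  · rw [← RCLike.re_eq_complex_re, ← integral_re hi]
    refine integral_congr_ae (Eventually.of_forall fun x => ?_)
    beta_reduce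
    rw [RCLike.re_eq_complex_re, ← mul_assoc, Complex.re_mul_ofReal, mul_comm]
  · rw [← RCLike.im_eq_complex_im, ← integral_im hi]
    refine integral_congr_ae (Eventually.of_forall fun x => ?_)
    beta_reduce
    rw [RCLike.im_eq_complex_im, ← mul_assoc, Complex.im_mul_ofReal, mul_comm]

theorem memLp_coord {α : Type*} {mα : MeasurableSpace α} {μ : Measure α} {p : ℝ≥0∞}
    {g : α → Plane} (hg : MemLp g p μ) (i : Fin 2) : MemLp (fun x => g x i) p μ :=
  (EuclideanSpace.proj (𝕜 := ℝ) i).comp_memLp' hg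

/-- The real and imaginary parts of the characters of the torus. -/
noncomputable def mode (j : (Fin 2 → ℤ) × Bool) (x : Torus2) : ℝ :=
  if j.2 then (UnitAddTorus.mFourier (-j.1) x).re else (UnitAddTorus.mFourier (-j.1) x).im

theorem isSmoothOnTorus_mode (j : (Fin 2 → ℤ) × Bool) : IsSmoothOnTorus (mode j) := by
  obtain ⟨k, b⟩ := j
  cases b
  · exact (isSmoothOnTorus_mFourier (-k)).2
  · exact (isSmoothOnTorus_mFourier (-k)).1

/-- Testing against real and imaginary parts of the characters suffices for the weak gradient. -/
theorem isWeakPartial_of_mode {f : Torus2 → ℝ} {g : Torus2 → Plane} (hf : MemLp f 2 volume)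
    (hg : MemLp g 2 volume)
    (h : ∀ j i, ∫ x, f x * torusPartial i (mode j) x = - ∫ x, g x i * mode j x) (i : Fin 2) :
    IsWeakPartial i f (fun x => g x i) := by
  intro k
  obtain ⟨e1, e2⟩ := integral_mul_torusPartial_mFourier hf k i
  obtain ⟨c1, c2⟩ := coef_eq_of_tests (memLp_coord hg i) k
  have h1 : ∫ x, f x * torusPartial i (fun x => (UnitAddTorus.mFourier (-k) x).re) x =
    - ∫ x, g x i * (UnitAddTorus.mFourier (-k) x).re := h (k, true) i
  have h2 : ∫ x, f x * torusPartial i (fun x => (UnitAddTorus.mFourier (-k) x).im) x =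
    - ∫ x, g x i * (UnitAddTorus.mFourier (-k) x).im := h (k, false) i
  rw [e1, ← c1, neg_inj] at h1
  rw [e2, ← c2, neg_inj] at h2
  exact (Complex.ext h1 h2).symm

theorem isWeakGradient_iff {f : Torus2 → ℝ} {g : Torus2 → Plane} (hf : MemLp f 2 volume)
    (hg : MemLp g 2 volume) :
    IsWeakGradient f g ↔ ∀ i, IsWeakPartial i f (fun x => g x i) := by
  refine ⟨fun h => isWeakPartial_of_mode hf hg fun j i => h _ (isSmoothOnTorus_mode j) i,
    fun h φ hφ i => ?_⟩
  exact (h i).integral_mul hf (memLp_coord hg i)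
    (memLp_of_continuous (continuous_of_smooth hφ) 2)
    (memLp_of_continuous (continuous_torusPartial hφ i) 2) (isWeakPartial_torusPartial hφ i)

theorem isWeakGradient_iff_mode {f : Torus2 → ℝ} {g : Torus2 → Plane} (hf : MemLp f 2 volume)
    (hg : MemLp g 2 volume) :
    IsWeakGradient f g ↔ ∀ j i, ∫ x, f x * torusPartial i (mode j) x = - ∫ x, g x i * mode j x :=
  ⟨fun h j i => h _ (isSmoothOnTorus_mode j) i,
    fun h => (isWeakGradient_iff hf hg).2 (isWeakPartial_of_mode hf hg h)⟩

theorem integral_sum_mul {f g : Fin 2 → Torus2 → ℝ} (hf : ∀ i, MemLp (f i) 2 volume)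
    (hg : ∀ i, MemLp (g i) 2 volume) :
    ∫ x, ∑ i, f i x * g i x = ∑ i, ∫ x, f i x * g i x :=
  integral_finsetSum _ fun i _ => (hf i).integrable_mul (hg i)

theorem hasSum_weakDivergence {F : Torus2 → Plane} {v φ : Torus2 → ℝ} {ψ : Torus2 → Plane}
    (hF : MemLp F 2 volume) (hv : MemLp v 2 volume) (hφ : MemLp φ 2 volume)
    (hψ : MemLp ψ 2 volume) (hφψ : ∀ i, IsWeakPartial i φ (fun x => ψ x i))
    (h : ∀ k, coef v k = ∑ i, symb i k * coef (fun x => F x i) k) :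
    ∫ x, ∑ i, F x i * ψ x i = - ∫ x, v x * φ x := by
  rw [integral_sum_mul (fun i => memLp_coord hF i) fun i => memLp_coord hψ i]
  refine (hasSum_sum fun i _ => hasSum_re_coef_mul (memLp_coord hF i) (memLp_coord hψ i)).unique ?_
  refine (hasSum_re_coef_mul hv hφ).neg.congr_fun fun k => ?_
  rw [h k, ← Complex.re_sum, ← Complex.neg_re]
  congr 1
  simp only [hφψ _ k, map_sum, map_mul, conj_symb, Finset.sum_mul, ← Finset.sum_neg_distrib]
  refine Finset.sum_congr rfl fun i _ => ?_
  ring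

theorem coef_eq_sum_of_mode {F : Torus2 → Plane} {v : Torus2 → ℝ} (hF : MemLp F 2 volume)
    (hv : MemLp v 2 volume)
    (h : ∀ j, ∫ x, ∑ i, F x i * torusPartial i (mode j) x = - ∫ x, v x * mode j x)
    (k : Fin 2 → ℤ) : coef v k = ∑ i, symb i k * coef (fun x => F x i) k := by
  obtain ⟨s1, s2⟩ := isSmoothOnTorus_mFourier (-k)
  obtain ⟨c1, c2⟩ := coef_eq_of_tests hv k
  have h1 : ∫ x, ∑ i, F x i * torusPartial i (fun x => (UnitAddTorus.mFourier (-k) x).re) x =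
    - ∫ x, v x * (UnitAddTorus.mFourier (-k) x).re := h (k, true)
  have h2 : ∫ x, ∑ i, F x i * torusPartial i (fun x => (UnitAddTorus.mFourier (-k) x).im) x =
    - ∫ x, v x * (UnitAddTorus.mFourier (-k) x).im := h (k, false)
  rw [integral_sum_mul (fun i => memLp_coord hF i)
    fun i => memLp_of_continuous (continuous_torusPartial s1 i) 2] at h1
  rw [integral_sum_mul (fun i => memLp_coord hF i)
    fun i => memLp_of_continuous (continuous_torusPartial s2 i) 2] at h2
  simp only [fun i => (integral_mul_torusPartial_mFourier (memLp_coord hF i) k i).1,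
    fun i => (integral_mul_torusPartial_mFourier (memLp_coord hF i) k i).2,
    Finset.sum_neg_distrib, neg_inj] at h1 h2
  rw [← c1, ← Complex.re_sum] at h1
  rw [← c2, ← Complex.im_sum] at h2
  exact (Complex.ext h1 h2).symm

theorem isWeakDivergence_iff {F : Torus2 → Plane} {v : Torus2 → ℝ} (hF : MemLp F 2 volume)
    (hv : MemLp v 2 volume) :
    IsWeakDivergence F v ↔ ∀ k, coef v k = ∑ i, symb i k * coef (fun x => F x i) k := by
  refine ⟨fun h => coef_eq_sum_of_mode hF hv fun j => h _ (isSmoothOnTorus_mode j),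
    fun h φ hφ => ?_⟩
  have hψ : Continuous fun x => (WithLp.toLp 2 fun i => torusPartial i φ x : Plane) :=
    (PiLp.continuous_toLp 2 _).comp (continuous_pi fun i => continuous_torusPartial hφ i)
  exact hasSum_weakDivergence hF hv (memLp_of_continuous (continuous_of_smooth hφ) 2)
    (memLp_of_continuous hψ 2) (fun i => isWeakPartial_torusPartial hφ i) h

theorem isWeakDivergence_iff_mode {F : Torus2 → Plane} {v : Torus2 → ℝ} (hF : MemLp F 2 volume)
    (hv : MemLp v 2 volume) :
    IsWeakDivergence F v ↔
      ∀ j, ∫ x, ∑ i, F x i * torusPartial i (mode j) x = - ∫ x, v x * mode j x :=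
  ⟨fun h j => h _ (isSmoothOnTorus_mode j),
    fun h => (isWeakDivergence_iff hF hv).2 (coef_eq_sum_of_mode hF hv h)⟩

/-- Integration by parts for a Sobolev function against a field with square integrable weak
divergence. -/
theorem integral_inner_weakGradient {F ψ : Torus2 → Plane} {v φ : Torus2 → ℝ}
    (hF : MemLp F 2 volume) (hv : MemLp v 2 volume) (hφ : MemLp φ 2 volume)
    (hψ : MemLp ψ 2 volume) (hφψ : IsWeakGradient φ ψ) (h : IsWeakDivergence F v) :
    ∫ x, inner ℝ (ψ x) (F x) = - ∫ x, v x * φ x := by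
  rw [← hasSum_weakDivergence hF hv hφ hψ ((isWeakGradient_iff hφ hψ).1 hφψ)
    ((isWeakDivergence_iff hF hv).1 h)]
  refine integral_congr_ae (Eventually.of_forall fun x => ?_)
  simp [PiLp.inner_apply]

end GraphMCF

namespace GraphMCF

open ComplexConjugate

/-! ### Square integrable limits of difference quotients -/

theorem integral_sq_eq_eLpNorm {α : Type*} {mα : MeasurableSpace α} {μ : Measure α} {f : α → ℝ}
    (hf : MemLp f 2 μ) : ∫ x, f x ^ 2 ∂μ = (eLpNorm f 2 μ).toReal ^ 2 := by
  have h := hf.eLpNorm_eq_integral_rpow_norm (by simp) (by simp)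
  have h0 : 0 ≤ ∫ x, f x ^ 2 ∂μ := integral_nonneg fun x => sq_nonneg _
  rw [h, ENNReal.toReal_ofReal (by positivity)]
  simp only [ENNReal.toReal_ofNat, Real.rpow_ofNat, Real.norm_eq_abs, sq_abs]
  rw [← Real.rpow_natCast, ← Real.rpow_mul h0]
  norm_num

theorem tendsto_eLpNorm_iff {α ι : Type*} {mα : MeasurableSpace α} {μ : Measure α}
    {l : Filter ι} {f : ι → α → ℝ} (hf : ∀ n, MemLp (f n) 2 μ) :
    Tendsto (fun n => eLpNorm (f n) 2 μ) l (𝓝 0) ↔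
      Tendsto (fun n => ∫ x, f n x ^ 2 ∂μ) l (𝓝 0) := by
  simp only [fun n => integral_sq_eq_eLpNorm (hf n)]
  rw [← ENNReal.toReal_zero, ← ENNReal.tendsto_toReal_iff (fun n => (hf n).2.ne) (by simp),
    ENNReal.toReal_zero]
  constructor
  · intro h
    simpa using h.pow 2
  · intro h
    have := h.sqrt
    simpa [Real.sqrt_sq] using this

/-- If `f` has the weak partial derivative `h`, its difference quotients converge to `h` in `L²`, by
dominated convergence on the Fourier side. -/
theorem tendsto_diffQuot {i : Fin 2} {f h : Torus2 → ℝ} (hf : MemLp f 2 volume)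
    (hh : MemLp h 2 volume) (hfh : IsWeakPartial i f h) :
    Tendsto (fun s => eLpNorm (diffQuot i s f - h) 2 volume) (𝓝[≠] 0) (𝓝 0) := by
  rw [tendsto_eLpNorm_iff fun s => (memLp_diffQuot hf i s).sub hh]
  have e : ∀ s, ∫ x, (diffQuot i s f - h) x ^ 2 =
      ∑' k, ‖(quotSymb i k s - symb i k) * coef f k‖ ^ 2 := by
    intro s
    rw [← (hasSum_normSq_coef ((memLp_diffQuot hf i s).sub hh)).tsum_eq]
    congr 1
    funext k
    rw [sub_mul, ← hfh k, ← coef_diffQuot hf, ← coef_sub (memLp_diffQuot hf i s) hh]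
    rfl
  simp only [e]
  have hz : (0 : ℝ) = ∑' k : Fin 2 → ℤ, (0 : ℝ) := by simp
  rw [hz]
  refine tendsto_tsum_of_dominated_convergence (bound := fun k => 4 * ‖coef h k‖ ^ 2)
    ((hasSum_normSq_coef hh).summable.mul_left 4) (fun k => ?_) (Eventually.of_forall fun s k => ?_)
  · have := (((tendsto_quotSymb i k).sub_const (symb i k)).mul_const (coef f k)).norm.pow 2
    simpa using this
  · rw [Real.norm_of_nonneg (by positivity), hfh k, norm_mul, norm_mul, mul_pow, mul_pow,
      ← mul_assoc]
    gcongr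
    have h1 : ‖quotSymb i k s - symb i k‖ ≤ 2 * ‖symb i k‖ :=
      (norm_sub_le _ _).trans (by linarith [norm_quotSymb_le i k s])
    calc _ ≤ (2 * ‖symb i k‖) ^ 2 := by gcongr
      _ = _ := by ring

/-- Conversely, an `L²` limit of difference quotients along some null sequence is the weak partial
derivative. -/
theorem isWeakPartial_of_tendsto {i : Fin 2} {f h : Torus2 → ℝ} (hf : MemLp f 2 volume)
    (hh : MemLp h 2 volume) {s : ℕ → ℝ} (hs : Tendsto s atTop (𝓝[≠] 0))
    (hlim : Tendsto (fun n => eLpNorm (diffQuot i (s n) f - h) 2 volume) atTop (𝓝 0)) :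
    IsWeakPartial i f h := by
  intro k
  rw [tendsto_eLpNorm_iff fun n => (memLp_diffQuot hf i _).sub hh] at hlim
  have h1 : Tendsto (fun n => ‖quotSymb i k (s n) * coef f k - coef h k‖ ^ 2) atTop (𝓝 0) := by
    refine squeeze_zero (fun n => sq_nonneg _) (fun n => ?_) hlim
    rw [← coef_diffQuot hf, ← coef_sub (memLp_diffQuot hf i _) hh]
    exact norm_coef_le ((memLp_diffQuot hf i _).sub hh) k
  have h2 : Tendsto (fun n => ‖quotSymb i k (s n) * coef f k - coef h k‖ ^ 2) atTop
      (𝓝 (‖symb i k * coef f k - coef h k‖ ^ 2)) :=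
    ((((tendsto_quotSymb i k).comp hs).mul_const _).sub_const _).norm.pow 2
  have h3 := tendsto_nhds_unique h1 h2
  have h4 : symb i k * coef f k - coef h k = 0 := by simpa using h3.symm
  exact (sub_eq_zero.1 h4).symm

/-- Continuity of superposition: a bounded continuous function of an `L²`-convergent sequence,
multiplied by an `L²`-convergent sequence. -/
theorem tendsto_eLpNorm_comp_mul {α E : Type*} {mα : MeasurableSpace α} {μ : Measure α}
    [NormedAddCommGroup E] {B : E → ℝ} (hB : Continuous B) {C : ℝ} (hC : ∀ p, |B p| ≤ C)
    {p : ℕ → α → E} {p₀ : α → E} (hp : ∀ n, AEStronglyMeasurable (p n) μ)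
    (hp₀ : AEStronglyMeasurable p₀ μ)
    (hpl : Tendsto (fun n => eLpNorm (p n - p₀) 2 μ) atTop (𝓝 0))
    {A : ℕ → α → ℝ} {A₀ : α → ℝ} (hA : ∀ n, AEStronglyMeasurable (A n) μ) (hA₀ : MemLp A₀ 2 μ)
    (hAl : Tendsto (fun n => eLpNorm (A n - A₀) 2 μ) atTop (𝓝 0)) :
    Tendsto (fun n => eLpNorm ((fun x => B (p n x) * A n x) - fun x => B (p₀ x) * A₀ x) 2 μ)
      atTop (𝓝 0) := by
  refine tendsto_of_subseq_tendsto fun ns hns => ?_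
  obtain ⟨ms, hms, hae⟩ := (tendstoInMeasure_of_tendsto_eLpNorm (p := 2) (by simp)
    (fun n => hp (ns n)) hp₀ (hpl.comp hns)).exists_seq_tendsto_ae
  refine ⟨ms, ?_⟩
  have hsub : Tendsto (fun n => ns (ms n)) atTop atTop := hns.comp hms.tendsto_atTop
  have hC0 : 0 ≤ C := (abs_nonneg _).trans (hC 0)
  -- `Bₙ Aₙ - B A = Bₙ (Aₙ - A) + (Bₙ - B) A`: the first part is small in norm, the second one
  -- is dominated by `2 C |A|`.
  have h1 : Tendsto (fun n => eLpNorm (fun x => B (p (ns (ms n)) x) *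
      (A (ns (ms n)) - A₀) x) 2 μ) atTop (𝓝 0) := by
    have h := ENNReal.Tendsto.const_mul (a := ENNReal.ofReal C) (hAl.comp hsub)
      (Or.inr (by simp))
    rw [mul_zero] at h
    refine tendsto_of_tendsto_of_tendsto_of_le_of_le tendsto_const_nhds h (fun n => zero_le)
      (fun n => ?_)
    refine eLpNorm_le_mul_eLpNorm_of_ae_le_mul (Eventually.of_forall fun x => ?_) 2
    rw [norm_mul]
    gcongr
    exact hC _
  have h2 : Tendsto (fun n => eLpNorm (fun x => (B (p (ns (ms n)) x) - B (p₀ x)) * A₀ x) 2 μ)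
      atTop (𝓝 0) := by
    have hmem : ∀ n, MemLp (fun x => (B (p (ns (ms n)) x) - B (p₀ x)) * A₀ x) 2 μ := by
      intro n
      refine hA₀.of_le_mul (c := 2 * C) (((hB.comp_aestronglyMeasurable (hp _)).sub
        (hB.comp_aestronglyMeasurable hp₀)).mul hA₀.1) (Eventually.of_forall fun x => ?_)
      rw [norm_mul]
      gcongr
      calc _ ≤ |B (p (ns (ms n)) x)| + |B (p₀ x)| := abs_sub _ _
        _ ≤ _ := by linarith [hC (p (ns (ms n)) x), hC (p₀ x)]
    rw [tendsto_eLpNorm_iff hmem]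
    have hz : (0 : ℝ) = ∫ x, (0 : ℝ) ∂μ := by simp
    rw [hz]
    refine tendsto_integral_of_dominated_convergence (fun x => 4 * C ^ 2 * A₀ x ^ 2)
      (fun n => (hmem n).integrable_sq.1) (hA₀.integrable_sq.const_mul _)
      (fun n => Eventually.of_forall fun x => ?_) ?_
    · rw [Real.norm_of_nonneg (sq_nonneg _), mul_pow]
      gcongr
      have h3 : |B (p (ns (ms n)) x) - B (p₀ x)| ≤ 2 * C := by
        calc _ ≤ |B (p (ns (ms n)) x)| + |B (p₀ x)| := abs_sub _ _
          _ ≤ _ := by linarith [hC (p (ns (ms n)) x), hC (p₀ x)]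
      calc _ = |B (p (ns (ms n)) x) - B (p₀ x)| ^ 2 := (sq_abs _).symm
        _ ≤ (2 * C) ^ 2 := by gcongr
        _ = _ := by ring
    · filter_upwards [hae] with x hx
      have h3 := ((((hB.tendsto _).comp hx).sub_const (B (p₀ x))).mul_const (A₀ x)).pow 2
      simpa using h3
  have h12 := h1.add h2
  rw [add_zero] at h12
  refine tendsto_of_tendsto_of_tendsto_of_le_of_le tendsto_const_nhds h12 (fun n => zero_le)
    (fun n => ?_)
  have e : ((fun x => B (p (ns (ms n)) x) * A (ns (ms n)) x) - fun x => B (p₀ x) * A₀ x) =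
      (fun x => B (p (ns (ms n)) x) * (A (ns (ms n)) - A₀) x) +
      fun x => (B (p (ns (ms n)) x) - B (p₀ x)) * A₀ x := by
    funext x
    simp only [Pi.sub_apply, Pi.add_apply]
    ring
  rw [e]
  refine eLpNorm_add_le ((hB.comp_aestronglyMeasurable (hp _)).mul ((hA _).sub hA₀.1))
    (((hB.comp_aestronglyMeasurable (hp _)).sub (hB.comp_aestronglyMeasurable hp₀)).mul hA₀.1)
    one_le_two

end GraphMCF

namespace GraphMCF

open ComplexConjugate

/-! ### The area density, the unit normal field and their chain rules -/

/-- The area density `H(p) = √(1 + |p|²)`. -/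
noncomputable def areaFn (p : Plane) : ℝ := √(1 + ‖p‖ ^ 2)

/-- The field `p ↦ p / H(p)`. -/
noncomputable def normalFn (p : Plane) : Plane := (areaFn p)⁻¹ • p

theorem continuous_areaFn : Continuous areaFn := by unfold areaFn; fun_prop

theorem areaFn_sq (p : Plane) : areaFn p ^ 2 = 1 + ‖p‖ ^ 2 := Real.sq_sqrt (by positivity)

theorem areaFn_pos (p : Plane) : 0 < areaFn p := Real.sqrt_pos.2 (by positivity)

theorem one_le_areaFn (p : Plane) : 1 ≤ areaFn p :=
  Real.one_le_sqrt.2 (by linarith [sq_nonneg ‖p‖])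

theorem norm_le_areaFn (p : Plane) : ‖p‖ ≤ areaFn p :=
  Real.le_sqrt_of_sq_le (by linarith)

theorem areaFn_le (p : Plane) : areaFn p ≤ 1 + ‖p‖ :=
  Real.sqrt_le_iff.2 ⟨by positivity, by nlinarith [norm_nonneg p]⟩

theorem continuous_normalFn : Continuous normalFn :=
  (continuous_areaFn.inv₀ fun p => (areaFn_pos p).ne').smul continuous_id

theorem norm_normalFn_le (p : Plane) : ‖normalFn p‖ ≤ 1 := by
  rw [normalFn, norm_smul, norm_inv, Real.norm_of_nonneg (areaFn_pos p).le,
    inv_mul_le_iff₀ (areaFn_pos p), mul_one]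
  exact norm_le_areaFn p

theorem normalFn_apply (p : Plane) (i : Fin 2) : normalFn p i = (areaFn p)⁻¹ * p i := rfl

theorem abs_apply_le_norm (p : Plane) (i : Fin 2) : |p i| ≤ ‖p‖ := PiLp.norm_apply_le p i

theorem abs_normalFn_le (p : Plane) (i : Fin 2) : |normalFn p i| ≤ 1 :=
  (abs_apply_le_norm _ i).trans (norm_normalFn_le p)

/-- The coefficient in the identity `H(q) - H(p) = ∑ⱼ Bⱼ(p, q) (qⱼ - pⱼ)`. -/
noncomputable def slopeFn (j : Fin 2) (pq : Plane × Plane) : ℝ :=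
  (pq.1 j + pq.2 j) / (areaFn pq.1 + areaFn pq.2)

theorem continuous_apply_plane (j : Fin 2) : Continuous fun p : Plane => p j :=
  (EuclideanSpace.proj (𝕜 := ℝ) j).continuous

theorem continuous_slopeFn (j : Fin 2) : Continuous (slopeFn j) := by
  have h1 := continuous_apply_plane j
  have h2 := continuous_areaFn
  exact ((h1.comp continuous_fst).add (h1.comp continuous_snd)).div
    ((h2.comp continuous_fst).add (h2.comp continuous_snd))
    fun p => (add_pos (areaFn_pos _) (areaFn_pos _)).ne'

theorem abs_slopeFn_le (j : Fin 2) (pq : Plane × Plane) : |slopeFn j pq| ≤ 1 := by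
  have h := add_pos (areaFn_pos pq.1) (areaFn_pos pq.2)
  rw [slopeFn, abs_div, abs_of_pos h, div_le_one h]
  exact (abs_add_le _ _).trans (add_le_add
    ((abs_apply_le_norm _ j).trans (norm_le_areaFn _))
    ((abs_apply_le_norm _ j).trans (norm_le_areaFn _)))

theorem slopeFn_diag (j : Fin 2) (p : Plane) : slopeFn j (p, p) = normalFn p j := by
  have h := (areaFn_pos p).ne'
  rw [slopeFn, normalFn_apply]
  field_simp

theorem norm_sq_plane (p : Plane) : ‖p‖ ^ 2 = ∑ j, p j ^ 2 := by
  rw [EuclideanSpace.norm_sq_eq]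
  simp

/-- The difference of two values of `H` in terms of the averaged slopes; applied to a difference
quotient of the gradient, it gives the chain rule. -/
theorem areaFn_sub (p q : Plane) :
    areaFn q - areaFn p = ∑ j, slopeFn j (p, q) * (q j - p j) := by
  have h := add_pos (areaFn_pos p) (areaFn_pos q)
  have e : ∑ j, slopeFn j (p, q) * (q j - p j) = (‖q‖ ^ 2 - ‖p‖ ^ 2) / (areaFn p + areaFn q) := by
    rw [norm_sq_plane, norm_sq_plane, ← Finset.sum_sub_distrib, Finset.sum_div]
    refine Finset.sum_congr rfl fun j _ => ?_
    simp only [slopeFn]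
    ring
  rw [e, eq_div_iff h.ne']
  linarith [areaFn_sq p, areaFn_sq q, sq_nonneg (areaFn p)]

/-- The analogue of `areaFn_sub` for the components of `p ↦ p / H(p)`. -/
theorem normalFn_sub (p q : Plane) (l : Fin 2) :
    normalFn q l - normalFn p l = (areaFn q)⁻¹ * (q l - p l) -
      ∑ j, normalFn p l * (areaFn q)⁻¹ * slopeFn j (p, q) * (q j - p j) := by
  have e : ∑ j, normalFn p l * (areaFn q)⁻¹ * slopeFn j (p, q) * (q j - p j) =
      normalFn p l * (areaFn q)⁻¹ * (areaFn q - areaFn p) := by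
    rw [areaFn_sub, Finset.mul_sum]
    exact Finset.sum_congr rfl fun j _ => by ring
  have h1 := (areaFn_pos p).ne'
  have h2 := (areaFn_pos q).ne'
  rw [e, normalFn_apply, normalFn_apply]
  field_simp
  ring

theorem abs_inv_areaFn_le (p : Plane) : |(areaFn p)⁻¹| ≤ 1 := by
  rw [abs_of_pos (inv_pos.2 (areaFn_pos p))]
  exact inv_le_one_of_one_le₀ (one_le_areaFn p)

section ChainRule

variable {i : Fin 2} {g : Torus2 → Plane} {A : Fin 2 → Torus2 → ℝ}

/-- A sequence of nonzero increments tending to zero. -/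
noncomputable def incr (n : ℕ) : ℝ := 1 / ((n : ℝ) + 1)

theorem tendsto_incr : Tendsto incr atTop (𝓝[≠] 0) := by
  refine tendsto_nhdsWithin_iff.2 ⟨tendsto_one_div_add_atTop_nhds_zero_nat, ?_⟩
  refine Eventually.of_forall fun n => ?_
  have : (0 : ℝ) < (n : ℝ) + 1 := by positivity
  exact (one_div_pos.2 this).ne'

theorem eLpNorm_plane_le {f : Torus2 → Plane} (hf : AEStronglyMeasurable f volume) :
    eLpNorm f 2 volume ≤ ∑ j, eLpNorm (fun x => f x j) 2 volume := by
  have hc : ∀ j, AEStronglyMeasurable (fun x => f x j) volume := fun j =>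
    (continuous_apply_plane j).comp_aestronglyMeasurable hf
  have h1 : eLpNorm f 2 volume ≤ eLpNorm (∑ j, fun x => |f x j|) 2 volume := by
    refine eLpNorm_mono_real fun x => ?_
    rw [Finset.sum_apply]
    refine abs_le_of_sq_le_sq' ?_ (Finset.sum_nonneg fun j _ => abs_nonneg _) |>.2
    rw [norm_sq_plane]
    simp only [Fin.sum_univ_two]
    nlinarith [abs_nonneg (f x 0), abs_nonneg (f x 1), sq_abs (f x 0), sq_abs (f x 1),
      mul_nonneg (abs_nonneg (f x 0)) (abs_nonneg (f x 1))]
  refine h1.trans ((eLpNorm_sum_le (fun j _ => (hc j).norm) one_le_two).trans ?_)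
  exact Finset.sum_le_sum fun j _ => (eLpNorm_norm _).le

/-- Translations converge in `L²` on functions with square integrable weak derivative. -/
theorem tendsto_shift_sub (hg : MemLp g 2 volume) (hA : ∀ j, MemLp (A j) 2 volume)
    (h : ∀ j, IsWeakPartial i (fun x => g x j) (A j)) :
    Tendsto (fun n => eLpNorm ((fun x => g (shift i (incr n) x)) - g) 2 volume) atTop (𝓝 0) := by
  have hj : ∀ j, Tendsto (fun n => eLpNorm (fun x => g (shift i (incr n) x) j - g x j) 2 volume)
      atTop (𝓝 0) := by
    intro j
    have hgj := memLp_coord hg j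
    have h1 := (tendsto_diffQuot hgj (hA j) (h j)).comp tendsto_incr
    have h2 : Tendsto (fun n => ‖incr n‖ₑ) atTop (𝓝 0) := by
      have := (tendsto_incr.mono_right nhdsWithin_le_nhds).enorm
      simpa using this
    have h3 := ENNReal.Tendsto.mul h2 (Or.inr (by simpa using (hA j).2.ne))
      (h1.add_const (eLpNorm (A j) 2 volume)) (Or.inr (by simp))
    rw [zero_mul] at h3
    refine tendsto_of_tendsto_of_tendsto_of_le_of_le tendsto_const_nhds h3 (fun n => zero_le)
      (fun n => ?_)
    have hne : incr n ≠ 0 := by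
      have : (0 : ℝ) < (n : ℝ) + 1 := by positivity
      exact (one_div_pos.2 this).ne'
    have e : (fun x => g (shift i (incr n) x) j - g x j) =
        incr n • ((diffQuot i (incr n) (fun x => g x j) - A j) + A j) := by
      funext x
      simp [diffQuot, mul_inv_cancel_left₀ hne]
    rw [e, eLpNorm_const_smul]
    exact mul_le_mul_right (eLpNorm_add_le ((memLp_diffQuot hgj i _).sub (hA j)).1 (hA j).1
      one_le_two) _
  have hs := tendsto_finsetSum Finset.univ fun j (_ : j ∈ Finset.univ) => hj j
  simp only [Finset.sum_const_zero] at hs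
  exact tendsto_of_tendsto_of_tendsto_of_le_of_le tendsto_const_nhds hs (fun n => zero_le)
    fun n => eLpNorm_plane_le ((memLp_shift hg i _).sub hg).1

/-- The sum of finitely many superpositions as in `tendsto_eLpNorm_comp_mul`, along the pair of a
field and its translate and the difference quotients of the field. -/
theorem tendsto_slope_mul (hg : MemLp g 2 volume) (hA : ∀ j, MemLp (A j) 2 volume)
    (h : ∀ j, IsWeakPartial i (fun x => g x j) (A j)) {B : Fin 2 → Plane × Plane → ℝ}
    (hB : ∀ j, Continuous (B j)) {C : ℝ} (hC : ∀ j p, |B j p| ≤ C) :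
    Tendsto (fun n => eLpNorm ((fun x => ∑ j, B j (g x, g (shift i (incr n) x)) *
      diffQuot i (incr n) (fun x => g x j) x) - fun x => ∑ j, B j (g x, g x) * A j x) 2 volume)
      atTop (𝓝 0) := by
  have hsm : ∀ n, MemLp (fun x => g (shift i (incr n) x)) 2 volume := fun n => memLp_shift hg i _
  have hp : Tendsto (fun n => eLpNorm ((fun x => (g x, g (shift i (incr n) x))) -
      fun x => (g x, g x)) 2 volume) atTop (𝓝 0) := by
    refine (tendsto_shift_sub hg hA h).congr fun n => ?_
    refine eLpNorm_congr_norm_ae (Eventually.of_forall fun x => ?_)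
    simp [Prod.norm_def]
  have hj := fun j => tendsto_eLpNorm_comp_mul (hB j) (hC j)
    (fun n => hg.1.prodMk (hsm n).1) (hg.1.prodMk hg.1) hp
    (fun n => (memLp_diffQuot (memLp_coord hg j) i (incr n)).1) (hA j)
    ((tendsto_diffQuot (memLp_coord hg j) (hA j) (h j)).comp tendsto_incr)
  have hs := tendsto_finsetSum Finset.univ fun j (_ : j ∈ Finset.univ) => hj j
  simp only [Finset.sum_const_zero] at hs
  refine tendsto_of_tendsto_of_tendsto_of_le_of_le tendsto_const_nhds hs (fun n => zero_le)
    fun n => ?_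
  have hm : ∀ j, AEStronglyMeasurable ((fun x => B j (g x, g (shift i (incr n) x)) *
      diffQuot i (incr n) (fun x => g x j) x) - fun x => B j (g x, g x) * A j x) volume :=
    fun j => (((hB j).comp_aestronglyMeasurable (hg.1.prodMk (hsm n).1)).mul
      (memLp_diffQuot (memLp_coord hg j) i (incr n)).1).sub
      (((hB j).comp_aestronglyMeasurable (hg.1.prodMk hg.1)).mul (hA j).1)
  refine le_trans (le_of_eq ?_) (eLpNorm_sum_le (fun j _ => hm j) one_le_two)
  congr 1
  funext x
  simp only [Pi.sub_apply, Finset.sum_apply, Finset.sum_sub_distrib]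

theorem memLp_bdd_mul {α : Type*} {mα : MeasurableSpace α} {μ : Measure α} {b f : α → ℝ} {C : ℝ}
    (hb : AEStronglyMeasurable b μ) (hC : ∀ x, |b x| ≤ C) (hf : MemLp f 2 μ) :
    MemLp (fun x => b x * f x) 2 μ := by
  refine hf.of_le_mul (c := C) (hb.mul hf.1) (Eventually.of_forall fun x => ?_)
  rw [norm_mul]
  gcongr
  exact hC x

theorem memLp_area (hg : MemLp g 2 volume) : MemLp (fun x => areaFn (g x)) 2 volume := by
  refine MemLp.of_le (g := fun x => 1 + ‖g x‖) ((memLp_const (1 : ℝ)).add hg.norm)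
    (continuous_areaFn.comp_aestronglyMeasurable hg.1) (Eventually.of_forall fun x => ?_)
  rw [Real.norm_of_nonneg (areaFn_pos _).le, Real.norm_of_nonneg (by positivity)]
  exact areaFn_le _

theorem memLp_normal (hg : MemLp g 2 volume) : MemLp (fun x => normalFn (g x)) 2 volume :=
  .of_bound (continuous_normalFn.comp_aestronglyMeasurable hg.1) 1
    (Eventually.of_forall fun _ => norm_normalFn_le _)

/-- Chain rule for `H(g)`, with `A j` the `i`-th partial derivative of the `j`-th component of `g`. -/
theorem isWeakPartial_area (hg : MemLp g 2 volume) (hA : ∀ j, MemLp (A j) 2 volume)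
    (h : ∀ j, IsWeakPartial i (fun x => g x j) (A j)) :
    IsWeakPartial i (fun x => areaFn (g x)) (fun x => ∑ j, normalFn (g x) j * A j x) := by
  have hl := tendsto_slope_mul hg hA h continuous_slopeFn abs_slopeFn_le
  refine isWeakPartial_of_tendsto (memLp_area hg) ?_ tendsto_incr (hl.congr fun n => ?_)
  · exact memLp_finsetSum _ fun j _ => memLp_bdd_mul
      (memLp_coord (memLp_normal hg) j).1 (fun _ => abs_normalFn_le _ j) (hA j)
  · congr 1
    funext x
    simp only [Pi.sub_apply, slopeFn_diag, diffQuot, areaFn_sub, Finset.mul_sum]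
    congr 1
    exact Finset.sum_congr rfl fun j _ => by ring

/-- Chain rule for the components of `g / H(g)`. -/
theorem isWeakPartial_normal (hg : MemLp g 2 volume) (hA : ∀ j, MemLp (A j) 2 volume)
    (h : ∀ j, IsWeakPartial i (fun x => g x j) (A j)) (l : Fin 2) :
    IsWeakPartial i (fun x => normalFn (g x) l) (fun x => ∑ j,
      ((if j = l then (areaFn (g x))⁻¹ else 0) -
        normalFn (g x) l * (areaFn (g x))⁻¹ * normalFn (g x) j) * A j x) := by
  have hcn : ∀ j, Continuous fun p : Plane × Plane => normalFn p.1 j := fun j =>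
    (continuous_apply_plane j).comp (continuous_normalFn.comp continuous_fst)
  have hca : Continuous fun p : Plane × Plane => (areaFn p.2)⁻¹ :=
    (continuous_areaFn.inv₀ fun p => (areaFn_pos p).ne').comp continuous_snd
  have hB : ∀ j : Fin 2, Continuous fun p : Plane × Plane =>
      (if j = l then (areaFn p.2)⁻¹ else 0) -
        normalFn p.1 l * (areaFn p.2)⁻¹ * slopeFn j p := by
    intro j
    refine Continuous.sub ?_ (((hcn l).mul hca).mul (continuous_slopeFn j))
    split_ifs
    · exact hca
    · exact continuous_const
  have hC : ∀ (j : Fin 2) (p : Plane × Plane), |(if j = l then (areaFn p.2)⁻¹ else 0) -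
        normalFn p.1 l * (areaFn p.2)⁻¹ * slopeFn j p| ≤ 2 := by
    intro j p
    refine (abs_sub _ _).trans ?_
    have h1 : |if j = l then (areaFn p.2)⁻¹ else 0| ≤ 1 := by
      split_ifs
      · exact abs_inv_areaFn_le _
      · simp
    have h2 : |normalFn p.1 l * (areaFn p.2)⁻¹ * slopeFn j p| ≤ 1 := by
      rw [abs_mul, abs_mul]
      exact mul_le_one₀ (mul_le_one₀ (abs_normalFn_le _ _) (abs_nonneg _) (abs_inv_areaFn_le _))
        (abs_nonneg _) (abs_slopeFn_le _ _)
    linarith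
  have hl := tendsto_slope_mul hg hA h hB hC
  simp only [slopeFn_diag] at hl
  refine isWeakPartial_of_tendsto (memLp_coord (memLp_normal hg) l) ?_ tendsto_incr
    (hl.congr fun n => ?_)
  · refine memLp_finsetSum _ fun j _ => memLp_bdd_mul (C := 2) ?_ (fun x => ?_) (hA j)
    · exact ((hB j).comp_aestronglyMeasurable (hg.1.prodMk hg.1)).congr
        (Eventually.of_forall fun x => by simp [slopeFn_diag])
    · simpa [slopeFn_diag] using hC j (g x, g x)
  · congr 1
    funext x
    simp only [Pi.sub_apply, diffQuot, normalFn_sub]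
    congr 1
    fin_cases l <;> simp [Fin.sum_univ_two] <;> ring

end ChainRule

end GraphMCF

namespace GraphMCF

open ComplexConjugate

/-! ### Mean curvature and the energy inequality in `H²` -/

theorem toL2_coeFn {E : Type} [NormedAddCommGroup E] {f : Torus2 → E} (hf : MemLp f 2 volume) :
    toL2 f =ᵐ[volume] f := by
  unfold toL2
  rw [dif_pos hf]
  exact hf.coeFn_toLp

theorem toL2_eq {E : Type} [NormedAddCommGroup E] {f : Torus2 → E} (hf : MemLp f 2 volume) :
    toL2 f = hf.toLp f := by
  unfold toL2
  rw [dif_pos hf]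

theorem toL2_congr {E : Type} [NormedAddCommGroup E] {f g : Torus2 → E}
    (h : f =ᵐ[volume] g) : toL2 f = toL2 g := by
  unfold toL2
  by_cases hf : MemLp f 2 volume
  · have hg : MemLp g 2 volume := (memLp_congr_ae h).1 hf
    rw [dif_pos hf, dif_pos hg]
    exact (MemLp.toLp_eq_toLp_iff hf hg).2 h
  · rw [dif_neg hf, dif_neg fun hg => hf ((memLp_congr_ae h).2 hg)]

theorem memLp_L2 {E : Type} [NormedAddCommGroup E] (f : L2 E) : MemLp f 2 volume := Lp.memLp f

theorem H2.area_eq (z : H2) (x : Torus2) : z.area x = areaFn (z.grad x) := rfl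

theorem isWeakPartial_grad (z : H2) (j : Fin 2) :
    IsWeakPartial j z.fn (fun x => z.grad x j) :=
  (isWeakGradient_iff (memLp_L2 _) (memLp_L2 _)).1 z.2.1 j

theorem isWeakPartial_hess (z : H2) (i j : Fin 2) :
    IsWeakPartial i (fun x => z.grad x j) (fun x => z.hess j x i) :=
  (isWeakGradient_iff (memLp_coord (memLp_L2 _) j) (memLp_L2 _)).1 (z.2.2 j) i

theorem memLp_hess (z : H2) (i j : Fin 2) : MemLp (fun x => z.hess i x j) 2 volume :=
  memLp_coord (memLp_L2 _) j

theorem coef_hess (z : H2) (i j : Fin 2) (k : Fin 2 → ℤ) :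
    coef (fun x => z.hess j x i) k = symb i k * (symb j k * coef z.fn k) := by
  rw [isWeakPartial_hess z i j k, isWeakPartial_grad z j k]

theorem hess_symm (z : H2) : (fun x => z.hess 0 x 1) =ᵐ[volume] fun x => z.hess 1 x 0 := by
  refine ae_eq_of_coef_eq (memLp_hess z 0 1) (memLp_hess z 1 0) fun k => ?_
  rw [coef_hess, coef_hess]
  ring

/-- The trace of the Hessian. -/
noncomputable def trHess (z : H2) (x : Torus2) : ℝ := ∑ i, z.hess i x i

/-- The second derivative `D²z(ν, ν)` in direction of `ν = ∇z / H(∇z)`. -/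
noncomputable def normalHess (z : H2) (x : Torus2) : ℝ :=
  ∑ i, ∑ j, normalFn (z.grad x) i * normalFn (z.grad x) j * z.hess j x i

/-- The partial derivatives of `H(∇z)`. -/
noncomputable def areaPartial (z : H2) (i : Fin 2) (x : Torus2) : ℝ :=
  ∑ j, normalFn (z.grad x) j * z.hess j x i

theorem memLp_trHess (z : H2) : MemLp (trHess z) 2 volume :=
  memLp_finsetSum _ fun i _ => memLp_hess z i i

theorem continuous_normalFn_apply (i : Fin 2) : Continuous fun p => normalFn p i :=
  (continuous_apply_plane i).comp continuous_normalFn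

theorem abs_normalFn_mul_le (p : Plane) (i j : Fin 2) : |normalFn p i * normalFn p j| ≤ 1 := by
  rw [abs_mul]
  exact mul_le_one₀ (abs_normalFn_le _ _) (abs_nonneg _) (abs_normalFn_le _ _)

theorem memLp_normalHess (z : H2) : MemLp (normalHess z) 2 volume := by
  refine memLp_finsetSum _ fun i _ => memLp_finsetSum _ fun j _ => ?_
  exact memLp_bdd_mul (((continuous_normalFn_apply i).mul
    (continuous_normalFn_apply j)).comp_aestronglyMeasurable (memLp_L2 z.grad).1)
    (fun _ => abs_normalFn_mul_le _ i j) (memLp_hess z j i)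

theorem memLp_areaPartial (z : H2) (i : Fin 2) : MemLp (areaPartial z i) 2 volume :=
  memLp_finsetSum _ fun j _ => memLp_bdd_mul
    ((continuous_normalFn_apply j).comp_aestronglyMeasurable (memLp_L2 z.grad).1)
    (fun _ => abs_normalFn_le _ j) (memLp_hess z j i)

theorem isWeakPartial_areaPartial (z : H2) (i : Fin 2) :
    IsWeakPartial i (fun x => areaFn (z.grad x)) (areaPartial z i) :=
  isWeakPartial_area (memLp_L2 _) (fun j => memLp_hess z j i) fun j => isWeakPartial_hess z i j

theorem coef_finsetSum {f : Fin 2 → Torus2 → ℝ} (hf : ∀ i, MemLp (f i) 2 volume)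
    (k : Fin 2 → ℤ) : coef (fun x => ∑ i, f i x) k = ∑ i, coef (f i) k := by
  simp only [Fin.sum_univ_two]
  exact coef_add (hf 0) (hf 1) k

theorem isWeakDivergence_unique {F : Torus2 → Plane} {v w : Torus2 → ℝ} (hF : MemLp F 2 volume)
    (hv : MemLp v 2 volume) (hw : MemLp w 2 volume) (h : IsWeakDivergence F v)
    (h' : IsWeakDivergence F w) : v =ᵐ[volume] w :=
  ae_eq_of_coef_eq hv hw fun k => by
    rw [(isWeakDivergence_iff hF hv).1 h k, (isWeakDivergence_iff hF hw).1 h' k]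

/-- The `l`-th summand of `div (∇z / H(∇z))`. -/
noncomputable def curvPart (z : H2) (l : Fin 2) (x : Torus2) : ℝ :=
  ∑ j, ((if j = l then (areaFn (z.grad x))⁻¹ else 0) -
    normalFn (z.grad x) l * (areaFn (z.grad x))⁻¹ * normalFn (z.grad x) j) * z.hess j x l

theorem memLp_curvPart (z : H2) (l : Fin 2) : MemLp (curvPart z l) 2 volume := by
  refine memLp_finsetSum _ fun j _ => memLp_bdd_mul (C := 2) ?_ (fun x => ?_) (memLp_hess z j l)
  · have hc : Continuous fun p : Plane => (areaFn p)⁻¹ :=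
      continuous_areaFn.inv₀ fun p => (areaFn_pos p).ne'
    refine Continuous.comp_aestronglyMeasurable (g := fun p : Plane =>
      (if j = l then (areaFn p)⁻¹ else 0) - normalFn p l * (areaFn p)⁻¹ * normalFn p j) ?_
      (memLp_L2 z.grad).1
    refine Continuous.sub ?_ (((continuous_normalFn_apply l).mul hc).mul
      (continuous_normalFn_apply j))
    split_ifs
    · exact hc
    · exact continuous_const
  · refine (abs_sub _ _).trans ?_
    have h1 : |if j = l then (areaFn (z.grad x))⁻¹ else 0| ≤ 1 := by
      split_ifs
      · exact abs_inv_areaFn_le _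
      · simp
    have h2 : |normalFn (z.grad x) l * (areaFn (z.grad x))⁻¹ * normalFn (z.grad x) j| ≤ 1 := by
      rw [abs_mul, abs_mul]
      exact mul_le_one₀ (mul_le_one₀ (abs_normalFn_le _ _) (abs_nonneg _) (abs_inv_areaFn_le _))
        (abs_nonneg _) (abs_normalFn_le _ _)
    linarith

theorem memLp_z_normal (z : H2) : MemLp z.normal 2 volume := memLp_normal (memLp_L2 z.grad)

theorem isWeakDivergence_curvPart (z : H2) :
    IsWeakDivergence z.normal (fun x => ∑ l, curvPart z l x) := by
  refine (isWeakDivergence_iff (memLp_z_normal z)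
    (memLp_finsetSum _ fun l _ => memLp_curvPart z l)).2 fun k => ?_
  rw [coef_finsetSum (memLp_curvPart z)]
  refine Finset.sum_congr rfl fun l _ => ?_
  exact isWeakPartial_normal (memLp_L2 _) (fun j => memLp_hess z j l)
    (fun j => isWeakPartial_hess z l j) l k

theorem isWeakDivergence_congr {F : Torus2 → Plane} {v w : Torus2 → ℝ} (h : v =ᵐ[volume] w)
    (hv : IsWeakDivergence F v) : IsWeakDivergence F w := by
  intro φ hφ
  rw [hv φ hφ]
  congr 1
  refine integral_congr_ae ?_
  filter_upwards [h] with x hx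
  rw [hx]

theorem isWeakDivergence_curv (z : H2) : IsWeakDivergence z.normal z.curv := by
  have h : ∃ v : L2 ℝ, IsWeakDivergence z.normal v := by
    have hm : MemLp (fun x => ∑ l, curvPart z l x) 2 volume :=
      memLp_finsetSum _ fun l _ => memLp_curvPart z l
    exact ⟨hm.toLp _, isWeakDivergence_congr hm.coeFn_toLp.symm (isWeakDivergence_curvPart z)⟩
  unfold H2.curv weakDiv
  rw [dif_pos h]
  exact h.choose_spec

/-- The curvature term is `Δz - D²z(ν, ν)`. -/
theorem area_mul_curv_ae_eq (z : H2) :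
    (fun x => z.area x * z.curv x) =ᵐ[volume] fun x => trHess z x - normalHess z x := by
  have h := isWeakDivergence_unique (memLp_z_normal z) (memLp_L2 z.curv)
    (memLp_finsetSum _ fun l _ => memLp_curvPart z l) (isWeakDivergence_curv z)
    (isWeakDivergence_curvPart z)
  filter_upwards [h] with x hx
  rw [hx, H2.area_eq]
  have h0 := (areaFn_pos (z.grad x)).ne'
  simp only [curvPart, trHess, normalHess, Fin.sum_univ_two]
  simp only [Fin.isValue, if_true, one_ne_zero, zero_ne_one, if_false]
  field_simp
  ring

/-- The drift `(1/2 + ε) Δz + 1/2 H(∇z) div(∇z / H(∇z))`. -/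
noncomputable def drift (ε : ℝ) (z : H2) (x : Torus2) : ℝ :=
  (1 / 2 + ε) * trHess z x + 1 / 2 * (trHess z x - normalHess z x)

theorem memLp_drift (ε : ℝ) (z : H2) : MemLp (drift ε z) 2 volume :=
  ((memLp_trHess z).const_mul _).add (((memLp_trHess z).sub (memLp_normalHess z)).const_mul _)

/-- The symbol of `-Δ`. -/
noncomputable def lapSymb (k : Fin 2 → ℤ) : ℝ := ∑ i, ‖symb i k‖ ^ 2

theorem coef_trHess (z : H2) (k : Fin 2 → ℤ) : coef (trHess z) k = -lapSymb k * coef z.fn k := by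
  have h : coef (trHess z) k = ∑ i, symb i k * (symb i k * coef z.fn k) := by
    have := coef_finsetSum (fun i => memLp_hess z i i) k
    simp only [coef_hess] at this
    exact this
  rw [h, lapSymb, Complex.ofReal_sum, neg_mul, Finset.sum_mul, ← Finset.sum_neg_distrib]
  refine Finset.sum_congr rfl fun i _ => ?_
  rw [← Complex.normSq_eq_norm_sq, Complex.normSq_eq_conj_mul_self, conj_symb]
  ring

/-- The contribution of the `k`-th Fourier mode to the time derivative of `E ‖∇u‖²`. -/
noncomputable def energyTerm (ε : ℝ) (z : H2) (k : Fin 2 → ℤ) : ℝ :=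
  lapSymb k * (2 * (conj (coef z.fn k) * coef (drift ε z) k).re +
    ‖coef (fun x => areaFn (z.grad x)) k‖ ^ 2)

theorem energyTerm_eq (ε : ℝ) (z : H2) (k : Fin 2 → ℤ) :
    energyTerm ε z k = -2 * (conj (coef (trHess z) k) * coef (drift ε z) k).re +
      ∑ i, ‖coef (areaPartial z i) k‖ ^ 2 := by
  simp only [fun i => isWeakPartial_areaPartial z i k, norm_mul, mul_pow, ← Finset.sum_mul]
  have e : conj (-(lapSymb k : ℂ) * coef z.fn k) * coef (drift ε z) k =
      ((-lapSymb k : ℝ) : ℂ) * (conj (coef z.fn k) * coef (drift ε z) k) := by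
    rw [map_mul, map_neg, Complex.conj_ofReal]
    push_cast
    ring
  rw [coef_trHess, e, energyTerm, Complex.re_ofReal_mul, lapSymb]
  ring

/-- The pointwise inequality behind the energy estimate: for a symmetric matrix
`A = (a b; b d)` and a vector `ν = (x, y)` with `|ν| ≤ 1`, up to a multiple of the null Lagrangian
`det A`, the second-order terms have a sign. -/
theorem pointwise_energy {a b d x y ε : ℝ} (hε : 0 ≤ ε) (h : x ^ 2 + y ^ 2 ≤ 1) :
    -2 * ((a + d) * ((1 / 2 + ε) * (a + d) +
      1 / 2 * ((a + d) - (x * x * a + 2 * (x * y * b) + y * y * d)))) +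
      ((x * a + y * b) ^ 2 + (x * b + y * d) ^ 2) ≤ -3 * (a * d - b * b) := by
  -- By Cayley-Hamilton the difference of both sides is `2 |cof(A) ν|²` plus nonnegative terms.
  have h0 : 0 ≤ 2 * a ^ 2 + 2 * d ^ 2 + a * d + 3 * b ^ 2 := by
    nlinarith [sq_nonneg (a + d), sq_nonneg a, sq_nonneg d, sq_nonneg b]
  have h1 : 0 ≤ (1 - (x ^ 2 + y ^ 2)) * (2 * a ^ 2 + 2 * d ^ 2 + a * d + 3 * b ^ 2) :=
    mul_nonneg (by linarith) h0
  have h2 : 0 ≤ 2 * ((d * x - b * y) ^ 2 + (a * y - b * x) ^ 2) := by positivity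
  have h3 : 0 ≤ 2 * (ε * (a + d) ^ 2) := by positivity
  nlinarith

/-- The determinant is a null Lagrangian: by Parseval, both products have the same Fourier symbol. -/
theorem integral_det_hess (z : H2) :
    ∫ x, (z.hess 0 x 0 * z.hess 1 x 1 - z.hess 0 x 1 * z.hess 1 x 0) = 0 := by
  have hi0 : Integrable fun x => z.hess 0 x 0 * z.hess 1 x 1 :=
    (memLp_hess z 0 0).integrable_mul (memLp_hess z 1 1)
  have hi1 : Integrable fun x => z.hess 0 x 1 * z.hess 1 x 0 :=
    (memLp_hess z 0 1).integrable_mul (memLp_hess z 1 0)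
  rw [integral_sub hi0 hi1, sub_eq_zero]
  refine (hasSum_re_coef_mul (memLp_hess z 0 0) (memLp_hess z 1 1)).unique ?_
  refine (hasSum_re_coef_mul (memLp_hess z 0 1) (memLp_hess z 1 0)).congr_fun fun k => ?_
  simp only [coef_hess, map_mul, conj_symb]
  congr 1
  ring

theorem hasSum_energyTerm (ε : ℝ) (z : H2) :
    HasSum (energyTerm ε z) (∫ x, (-2 * (trHess z x * drift ε z x) +
      (areaPartial z 0 x ^ 2 + areaPartial z 1 x ^ 2))) := by
  have h1 := (hasSum_re_coef_mul (memLp_trHess z) (memLp_drift ε z)).mul_left (-2)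
  have h2 := (hasSum_normSq_coef (memLp_areaPartial z 0)).add
    (hasSum_normSq_coef (memLp_areaPartial z 1))
  have hi0 := (memLp_areaPartial z 0).integrable_sq
  have hi1 := (memLp_areaPartial z 1).integrable_sq
  have hi01 : Integrable fun x => areaPartial z 0 x ^ 2 + areaPartial z 1 x ^ 2 := hi0.add hi1
  have hi2 : Integrable fun x => -2 * (trHess z x * drift ε z x) :=
    ((memLp_trHess z).integrable_mul (memLp_drift ε z)).const_mul _
  rw [integral_add hi2 hi01, integral_const_mul, integral_add hi0 hi1]
  refine (h1.add h2).congr_fun fun k => ?_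
  rw [energyTerm_eq, Fin.sum_univ_two]

theorem normalFn_sq_le (p : Plane) : normalFn p 0 ^ 2 + normalFn p 1 ^ 2 ≤ 1 := by
  have h := norm_sq_plane (normalFn p)
  rw [Fin.sum_univ_two] at h
  rw [← h]
  exact pow_le_one₀ (norm_nonneg _) (norm_normalFn_le p)

theorem integrable_energy (ε : ℝ) (z : H2) : Integrable fun x =>
    -2 * (trHess z x * drift ε z x) + (areaPartial z 0 x ^ 2 + areaPartial z 1 x ^ 2) :=
  (((memLp_trHess z).integrable_mul (memLp_drift ε z)).const_mul _).add
    ((memLp_areaPartial z 0).integrable_sq.add (memLp_areaPartial z 1).integrable_sq)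

/-- The energy balance of a function in `H²`, summed over all Fourier modes, has a sign. -/
theorem tsum_energyTerm_nonpos {ε : ℝ} (hε : 0 ≤ ε) (z : H2) : ∑' k, energyTerm ε z k ≤ 0 := by
  rw [(hasSum_energyTerm ε z).tsum_eq]
  have h : ∫ x, -3 * (z.hess 0 x 0 * z.hess 1 x 1 - z.hess 0 x 1 * z.hess 1 x 0) = 0 := by
    rw [integral_const_mul, integral_det_hess, mul_zero]
  rw [← h]
  refine integral_mono_ae (integrable_energy ε z)
    ((((memLp_hess z 0 0).integrable_mul (memLp_hess z 1 1)).sub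
      ((memLp_hess z 0 1).integrable_mul (memLp_hess z 1 0))).const_mul _) ?_
  filter_upwards [hess_symm z] with x hx
  have := pointwise_energy (a := z.hess 0 x 0) (b := z.hess 1 x 0) (d := z.hess 1 x 1) hε
    (normalFn_sq_le (z.grad x))
  rw [hx]
  refine le_trans (le_of_eq ?_) this
  simp only [trHess, drift, normalHess, areaPartial, Fin.sum_univ_two]
  rw [hx]
  ring

/-- A bound for partial sums that is uniform in the set of modes, as needed to interchange the sum
over the modes with expectation and time integral. -/
theorem abs_sum_energyTerm_le (ε : ℝ) (z : H2) (K : Finset (Fin 2 → ℤ)) :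
    |∑ k ∈ K, energyTerm ε z k| ≤ ∫ x, (trHess z x ^ 2 + drift ε z x ^ 2 +
      (areaPartial z 0 x ^ 2 + areaPartial z 1 x ^ 2)) := by
  have hs := ((hasSum_normSq_coef (memLp_trHess z)).add
    (hasSum_normSq_coef (memLp_drift ε z))).add ((hasSum_normSq_coef (memLp_areaPartial z 0)).add
    (hasSum_normSq_coef (memLp_areaPartial z 1)))
  have hi0 := (memLp_areaPartial z 0).integrable_sq
  have hi1 := (memLp_areaPartial z 1).integrable_sq
  have hi2 := (memLp_trHess z).integrable_sq
  have hi3 := (memLp_drift ε z).integrable_sq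
  have hi01 : Integrable fun x => areaPartial z 0 x ^ 2 + areaPartial z 1 x ^ 2 := hi0.add hi1
  have hi23 : Integrable fun x => trHess z x ^ 2 + drift ε z x ^ 2 := hi2.add hi3
  rw [integral_add hi23 hi01, integral_add hi2 hi3, integral_add hi0 hi1]
  refine (Finset.abs_sum_le_sum_abs _ _).trans (le_trans (Finset.sum_le_sum fun k _ => ?_)
    (sum_le_hasSum K (fun k _ => by positivity) hs))
  rw [energyTerm_eq, Fin.sum_univ_two]
  have h1 : |(conj (coef (trHess z) k) * coef (drift ε z) k).re| ≤
      ‖coef (trHess z) k‖ * ‖coef (drift ε z) k‖ := by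
    refine (Complex.abs_re_le_norm _).trans ?_
    rw [norm_mul, RCLike.norm_conj]
  refine (abs_add_le _ _).trans ?_
  rw [abs_mul, abs_of_nonneg (a := ‖coef (areaPartial z 0) k‖ ^ 2 + _) (by positivity),
    abs_neg, abs_two]
  nlinarith [sq_nonneg (‖coef (trHess z) k‖ - ‖coef (drift ε z) k‖)]

/-- The integrand in `abs_sum_energyTerm_le` is controlled by the full Hessian, here with entries
`a`, `b`, `c`, `d`, using `|(x, y)| ≤ 1`. -/
theorem pointwise_bound {a b c d x y ε : ℝ} (hε : 0 ≤ ε) (hε1 : ε ≤ 1) (h : x ^ 2 + y ^ 2 ≤ 1) :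
    (a + d) ^ 2 + ((1 / 2 + ε) * (a + d) +
      1 / 2 * ((a + d) - (x * (x * a + y * b) + y * (x * c + y * d)))) ^ 2 +
      ((x * a + y * b) ^ 2 + (x * c + y * d) ^ 2) ≤ 20 * (a ^ 2 + b ^ 2 + c ^ 2 + d ^ 2) := by
  have h1 : (x * a + y * b) ^ 2 ≤ a ^ 2 + b ^ 2 := by
    nlinarith [sq_nonneg (x * b - y * a), mul_nonneg (sub_nonneg.2 h)
      (add_nonneg (sq_nonneg a) (sq_nonneg b))]
  have h2 : (x * c + y * d) ^ 2 ≤ c ^ 2 + d ^ 2 := by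
    nlinarith [sq_nonneg (x * d - y * c), mul_nonneg (sub_nonneg.2 h)
      (add_nonneg (sq_nonneg c) (sq_nonneg d))]
  set p := x * a + y * b
  set q := x * c + y * d
  have h3 : (x * p + y * q) ^ 2 ≤ p ^ 2 + q ^ 2 := by
    nlinarith [sq_nonneg (x * q - y * p), mul_nonneg (sub_nonneg.2 h)
      (add_nonneg (sq_nonneg p) (sq_nonneg q))]
  set Q := x * p + y * q
  have h4 : (a + d) ^ 2 ≤ 2 * (a ^ 2 + d ^ 2) := by nlinarith [sq_nonneg (a - d)]
  have h5 : ((1 / 2 + ε) * (a + d) + 1 / 2 * ((a + d) - Q)) ^ 2 ≤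
      8 * (a + d) ^ 2 + 1 / 2 * Q ^ 2 := by
    have h6 : ((1 + ε) * (a + d)) ^ 2 ≤ 4 * (a + d) ^ 2 := by
      rw [mul_pow]
      gcongr
      nlinarith
    nlinarith [sq_nonneg ((1 + ε) * (a + d) + 1 / 2 * Q)]
  nlinarith [sq_nonneg b, sq_nonneg c]

theorem norm_sq_L2 (f : L2 Plane) : ‖f‖ ^ 2 = ∫ x, ‖f x‖ ^ 2 := by
  rw [← real_inner_self_eq_norm_sq, L2.inner_def]
  simp only [real_inner_self_eq_norm_sq]

theorem norm_sq_L2_real (f : L2 ℝ) : ‖f‖ ^ 2 = ∫ x, f x ^ 2 := by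
  rw [← real_inner_self_eq_norm_sq, L2.inner_def]
  simp only [real_inner_self_eq_norm_sq, Real.norm_eq_abs, sq_abs]

/-- The square norm of the Hessian dominates all terms in the energy balance. -/
theorem integral_energy_le {ε : ℝ} (hε : 0 ≤ ε) (hε1 : ε ≤ 1) (z : H2) :
    ∫ x, (trHess z x ^ 2 + drift ε z x ^ 2 + (areaPartial z 0 x ^ 2 + areaPartial z 1 x ^ 2)) ≤
      20 * ∑ i, ‖z.hess i‖ ^ 2 := by
  have hh : ∀ i, Integrable fun x => ‖z.hess i x‖ ^ 2 := fun i => (memLp_L2 _).integrable_norm_pow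
    two_ne_zero
  simp only [norm_sq_L2, Fin.sum_univ_two]
  rw [← integral_add (hh 0) (hh 1), ← integral_const_mul]
  refine integral_mono ((((memLp_trHess z).integrable_sq.add (memLp_drift ε z).integrable_sq)).add
    ((memLp_areaPartial z 0).integrable_sq.add (memLp_areaPartial z 1).integrable_sq))
    (((hh 0).add (hh 1)).const_mul _) fun x => ?_
  have := pointwise_bound (a := z.hess 0 x 0) (b := z.hess 1 x 0) (c := z.hess 0 x 1)
    (d := z.hess 1 x 1) hε hε1 (normalFn_sq_le (z.grad x))
  simp only [norm_sq_plane, trHess, drift, normalHess, areaPartial, Fin.sum_univ_two]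
  refine le_trans (le_of_eq ?_) (this.trans (le_of_eq ?_))
  all_goals ring

end GraphMCF

namespace GraphMCF

/-! ### Continuity of the coefficients of the equation on `H²` -/

theorem tendsto_toL2 {f : ℕ → Torus2 → ℝ} {f₀ : Torus2 → ℝ} (hf : ∀ n, MemLp (f n) 2 volume)
    (hf₀ : MemLp f₀ 2 volume)
    (h : Tendsto (fun n => eLpNorm (f n - f₀) 2 volume) atTop (𝓝 0)) :
    Tendsto (fun n => toL2 (f n)) atTop (𝓝 (toL2 f₀)) := by
  simp only [fun n => toL2_eq (hf n), toL2_eq hf₀]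
  exact (Lp.tendsto_Lp_iff_tendsto_eLpNorm'' f hf f₀ hf₀).2 h

theorem tendsto_eLpNorm_of_tendsto {E : Type} [NormedAddCommGroup E] {f : ℕ → L2 E} {f₀ : L2 E}
    (h : Tendsto f atTop (𝓝 f₀)) :
    Tendsto (fun n => eLpNorm (f n - f₀ : Torus2 → E) 2 volume) atTop (𝓝 0) :=
  (Lp.tendsto_Lp_iff_tendsto_eLpNorm' f f₀).1 h

instance : FirstCountableTopology H2 :=
  inferInstanceAs (FirstCountableTopology {z : L2 ℝ × L2 Plane × (Fin 2 → L2 Plane) //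
    IsWeakGradient z.1 z.2.1 ∧ ∀ i, IsWeakGradient (fun x => z.2.1 x i) (z.2.2 i)})

theorem continuous_H2_fn : Continuous H2.fn := continuous_fst.comp continuous_subtype_val

theorem continuous_H2_grad : Continuous H2.grad :=
  continuous_fst.comp (continuous_snd.comp continuous_subtype_val)

theorem continuous_H2_hess (i : Fin 2) : Continuous fun z : H2 => z.hess i :=
  (continuous_apply i).comp (continuous_snd.comp (continuous_snd.comp continuous_subtype_val))

theorem tendsto_coord {α : Type*} {mα : MeasurableSpace α} {μ : Measure α} {f : ℕ → α → Plane}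
    {f₀ : α → Plane} (h : Tendsto (fun n => eLpNorm (f n - f₀) 2 μ) atTop (𝓝 0)) (j : Fin 2) :
    Tendsto (fun n => eLpNorm ((fun x => f n x j) - fun x => f₀ x j) 2 μ) atTop (𝓝 0) := by
  refine tendsto_of_tendsto_of_tendsto_of_le_of_le tendsto_const_nhds h (fun n => zero_le)
    fun n => eLpNorm_mono fun x => ?_
  exact abs_apply_le_norm (f n x - f₀ x) j

/-- Bounded continuous functions of the gradient times second derivatives are continuous
on `H²`. -/
theorem continuous_toL2_mul_hess {B : Plane → ℝ} (hB : Continuous B) {C : ℝ}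
    (hC : ∀ p, |B p| ≤ C) (i j : Fin 2) :
    Continuous fun z : H2 => toL2 fun x => B (z.grad x) * z.hess i x j := by
  have hm : ∀ z : H2, MemLp (fun x => B (z.grad x) * z.hess i x j) 2 volume := fun z =>
    memLp_bdd_mul (hB.comp_aestronglyMeasurable (memLp_L2 z.grad).1) (fun _ => hC _)
      (memLp_hess z i j)
  refine continuous_iff_seqContinuous.2 fun z z₀ hz => tendsto_toL2 (fun n => hm (z n)) (hm z₀) ?_
  refine tendsto_eLpNorm_comp_mul hB hC (fun n => (memLp_L2 (z n).grad).1) (memLp_L2 z₀.grad).1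
    (tendsto_eLpNorm_of_tendsto ((continuous_H2_grad.tendsto _).comp hz))
    (fun n => (memLp_hess (z n) i j).1) (memLp_hess z₀ i j) ?_
  exact tendsto_coord (tendsto_eLpNorm_of_tendsto (((continuous_H2_hess i).tendsto _).comp hz)) j

theorem toL2_add {f g : Torus2 → ℝ} (hf : MemLp f 2 volume) (hg : MemLp g 2 volume) :
    toL2 (fun x => f x + g x) = toL2 f + toL2 g := by
  rw [toL2_eq hf, toL2_eq hg, ← MemLp.toLp_add hf hg, ← toL2_eq]
  rfl

theorem toL2_sum {f : Fin 2 → Torus2 → ℝ} (hf : ∀ i, MemLp (f i) 2 volume) :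
    toL2 (fun x => ∑ i, f i x) = ∑ i, toL2 (f i) := by
  simp only [Fin.sum_univ_two]
  exact toL2_add (hf 0) (hf 1)

theorem toL2_sub {f g : Torus2 → ℝ} (hf : MemLp f 2 volume) (hg : MemLp g 2 volume) :
    toL2 (fun x => f x - g x) = toL2 f - toL2 g := by
  rw [toL2_eq hf, toL2_eq hg, ← MemLp.toLp_sub hf hg, ← toL2_eq]
  rfl

theorem toL2_const_mul {f : Torus2 → ℝ} (hf : MemLp f 2 volume) (c : ℝ) :
    toL2 (fun x => c * f x) = c • toL2 f := by
  rw [toL2_eq hf, ← MemLp.toLp_const_smul c hf, ← toL2_eq]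
  rfl

theorem continuous_lap : Continuous H2.lap := by
  have h : ∀ z : H2, z.lap = (toL2 fun x => z.hess 0 x 0) + toL2 fun x => z.hess 1 x 1 := by
    intro z
    rw [← toL2_add (memLp_hess z 0 0) (memLp_hess z 1 1), H2.lap]
    simp only [Fin.sum_univ_two]
  have h1 : ∀ i : Fin 2, Continuous fun z : H2 => toL2 fun x => z.hess i x i := by
    intro i
    have := continuous_toL2_mul_hess (B := fun _ => 1) continuous_const (C := 1)
      (fun _ => by simp) i i
    simpa using this
  rw [funext h]
  exact (h1 0).add (h1 1)

theorem continuous_toL2_normalHess : Continuous fun z : H2 => toL2 (normalHess z) := by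
  have hc : ∀ i j : Fin 2, Continuous fun z : H2 => toL2 fun x =>
      normalFn (z.grad x) i * normalFn (z.grad x) j * z.hess j x i := fun i j =>
    continuous_toL2_mul_hess (B := fun p => normalFn p i * normalFn p j)
      ((continuous_normalFn_apply i).mul (continuous_normalFn_apply j))
      (fun p => abs_normalFn_mul_le p i j) j i
  have hm : ∀ (z : H2) (i j : Fin 2), MemLp (fun x =>
      normalFn (z.grad x) i * normalFn (z.grad x) j * z.hess j x i) 2 volume := fun z i j =>
    memLp_bdd_mul (((continuous_normalFn_apply i).mul
      (continuous_normalFn_apply j)).comp_aestronglyMeasurable (memLp_L2 z.grad).1)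
      (fun _ => abs_normalFn_mul_le _ i j) (memLp_hess z j i)
  have h : ∀ z : H2, toL2 (normalHess z) = ∑ i, ∑ j, toL2 fun x =>
      normalFn (z.grad x) i * normalFn (z.grad x) j * z.hess j x i := by
    intro z
    simp only [← toL2_sum (hm z _)]
    exact toL2_sum fun i => memLp_finsetSum _ fun j _ => hm z i j
  rw [funext h]
  exact continuous_finsetSum _ fun i _ => continuous_finsetSum _ fun j _ => hc i j

theorem toL2_area_mul_curv (z : H2) :
    toL2 (fun x => z.area x * z.curv x) = z.lap - toL2 (normalHess z) := by
  rw [toL2_congr (area_mul_curv_ae_eq z), toL2_sub (memLp_trHess z) (memLp_normalHess z)]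
  rfl

theorem toL2_drift (ε : ℝ) (z : H2) :
    toL2 (drift ε z) = (1 / 2 + ε) • z.lap +
      (1 / 2 : ℝ) • toL2 (fun x => z.area x * z.curv x) := by
  rw [toL2_area_mul_curv]
  have h1 := (memLp_trHess z).const_mul (1 / 2 + ε)
  have h2 := ((memLp_trHess z).sub (memLp_normalHess z)).const_mul (1 / 2)
  have h3 := toL2_add h1 h2
  rw [toL2_const_mul (memLp_trHess z)] at h3
  have h4 := toL2_const_mul ((memLp_trHess z).sub (memLp_normalHess z)) (1 / 2)
  rw [h4] at h3
  have h5 := toL2_sub (memLp_trHess z) (memLp_normalHess z)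
  have h6 : toL2 (trHess z - normalHess z) = z.lap - toL2 (normalHess z) := h5
  rw [h6] at h3
  exact h3

theorem areaFn_sub_le (p q : Plane) : areaFn q - areaFn p ≤ ‖q - p‖ := by
  have h1 : ‖q‖ ≤ ‖p‖ + ‖q - p‖ := by
    simpa using norm_add_le p (q - p)
  have h2 := norm_le_areaFn p
  have h3 : areaFn q ≤ areaFn p + ‖q - p‖ := by
    refine Real.sqrt_le_iff.2 ⟨add_nonneg (areaFn_pos p).le (norm_nonneg _), ?_⟩
    have h4 : ‖q‖ ^ 2 ≤ (‖p‖ + ‖q - p‖) ^ 2 := by gcongr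
    nlinarith [areaFn_sq p, mul_le_mul_of_nonneg_right h2 (norm_nonneg (q - p))]
  linarith

theorem abs_areaFn_sub_le (p q : Plane) : |areaFn p - areaFn q| ≤ ‖p - q‖ := by
  rw [abs_le]
  constructor
  · linarith [areaFn_sub_le p q, norm_sub_rev p q]
  · exact areaFn_sub_le q p

theorem continuous_toL2_drift (ε : ℝ) : Continuous fun z : H2 => toL2 (drift ε z) := by
  simp only [toL2_drift, toL2_area_mul_curv]
  exact (continuous_lap.const_smul (1 / 2 + ε)).add
    ((continuous_lap.sub continuous_toL2_normalHess).const_smul (1 / 2 : ℝ))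

theorem norm_toL2_sq {f : Torus2 → ℝ} (hf : MemLp f 2 volume) :
    ‖toL2 f‖ ^ 2 = ∫ x, f x ^ 2 := by
  rw [norm_sq_L2_real]
  refine integral_congr_ae ?_
  filter_upwards [toL2_coeFn hf] with x hx
  rw [hx]

theorem sum_norm_hess_le (z : H2) : ENNReal.ofReal (∑ i, ‖z.hess i‖ ^ 2) ≤ z.sqNorm := by
  rw [ENNReal.ofReal_sum_of_nonneg fun i _ => sq_nonneg _]
  unfold H2.sqNorm
  refine le_trans (le_of_eq (Finset.sum_congr rfl fun i _ => ?_)) le_add_self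
  rw [ENNReal.ofReal_pow (norm_nonneg _), ofReal_norm]

theorem norm_drift_sq_le {ε : ℝ} (hε : 0 ≤ ε) (hε1 : ε ≤ 1) (z : H2) :
    ‖toL2 (drift ε z)‖ ^ 2 ≤ 20 * ∑ i, ‖z.hess i‖ ^ 2 := by
  rw [norm_toL2_sq (memLp_drift ε z)]
  refine le_trans (integral_mono (memLp_drift ε z).integrable_sq
    (((memLp_trHess z).integrable_sq.add (memLp_drift ε z).integrable_sq).add
    ((memLp_areaPartial z 0).integrable_sq.add (memLp_areaPartial z 1).integrable_sq)) fun x => ?_)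
    (integral_energy_le hε hε1 z)
  simp only [Pi.add_apply]
  nlinarith [sq_nonneg (trHess z x), sq_nonneg (areaPartial z 0 x), sq_nonneg (areaPartial z 1 x)]

end GraphMCF

namespace GraphMCF

/-! ### Elementary stochastic integrals -/

theorem timeMeasure_apply (T : ℝ≥0) {s : Set ℝ≥0} (hs : MeasurableSet s) :
    timeMeasure T s = volume (((↑) : ℝ≥0 → ℝ) '' (s ∩ Set.Iic T)) := by
  have he : MeasurableEmbedding ((↑) : ℝ≥0 → ℝ) :=
    MeasurableEmbedding.subtype_coe measurableSet_Ici
  rw [timeMeasure, Measure.restrict_apply hs, he.comap_apply]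

theorem timeMeasure_Ioc (T a b : ℝ≥0) :
    timeMeasure T (Set.Ioc a b) =
      ENNReal.ofReal (((min T b : ℝ≥0) : ℝ) - ((min T a : ℝ≥0) : ℝ)) := by
  have h : ((↑) : ℝ≥0 → ℝ) '' (Set.Ioc a b ∩ Set.Iic T) =
      Set.Ioc ((min T a : ℝ≥0) : ℝ) ((min T b : ℝ≥0) : ℝ) := by
    ext x
    constructor
    · rintro ⟨y, ⟨⟨h1, h2⟩, h3⟩, rfl⟩
      exact ⟨NNReal.coe_lt_coe.2 (min_lt_of_right_lt h1), NNReal.coe_le_coe.2 (le_min h3 h2)⟩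
    · rintro ⟨h1, h2⟩
      have h0 : 0 ≤ x := (NNReal.coe_nonneg _).trans h1.le
      lift x to ℝ≥0 using h0
      rw [NNReal.coe_lt_coe] at h1
      rw [NNReal.coe_le_coe] at h2
      refine ⟨x, ⟨⟨?_, h2.trans (min_le_right _ _)⟩, h2.trans (min_le_left _ _)⟩, rfl⟩
      rcases min_lt_iff.1 h1 with h | h
      · exact absurd (h2.trans (min_le_left _ _)) (not_le.2 h)
      · exact h
  rw [timeMeasure_apply T measurableSet_Ioc, h, Real.volume_Ioc]

theorem timeMeasure_univ (T : ℝ≥0) : timeMeasure T Set.univ = T := by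
  have h : ((↑) : ℝ≥0 → ℝ) '' (Set.univ ∩ Set.Iic T) = Set.Icc 0 (T : ℝ) := by
    ext x
    constructor
    · rintro ⟨y, ⟨_, h3⟩, rfl⟩
      exact ⟨y.2, NNReal.coe_le_coe.2 h3⟩
    · rintro ⟨h1, h2⟩
      lift x to ℝ≥0 using h1
      exact ⟨x, ⟨trivial, NNReal.coe_le_coe.1 h2⟩, rfl⟩
  rw [timeMeasure_apply T MeasurableSet.univ, h, Real.volume_Icc, sub_zero,
    ENNReal.ofReal_coe_nnreal]

instance (T : ℝ≥0) : IsFiniteMeasure (timeMeasure T) :=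
  ⟨by rw [timeMeasure_univ]; exact ENNReal.coe_lt_top⟩

instance (T : ℝ≥0) : NullSingletonClass (timeMeasure T) := by
  refine ⟨fun x => ?_⟩
  rw [timeMeasure_apply T (measurableSet_singleton x)]
  exact (((Set.finite_singleton x).inter_of_left _).image _).measure_zero _

theorem timeMeasure_restrict {t T : ℝ≥0} (h : t ≤ T) :
    (timeMeasure T).restrict (Set.Iic t) = timeMeasure t := by
  rw [timeMeasure, timeMeasure, Measure.restrict_restrict measurableSet_Iic,
    Set.inter_eq_left.2 (Set.Iic_subset_Iic.2 h)]

theorem timeMeasure_mono {t T : ℝ≥0} (h : t ≤ T) : timeMeasure t ≤ timeMeasure T := by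
  rw [← timeMeasure_restrict h]
  exact Measure.restrict_le_self

theorem ae_le_timeMeasure (T : ℝ≥0) : ∀ᵐ t ∂timeMeasure T, t ≤ T :=
  ae_restrict_mem measurableSet_Iic

variable {Ω : Type*} {mΩ : MeasurableSpace Ω} {P : Measure Ω} [IsProbabilityMeasure P]
  {F : Filtration ℝ≥0 mΩ} {T : ℝ≥0} {W : ℝ≥0 → Ω → ℝ}

namespace Wiener

theorem measurable_of_le (hW : IsWienerProcess P F T W) {t : ℝ≥0} (ht : t ≤ T) :
    Measurable (W t) := (hW.adapted t ht).mono (F.le t) le_rfl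

theorem memLp_incr (hW : IsWienerProcess P F T W) {s t : ℝ≥0} (hst : s ≤ t) (ht : t ≤ T) :
    MemLp (fun ω => W t ω - W s ω) 2 P := by
  have hm : Measurable fun ω => W t ω - W s ω :=
    (measurable_of_le hW ht).sub (measurable_of_le hW (hst.trans ht))
  have h := ProbabilityTheory.memLp_id_gaussianReal (μ := 0) (v := t - s) 2
  rw [← hW.law s t hst ht] at h
  exact (memLp_map_measure_iff h.1 hm.aemeasurable).1 h

theorem integral_incr (hW : IsWienerProcess P F T W) {s t : ℝ≥0} (hst : s ≤ t) (ht : t ≤ T) :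
    ∫ ω, (W t ω - W s ω) ∂P = 0 := by
  have hm : Measurable fun ω => W t ω - W s ω :=
    (measurable_of_le hW ht).sub (measurable_of_le hW (hst.trans ht))
  have h := integral_map (μ := P) hm.aemeasurable (f := id) aestronglyMeasurable_id
  rw [hW.law s t hst ht] at h
  simp only [id] at h
  rw [← h, ProbabilityTheory.integral_id_gaussianReal]

theorem integral_incr_sq (hW : IsWienerProcess P F T W) {s t : ℝ≥0} (hst : s ≤ t) (ht : t ≤ T) :
    ∫ ω, (W t ω - W s ω) ^ 2 ∂P = t - s := by
  have hm : Measurable fun ω => W t ω - W s ω :=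
    (measurable_of_le hW ht).sub (measurable_of_le hW (hst.trans ht))
  have h := integral_map (μ := P) hm.aemeasurable (f := fun x : ℝ => x ^ 2)
    (by fun_prop)
  rw [hW.law s t hst ht] at h
  rw [← h]
  have h2 := ProbabilityTheory.variance_of_integral_eq_zero
    (μ := ProbabilityTheory.gaussianReal 0 (t - s)) (X := id) aemeasurable_id
    (by simp only [id]; exact ProbabilityTheory.integral_id_gaussianReal)
  rw [ProbabilityTheory.variance_id_gaussianReal] at h2
  simp only [id] at h2
  rw [← h2, NNReal.coe_sub hst]

theorem indepFun_incr (hW : IsWienerProcess P F T W) {s t : ℝ≥0} (hst : s ≤ t) (ht : t ≤ T)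
    {ξ : Ω → ℝ} (hξ : StronglyMeasurable[F s] ξ) :
    ProbabilityTheory.IndepFun ξ (fun ω => W t ω - W s ω) P := by
  refine ProbabilityTheory.IndepFun.symm ?_
  rw [ProbabilityTheory.IndepFun_iff_Indep]
  exact ProbabilityTheory.indep_of_indep_of_le_right (hW.indep s t hst ht)
    hξ.measurable.comap_le

theorem integral_mul_incr (hW : IsWienerProcess P F T W) {s t : ℝ≥0} (hst : s ≤ t) (ht : t ≤ T)
    {ξ : Ω → ℝ} (hξ : StronglyMeasurable[F s] ξ) :
    ∫ ω, ξ ω * (W t ω - W s ω) ∂P = 0 := by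
  have h := (indepFun_incr hW hst ht hξ).integral_mul_eq_mul_integral
    (hξ.mono (F.le s)).aestronglyMeasurable (memLp_incr hW hst ht).1
  rw [integral_incr hW hst ht, mul_zero] at h
  exact h

theorem integral_sq_mul_incr_sq (hW : IsWienerProcess P F T W) {s t : ℝ≥0} (hst : s ≤ t)
    (ht : t ≤ T) {ξ : Ω → ℝ} (hξ : StronglyMeasurable[F s] ξ) :
    ∫ ω, ξ ω ^ 2 * (W t ω - W s ω) ^ 2 ∂P = (∫ ω, ξ ω ^ 2 ∂P) * (t - s) := by
  have hi : ProbabilityTheory.IndepFun (fun ω => ξ ω ^ 2) (fun ω => (W t ω - W s ω) ^ 2) P :=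
    (indepFun_incr hW hst ht hξ).comp (φ := fun x : ℝ => x ^ 2) (ψ := fun x : ℝ => x ^ 2)
      (by fun_prop) (by fun_prop)
  have h := hi.integral_mul_eq_mul_integral
    ((hξ.mono (F.le s)).aestronglyMeasurable.pow 2) ((memLp_incr hW hst ht).1.pow 2)
  rw [integral_incr_sq hW hst ht] at h
  exact h

end Wiener

namespace Elementary

open Wiener

variable (S : ElementaryProcess F ℝ)

theorem memLp_coeff (i : ℕ) (p : ℝ≥0∞) : MemLp (S.coeff i) p P := by
  obtain ⟨C, hC⟩ := S.coeff_bdd i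
  exact .of_bound ((S.coeff_meas i).mono (F.le _)).aestronglyMeasurable C (Eventually.of_forall hC)

theorem memLp_coeff_mul (i : ℕ) {f : Ω → ℝ} (hf : MemLp f 2 P) :
    MemLp (fun ω => S.coeff i ω * f ω) 2 P := by
  obtain ⟨C, hC⟩ := S.coeff_bdd i
  exact memLp_bdd_mul ((S.coeff_meas i).mono (F.le _)).aestronglyMeasurable hC hf

theorem memLp_term (hW : IsWienerProcess P F T W) {t : ℝ≥0} (ht : t ≤ T) (i : ℕ) :
    MemLp (fun ω => (W (min t (S.time (i + 1))) ω - W (min t (S.time i)) ω) • S.coeff i ω) 2 P := by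
  have h := memLp_coeff_mul S i (memLp_incr hW (min_le_min_left t (S.time_mono i.le_succ))
    ((min_le_left _ _).trans ht))
  refine h.ae_eq (Eventually.of_forall fun ω => ?_)
  simp [mul_comm]

theorem memLp_integral (hW : IsWienerProcess P F T W) {t : ℝ≥0} (ht : t ≤ T) :
    MemLp (S.integral W t) 2 P :=
  memLp_finsetSum _ fun i _ => memLp_term S hW ht i

/-- Elementary integrals are martingales. -/
theorem integral_mul_sub (hW : IsWienerProcess P F T W) {s t : ℝ≥0} (hst : s ≤ t) (ht : t ≤ T)
    {ξ : Ω → ℝ} (hξ : StronglyMeasurable[F s] ξ) (hξ2 : MemLp ξ 2 P) :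
    ∫ ω, ξ ω * (S.integral W t ω - S.integral W s ω) ∂P = 0 := by
  -- the increments of `S.integral W` between `s` and `t` start after `s`
  have key : ∀ x ω, W (min t x) ω - W (min s x) ω = W (max (min t x) s) ω - W s ω := by
    intro x ω
    rcases le_total x s with h | h
    · rw [min_eq_right (h.trans hst), min_eq_right h, max_eq_right h, sub_self, sub_self]
    · rw [min_eq_left h, max_eq_left (le_min hst h)]
  have e : ∀ ω, ξ ω * (S.integral W t ω - S.integral W s ω) =
      ∑ i ∈ Finset.range S.size, (ξ ω * S.coeff i ω) *
        (W (max (min t (S.time (i + 1))) s) ω - W (max (min t (S.time i)) s) ω) := by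
    intro ω
    rw [ElementaryProcess.integral, ElementaryProcess.integral, ← Finset.sum_sub_distrib,
      Finset.mul_sum]
    refine Finset.sum_congr rfl fun i _ => ?_
    have h1 := key (S.time (i + 1)) ω
    have h2 := key (S.time i) ω
    rw [smul_eq_mul, smul_eq_mul]
    linear_combination (ξ ω * S.coeff i ω) * (h1 - h2)
  have hle : ∀ i, max (min t (S.time i)) s ≤ max (min t (S.time (i + 1))) s := fun i =>
    max_le_max_right _ (min_le_min_left _ (S.time_mono i.le_succ))
  have hT : ∀ i, max (min t (S.time i)) s ≤ T := fun i =>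
    max_le ((min_le_left _ _).trans ht) (hst.trans ht)
  simp only [e]
  rw [integral_finsetSum]
  · refine Finset.sum_eq_zero fun i _ => ?_
    rcases le_total (S.time i) t with h | h
    · refine integral_mul_incr hW (hle i) (hT _) (ξ := fun ω => ξ ω * S.coeff i ω) ?_
      refine StronglyMeasurable.mul (hξ.mono (F.mono (le_max_right _ _))) ?_
      exact (S.coeff_meas i).mono (F.mono (le_max_of_le_left (le_min h le_rfl)))
    · rw [min_eq_left h, min_eq_left (h.trans (S.time_mono i.le_succ))]
      simp
  · intro i _
    have hm : MemLp (fun ω => ξ ω * S.coeff i ω) 2 P :=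
      (memLp_coeff_mul S i hξ2).ae_eq (Eventually.of_forall fun ω => mul_comm _ _)
    exact hm.integrable_mul (memLp_incr hW (hle i) (hT _))

theorem stronglyMeasurable_partial (hW : IsWienerProcess P F T W) {t : ℝ≥0} (ht : t ≤ T) (n : ℕ) :
    StronglyMeasurable[F (min t (S.time n))] fun ω => ∑ i ∈ Finset.range n,
      (W (min t (S.time (i + 1))) ω - W (min t (S.time i)) ω) • S.coeff i ω := by
  refine Finset.stronglyMeasurable_fun_sum _ fun i hi => ?_
  have hin : i + 1 ≤ n := Finset.mem_range.1 hi
  rcases le_total (S.time i) t with h | h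
  · have hm : ∀ j ≤ n, StronglyMeasurable[F (min t (S.time n))] (W (min t (S.time j))) := fun j hj =>
      ((hW.adapted _ ((min_le_left _ _).trans ht)).mono
        (F.mono (min_le_min_left _ (S.time_mono hj))) le_rfl).stronglyMeasurable
    refine StronglyMeasurable.smul ((hm _ hin).sub (hm _ (i.le_succ.trans hin))) ?_
    exact (S.coeff_meas i).mono (F.mono (le_min h (S.time_mono (i.le_succ.trans hin))))
  · rw [min_eq_left h, min_eq_left (h.trans (S.time_mono i.le_succ))]
    simp only [sub_self, zero_smul]
    exact stronglyMeasurable_const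

/-- Itô isometry for partial sums, by induction: the increment of `W` over the last interval is
independent of everything before. -/
theorem integral_partial_sq (hW : IsWienerProcess P F T W) {t : ℝ≥0} (ht : t ≤ T) (n : ℕ) :
    ∫ ω, (∑ i ∈ Finset.range n,
      (W (min t (S.time (i + 1))) ω - W (min t (S.time i)) ω) • S.coeff i ω) ^ 2 ∂P =
    ∑ i ∈ Finset.range n, (∫ ω, S.coeff i ω ^ 2 ∂P) *
      (((min t (S.time (i + 1)) : ℝ≥0) : ℝ) - ((min t (S.time i) : ℝ≥0) : ℝ)) := by
  induction n with
  | zero => simp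
  | succ n ih =>
    rcases le_total t (S.time n) with h | h
    · have h' := h.trans (S.time_mono n.le_succ)
      simp only [Finset.sum_range_succ, min_eq_left h, min_eq_left h', sub_self, zero_smul,
        mul_zero, add_zero]
      exact ih
    set N : Ω → ℝ := fun ω => ∑ i ∈ Finset.range n,
      (W (min t (S.time (i + 1))) ω - W (min t (S.time i)) ω) • S.coeff i ω with hN
    have hNm : MemLp N 2 P := memLp_finsetSum _ fun i _ => memLp_term S hW ht i
    have hNF : StronglyMeasurable[F (S.time n)] N := by
      have := stronglyMeasurable_partial S hW ht n
      rwa [min_eq_right h] at this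
    have hle : S.time n ≤ min t (S.time (n + 1)) := le_min h (S.time_mono n.le_succ)
    have hT : min t (S.time (n + 1)) ≤ T := (min_le_left _ _).trans ht
    have hc := S.coeff_meas n
    have hterm := memLp_term S hW ht n
    have i1 := hNm.integrable_sq
    have i2 : Integrable (fun ω => 2 * (N ω * S.coeff n ω *
        (W (min t (S.time (n + 1))) ω - W (S.time n) ω))) P := by
      have : MemLp (fun ω => N ω * S.coeff n ω) 2 P :=
        (memLp_coeff_mul S n hNm).ae_eq (Eventually.of_forall fun ω => mul_comm _ _)
      exact (this.integrable_mul (memLp_incr hW hle hT)).const_mul 2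
    have i3 : Integrable (fun ω => S.coeff n ω ^ 2 *
        (W (min t (S.time (n + 1))) ω - W (S.time n) ω) ^ 2) P := by
      refine hterm.integrable_sq.congr (Eventually.of_forall fun ω => ?_)
      simp only [min_eq_right h, smul_eq_mul]
      ring
    have i12 : Integrable (fun ω => N ω ^ 2 + 2 * (N ω * S.coeff n ω *
        (W (min t (S.time (n + 1))) ω - W (S.time n) ω))) P := i1.add i2
    have e : ∀ ω, (N ω + (W (min t (S.time (n + 1))) ω - W (S.time n) ω) • S.coeff n ω) ^ 2 =
        (N ω ^ 2 + 2 * (N ω * S.coeff n ω * (W (min t (S.time (n + 1))) ω - W (S.time n) ω))) +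
        S.coeff n ω ^ 2 * (W (min t (S.time (n + 1))) ω - W (S.time n) ω) ^ 2 := by
      intro ω
      rw [smul_eq_mul]
      ring
    have hNF2 : StronglyMeasurable[F (S.time n)] fun ω => N ω * S.coeff n ω := hNF.mul hc
    simp only [Finset.sum_range_succ, min_eq_right h, ← ih]
    change ∫ ω, (N ω + (W (min t (S.time (n + 1))) ω - W (S.time n) ω) • S.coeff n ω) ^ 2 ∂P =
      ∫ ω, N ω ^ 2 ∂P + _
    simp only [e]
    rw [integral_add i12 i3, integral_add i1 i2, integral_const_mul,
      integral_mul_incr hW hle hT hNF2, integral_sq_mul_incr_sq hW hle hT hc, mul_zero, add_zero]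

theorem val_sq (t : ℝ≥0) (ω : Ω) (n : ℕ) :
    (∑ i ∈ Finset.range n,
      (Set.Ioc (S.time i) (S.time (i + 1))).indicator (fun _ => S.coeff i ω) t) ^ 2 =
    ∑ i ∈ Finset.range n,
      (Set.Ioc (S.time i) (S.time (i + 1))).indicator (fun _ => S.coeff i ω ^ 2) t := by
  induction n with
  | zero => simp
  | succ n ih =>
    rw [Finset.sum_range_succ, Finset.sum_range_succ, add_sq, ih]
    by_cases h : t ∈ Set.Ioc (S.time n) (S.time (n + 1))
    · have h0 : ∑ i ∈ Finset.range n,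
          (Set.Ioc (S.time i) (S.time (i + 1))).indicator (fun _ => S.coeff i ω) t = 0 := by
        refine Finset.sum_eq_zero fun i hi => Set.indicator_of_notMem (fun hm => ?_) _
        exact absurd (hm.2.trans (S.time_mono (Finset.mem_range.1 hi))) (not_le.2 h.1)
      rw [h0, Set.indicator_of_mem h, Set.indicator_of_mem h]
      ring
    · rw [Set.indicator_of_notMem h, Set.indicator_of_notMem h]
      ring

theorem stronglyMeasurable_val : StronglyMeasurable fun p : Ω × ℝ≥0 => S.val p.2 p.1 := by
  refine Finset.stronglyMeasurable_fun_sum _ fun i _ => ?_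
  have h : (fun p : Ω × ℝ≥0 => (Set.Ioc (S.time i) (S.time (i + 1))).indicator
      (fun _ => S.coeff i p.1) p.2) =
      (Set.univ ×ˢ Set.Ioc (S.time i) (S.time (i + 1))).indicator fun p => S.coeff i p.1 := by
    funext p
    by_cases hp : p.2 ∈ Set.Ioc (S.time i) (S.time (i + 1))
    · rw [Set.indicator_of_mem hp, Set.indicator_of_mem (by exact ⟨trivial, hp⟩)]
    · rw [Set.indicator_of_notMem hp, Set.indicator_of_notMem fun h => hp h.2]
  rw [h]
  exact (((S.coeff_meas i).mono (F.le _)).comp_measurable measurable_fst).indicator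
    (MeasurableSet.univ.prod measurableSet_Ioc)

theorem exists_val_bound : ∃ C, ∀ t ω, ‖S.val t ω‖ ≤ C := by
  choose C hC using S.coeff_bdd
  refine ⟨∑ i ∈ Finset.range S.size, C i, fun t ω => ?_⟩
  refine (norm_sum_le _ _).trans (Finset.sum_le_sum fun i _ => ?_)
  refine (norm_indicator_le_norm_self _ _).trans (hC i ω)

theorem memLp_val (t : ℝ≥0) :
    MemLp (fun p : Ω × ℝ≥0 => S.val p.2 p.1) 2 (P.prod (timeMeasure t)) := by
  obtain ⟨C, hC⟩ := exists_val_bound S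
  exact .of_bound (stronglyMeasurable_val S).aestronglyMeasurable C
    (Eventually.of_forall fun p => hC _ _)

/-- The Itô isometry for elementary integrals. -/
theorem integral_sq (hW : IsWienerProcess P F T W) {t : ℝ≥0} (ht : t ≤ T) :
    ∫ ω, S.integral W t ω ^ 2 ∂P =
      ∫ p : Ω × ℝ≥0, S.val p.2 p.1 ^ 2 ∂(P.prod (timeMeasure t)) := by
  rw [integral_prod _ (memLp_val S t).integrable_sq]
  have h1 : ∀ ω, ∫ s, S.val s ω ^ 2 ∂timeMeasure t = ∑ i ∈ Finset.range S.size,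
      S.coeff i ω ^ 2 *
        (((min t (S.time (i + 1)) : ℝ≥0) : ℝ) - ((min t (S.time i) : ℝ≥0) : ℝ)) := by
    intro ω
    simp only [ElementaryProcess.val, val_sq]
    rw [integral_finsetSum _ fun i _ => (integrable_const _).indicator measurableSet_Ioc]
    refine Finset.sum_congr rfl fun i _ => ?_
    rw [integral_indicator_const _ measurableSet_Ioc, Measure.real, timeMeasure_Ioc,
      ENNReal.toReal_ofReal, smul_eq_mul, mul_comm]
    exact sub_nonneg.2 (NNReal.coe_le_coe.2 (min_le_min_left _ (S.time_mono i.le_succ)))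
  simp only [h1]
  rw [integral_finsetSum _ fun i _ => (memLp_coeff S i 2).integrable_sq.mul_const _]
  simp only [integral_mul_const]
  exact integral_partial_sq S hW ht S.size

end Elementary

end GraphMCF

namespace GraphMCF

/-! ### The Itô isometry and the martingale property -/

section L2Limits

variable {α : Type*} {mα : MeasurableSpace α} {μ : Measure α}

theorem eLpNorm_two_sq {E : Type*} [NormedAddCommGroup E] (f : α → E) :
    eLpNorm f 2 μ ^ 2 = ∫⁻ x, ‖f x‖ₑ ^ 2 ∂μ := by
  have h := eLpNorm_nnreal_pow_eq_lintegral (μ := μ) (f := f) (p := 2) two_ne_zero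
  simpa using h

theorem tendsto_eLpNorm_of_lintegral {E : Type*} [NormedAddCommGroup E] {f : ℕ → α → E}
    (h : Tendsto (fun n => ∫⁻ x, ‖f n x‖ₑ ^ 2 ∂μ) atTop (𝓝 0)) :
    Tendsto (fun n => eLpNorm (f n) 2 μ) atTop (𝓝 0) := by
  simp only [← eLpNorm_two_sq] at h
  have h2 := (ENNReal.continuous_rpow_const (y := 1 / 2)).tendsto 0 |>.comp h
  have h3 : ((0 : ℝ≥0∞) ^ (1 / 2 : ℝ)) = 0 := ENNReal.zero_rpow_of_pos (by norm_num)
  rw [h3] at h2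
  refine h2.congr fun n => ?_
  simp only [Function.comp]
  rw [← ENNReal.rpow_natCast, ← ENNReal.rpow_mul]
  norm_num

theorem tendsto_integral_mul {f g : ℕ → α → ℝ} {f₀ g₀ : α → ℝ} (hf : ∀ n, MemLp (f n) 2 μ)
    (hf₀ : MemLp f₀ 2 μ) (hg : ∀ n, MemLp (g n) 2 μ) (hg₀ : MemLp g₀ 2 μ)
    (hfl : Tendsto (fun n => eLpNorm (f n - f₀) 2 μ) atTop (𝓝 0))
    (hgl : Tendsto (fun n => eLpNorm (g n - g₀) 2 μ) atTop (𝓝 0)) :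
    Tendsto (fun n => ∫ x, f n x * g n x ∂μ) atTop (𝓝 (∫ x, f₀ x * g₀ x ∂μ)) := by
  have e : ∀ {u v : α → ℝ} (hu : MemLp u 2 μ) (hv : MemLp v 2 μ),
      ∫ x, u x * v x ∂μ = inner ℝ (hu.toLp u) (hv.toLp v) := by
    intro u v hu hv
    rw [L2.inner_def]
    refine integral_congr_ae ?_
    filter_upwards [hu.coeFn_toLp, hv.coeFn_toLp] with x h1 h2
    rw [h1, h2]
    simp [mul_comm]
  simp only [fun n => e (hf n) (hg n), e hf₀ hg₀]
  exact ((Lp.tendsto_Lp_iff_tendsto_eLpNorm'' f hf f₀ hf₀).2 hfl).inner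
    ((Lp.tendsto_Lp_iff_tendsto_eLpNorm'' g hg g₀ hg₀).2 hgl)

theorem integrable_mul_of_memLp {f g : α → ℝ} (hf : MemLp f 2 μ) (hg : MemLp g 2 μ) :
    Integrable (fun x => f x * g x) μ := hf.integrable_mul hg

theorem memLp_of_tendsto {f : ℕ → α → ℝ} {f₀ : α → ℝ} (hf : ∀ n, MemLp (f n) 2 μ)
    (hf₀ : AEStronglyMeasurable f₀ μ)
    (h : Tendsto (fun n => eLpNorm (f n - f₀) 2 μ) atTop (𝓝 0)) : MemLp f₀ 2 μ := by
  obtain ⟨n, hn⟩ := (h.eventually (gt_mem_nhds (zero_lt_one (α := ℝ≥0∞)))).exists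
  have h1 : MemLp (f n - f₀) 2 μ := ⟨(hf n).1.sub hf₀, hn.trans ENNReal.one_lt_top⟩
  have h2 := (hf n).sub h1
  rwa [sub_sub_cancel] at h2

end L2Limits

variable {Ω : Type*} {mΩ : MeasurableSpace Ω} {P : Measure Ω} [IsProbabilityMeasure P]
  {F : Filtration ℝ≥0 mΩ} {T : ℝ≥0} {W : ℝ≥0 → Ω → ℝ}

theorem predictable_le_prod (F : Filtration ℝ≥0 mΩ) :
    F.predictable ≤ (inferInstance : MeasurableSpace (ℝ≥0 × Ω)) :=
  measurableSpace_le_predictable_of_measurableSet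
    (fun A hA => (measurableSet_singleton _).prod (F.le _ A hA))
    fun i A hA => measurableSet_Ioi.prod (F.le i A hA)

theorem stronglyMeasurable_of_predictable {E : Type*} [TopologicalSpace E] {g : ℝ≥0 → Ω → E}
    (hg : IsStronglyPredictable F g) : StronglyMeasurable fun p : Ω × ℝ≥0 => g p.2 p.1 :=
  (StronglyMeasurable.mono hg (predictable_le_prod F)).comp_measurable measurable_swap

theorem prod_timeMeasure_mono {t : ℝ≥0} (ht : t ≤ T) :
    P.prod (timeMeasure t) ≤ P.prod (timeMeasure T) :=
  Measure.prod_mono le_rfl (timeMeasure_mono ht)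

/-- The data extracted from an Itô integral: approximating elementary processes, with convergence
expressed by `L²` norms. -/
theorem _root_.IsItoIntegral.exists_approx {g M : ℝ≥0 → Ω → ℝ} (hM : IsItoIntegral P F T W g M) :
    ∃ S : ℕ → ElementaryProcess F ℝ,
      Tendsto (fun k => eLpNorm ((fun p : Ω × ℝ≥0 => (S k).val p.2 p.1) - fun p => g p.2 p.1) 2
        (P.prod (timeMeasure T))) atTop (𝓝 0) ∧
      ∀ t ≤ T, Tendsto (fun k => eLpNorm ((S k).integral W t - M t) 2 P) atTop (𝓝 0) := by
  obtain ⟨hg, -, S, h1, h2⟩ := hM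
  refine ⟨S, tendsto_eLpNorm_of_lintegral ?_, fun t ht => tendsto_eLpNorm_of_lintegral (h2 t ht)⟩
  refine h1.congr fun k => ?_
  have hm : Measurable fun p : Ω × ℝ≥0 => ‖(S k).val p.2 p.1 - g p.2 p.1‖ₑ ^ 2 :=
    ((Elementary.stronglyMeasurable_val (S k)).sub
      (stronglyMeasurable_of_predictable hg)).enorm.pow_const 2
  rw [← lintegral_prod _ hm.aemeasurable]
  rfl

theorem _root_.IsItoIntegral.memLp (hW : IsWienerProcess P F T W) {g M : ℝ≥0 → Ω → ℝ}
    (hM : IsItoIntegral P F T W g M) {t : ℝ≥0} (ht : t ≤ T) : MemLp (M t) 2 P := by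
  obtain ⟨S, -, h2⟩ := hM.exists_approx
  exact memLp_of_tendsto (fun k => Elementary.memLp_integral (S k) hW ht) (hM.2.1 t ht) (h2 t ht)

theorem _root_.IsItoIntegral.memLp_integrand {g M : ℝ≥0 → Ω → ℝ} (hM : IsItoIntegral P F T W g M) :
    MemLp (fun p : Ω × ℝ≥0 => g p.2 p.1) 2 (P.prod (timeMeasure T)) := by
  obtain ⟨S, h1, -⟩ := hM.exists_approx
  exact memLp_of_tendsto (fun k => Elementary.memLp_val (S k) T)
    (stronglyMeasurable_of_predictable hM.1).aestronglyMeasurable h1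

/-- The Itô isometry. -/
theorem _root_.IsItoIntegral.integral_sq (hW : IsWienerProcess P F T W) {g M : ℝ≥0 → Ω → ℝ}
    (hM : IsItoIntegral P F T W g M) {t : ℝ≥0} (ht : t ≤ T) :
    ∫ ω, M t ω ^ 2 ∂P = ∫ p : Ω × ℝ≥0, g p.2 p.1 ^ 2 ∂(P.prod (timeMeasure t)) := by
  obtain ⟨S, h1, h2⟩ := hM.exists_approx
  have hm1 := fun k => Elementary.memLp_integral (S k) hW ht
  have hm2 := fun k => Elementary.memLp_val (P := P) (S k) t
  have hg := hM.memLp_integrand.mono_measure (prod_timeMeasure_mono ht)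
  have h1' : Tendsto (fun k => eLpNorm ((fun p : Ω × ℝ≥0 => (S k).val p.2 p.1) -
      fun p => g p.2 p.1) 2 (P.prod (timeMeasure t))) atTop (𝓝 0) :=
    tendsto_of_tendsto_of_tendsto_of_le_of_le tendsto_const_nhds h1 (fun n => zero_le)
      fun n => eLpNorm_mono_measure _ (prod_timeMeasure_mono ht)
  have l1 := tendsto_integral_mul hm1 (hM.memLp hW ht) hm1 (hM.memLp hW ht) (h2 t ht) (h2 t ht)
  have l2 := tendsto_integral_mul hm2 hg hm2 hg h1' h1'
  simp only [← pow_two] at l1 l2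
  refine tendsto_nhds_unique l1 (l2.congr fun k => ?_)
  exact (Elementary.integral_sq (S k) hW ht).symm

theorem tendsto_eLpNorm_const {α : Type*} {mα : MeasurableSpace α} {μ : Measure α} (f : α → ℝ) :
    Tendsto (fun _ : ℕ => eLpNorm (f - f) 2 μ) atTop (𝓝 0) := by
  simp

/-- Itô integrals are martingales. -/
theorem _root_.IsItoIntegral.integral_mul_eq (hW : IsWienerProcess P F T W) {g M : ℝ≥0 → Ω → ℝ}
    (hM : IsItoIntegral P F T W g M) {s t : ℝ≥0} (hst : s ≤ t) (ht : t ≤ T) {ξ : Ω → ℝ}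
    (hξ : StronglyMeasurable[F s] ξ) (hξ2 : MemLp ξ 2 P) :
    ∫ ω, ξ ω * M t ω ∂P = ∫ ω, ξ ω * M s ω ∂P := by
  obtain ⟨S, -, h2⟩ := hM.exists_approx
  have hs := hst.trans ht
  have l1 := tendsto_integral_mul (fun _ => hξ2) hξ2
    (fun k => Elementary.memLp_integral (S k) hW ht) (hM.memLp hW ht) (tendsto_eLpNorm_const ξ)
    (h2 t ht)
  have l2 := tendsto_integral_mul (fun _ => hξ2) hξ2
    (fun k => Elementary.memLp_integral (S k) hW hs) (hM.memLp hW hs) (tendsto_eLpNorm_const ξ)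
    (h2 s hs)
  refine tendsto_nhds_unique l1 (l2.congr fun k => ?_)
  have h := Elementary.integral_mul_sub (S k) hW hst ht hξ hξ2
  simp only [mul_sub] at h
  rw [integral_sub (integrable_mul_of_memLp hξ2 (Elementary.memLp_integral (S k) hW ht))
    (integrable_mul_of_memLp hξ2 (Elementary.memLp_integral (S k) hW hs)), sub_eq_zero] at h
  exact h.symm

theorem _root_.IsItoIntegral.integral_mul_zero (hW : IsWienerProcess P F T W) {g M : ℝ≥0 → Ω → ℝ}
    (hM : IsItoIntegral P F T W g M) {t : ℝ≥0} (ht : t ≤ T) {ξ : Ω → ℝ}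
    (hξ : StronglyMeasurable[F 0] ξ) (hξ2 : MemLp ξ 2 P) :
    ∫ ω, ξ ω * M t ω ∂P = 0 := by
  rw [hM.integral_mul_eq hW zero_le ht hξ hξ2]
  obtain ⟨S, -, h2⟩ := hM.exists_approx
  have l2 := tendsto_integral_mul (fun _ => hξ2) hξ2
    (fun k => Elementary.memLp_integral (S k) hW zero_le) (hM.memLp hW zero_le)
    (tendsto_eLpNorm_const ξ) (h2 0 zero_le)
  refine tendsto_nhds_unique l2 ?_
  have e : ∀ k, ∫ ω, ξ ω * (S k).integral W 0 ω ∂P = 0 := by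
    intro k
    simp [ElementaryProcess.integral]
  simp only [e]
  exact tendsto_const_nhds

/-- The square of a primitive `A` of `h` is `2 ∫ A h`. -/
theorem sq_integral_timeMeasure {h : ℝ≥0 → ℝ} {t : ℝ≥0} (hh : Integrable h (timeMeasure t)) :
    (∫ s, h s ∂timeMeasure t) ^ 2 =
      2 * ∫ s, (∫ r, h r ∂timeMeasure s) * h s ∂timeMeasure t := by
  set μ := timeMeasure t
  have hp : Integrable (fun p : ℝ≥0 × ℝ≥0 => h p.1 * h p.2) (μ.prod μ) := hh.mul_prod hh
  have hE : MeasurableSet {p : ℝ≥0 × ℝ≥0 | p.1 < p.2} :=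
    measurableSet_lt measurable_fst measurable_snd
  have hpE := hp.indicator hE
  have hin : ∀ᵐ s ∂μ, ∫ r, h r ∂timeMeasure s = ∫ r in Set.Iic s, h r ∂μ := by
    filter_upwards [ae_le_timeMeasure t] with s hs
    rw [timeMeasure_restrict hs]
  have h1 : ∫ s, (∫ r, h r ∂timeMeasure s) * h s ∂μ =
      ∫ s, (∫ r in Set.Iic s, h r ∂μ) * h s ∂μ := by
    refine integral_congr_ae ?_
    filter_upwards [hin] with s hs
    rw [hs]
  -- Fubini over the two triangles, which are exchanged by the reflection.
  have h2 : ∫ s, (∫ r in Set.Ioi s, h r ∂μ) * h s ∂μ =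
      ∫ s, (∫ r in Set.Iic s, h r ∂μ) * h s ∂μ := by
    have e1 : ∀ s, (∫ r in Set.Ioi s, h r ∂μ) * h s =
        ∫ r, {p : ℝ≥0 × ℝ≥0 | p.1 < p.2}.indicator (fun p => h p.1 * h p.2) (s, r) ∂μ := by
      intro s
      rw [← integral_indicator measurableSet_Ioi, ← integral_mul_const]
      congr 1
      funext r
      by_cases hr : s < r
      · rw [Set.indicator_of_mem (by exact hr), Set.indicator_of_mem (by exact hr), mul_comm]
      · rw [Set.indicator_of_notMem (by exact hr), Set.indicator_of_notMem (by exact hr), zero_mul]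
    have e2 : ∀ r, (∫ s in Set.Iic r, h s ∂μ) * h r =
        ∫ s, {p : ℝ≥0 × ℝ≥0 | p.1 < p.2}.indicator (fun p => h p.1 * h p.2) (s, r) ∂μ := by
      intro r
      rw [← setIntegral_congr_set Iio_ae_eq_Iic, ← integral_indicator measurableSet_Iio,
        ← integral_mul_const]
      congr 1
      funext s
      by_cases hr : s < r
      · rw [Set.indicator_of_mem (by exact hr), Set.indicator_of_mem (by exact hr)]
      · rw [Set.indicator_of_notMem (by exact hr), Set.indicator_of_notMem (by exact hr), zero_mul]
    simp only [e1, e2]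
    exact integral_integral_swap hpE
  have h3 : ∀ s, (∫ r in Set.Iic s, h r ∂μ) + ∫ r in Set.Ioi s, h r ∂μ = ∫ r, h r ∂μ := by
    intro s
    rw [← Set.compl_Iic]
    exact integral_add_compl measurableSet_Iic hh
  have i1 : Integrable (fun s => (∫ r in Set.Iic s, h r ∂μ) * h s) μ := by
    have hpF := (hp.indicator (measurableSet_le measurable_snd measurable_fst :
      MeasurableSet {p : ℝ≥0 × ℝ≥0 | p.2 ≤ p.1})).integral_prod_left
    refine hpF.congr (Eventually.of_forall fun s => ?_)
    simp only
    rw [← integral_indicator measurableSet_Iic, ← integral_mul_const]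
    congr 1
    funext r
    by_cases hr : r ≤ s
    · rw [Set.indicator_of_mem (by exact hr), Set.indicator_of_mem (by exact hr), mul_comm]
    · rw [Set.indicator_of_notMem (by exact hr), Set.indicator_of_notMem (by exact hr), zero_mul]
  have i2 : Integrable (fun s => (∫ r in Set.Ioi s, h r ∂μ) * h s) μ := by
    have : Integrable (fun s => (∫ r, h r ∂μ) * h s - (∫ r in Set.Iic s, h r ∂μ) * h s) μ :=
      (hh.const_mul _).sub i1
    refine this.congr (Eventually.of_forall fun s => ?_)
    simp only
    rw [← h3 s]
    ring
  rw [h1, two_mul]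
  nth_rewrite 2 [← h2]
  rw [← integral_add i1 i2, pow_two, ← integral_const_mul]
  refine integral_congr_ae (Eventually.of_forall fun s => ?_)
  simp only
  rw [← h3 s]
  ring

end GraphMCF

namespace GraphMCF

/-! ### Second moments of scalar Itô processes -/

variable {Ω : Type*} {mΩ : MeasurableSpace Ω} {P : Measure Ω} [IsProbabilityMeasure P]
  {F : Filtration ℝ≥0 mΩ} {T : ℝ≥0} {W : ℝ≥0 → Ω → ℝ}

/-- The drift part `∫₀ᵗ a ds` as a jointly measurable function of `(ω, t)`. -/
theorem stronglyMeasurable_primitive {a : ℝ≥0 → Ω → ℝ}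
    (ha : StronglyMeasurable fun p : Ω × ℝ≥0 => a p.2 p.1) :
    StronglyMeasurable fun p : Ω × ℝ≥0 =>
      ∫ r, (Set.Iic p.2).indicator (fun r => a r p.1) r ∂timeMeasure T := by
  have hm : StronglyMeasurable fun q : (Ω × ℝ≥0) × ℝ≥0 =>
      {q : (Ω × ℝ≥0) × ℝ≥0 | q.2 ≤ q.1.2}.indicator (fun q => a q.2 q.1.1) q := by
    refine StronglyMeasurable.indicator (ha.comp_measurable
      (f := fun p : Ω × ℝ≥0 => a p.2 p.1) (g := fun q : (Ω × ℝ≥0) × ℝ≥0 => (q.1.1, q.2))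
      (by fun_prop)) ?_
    exact measurableSet_le measurable_snd (measurable_snd.comp measurable_fst)
  exact StronglyMeasurable.integral_prod_right
    (f := fun (p : Ω × ℝ≥0) r => (Set.Iic p.2).indicator (fun r => a r p.1) r) hm

theorem primitive_eq {h : ℝ≥0 → ℝ} {s : ℝ≥0} (hs : s ≤ T) :
    ∫ r, (Set.Iic s).indicator h r ∂timeMeasure T = ∫ r, h r ∂timeMeasure s := by
  rw [integral_indicator measurableSet_Iic, timeMeasure_restrict hs]

theorem sq_integral_le {h : ℝ≥0 → ℝ} (hh : MemLp h 2 (timeMeasure T)) :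
    (∫ s, ‖h s‖ ∂timeMeasure T) ^ 2 ≤ T * ∫ s, h s ^ 2 ∂timeMeasure T := by
  set D := ∫ s, ‖h s‖ ∂timeMeasure T with hD
  have hi : Integrable h (timeMeasure T) := hh.integrable one_le_two
  -- expand `0 ≤ ∫ (T |h| - D)²`
  have h0 : 0 ≤ ∫ s, ((T : ℝ) ^ 2 * h s ^ 2 - 2 * T * D * ‖h s‖ + D ^ 2) ∂timeMeasure T := by
    refine integral_nonneg fun s => ?_
    have : (T : ℝ) ^ 2 * h s ^ 2 - 2 * T * D * ‖h s‖ + D ^ 2 = (T * ‖h s‖ - D) ^ 2 := by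
      rw [sub_sq, mul_pow, Real.norm_eq_abs, sq_abs]
      ring
    simp only [this]
    exact sq_nonneg _
  have i1 : Integrable (fun s => (T : ℝ) ^ 2 * h s ^ 2) (timeMeasure T) :=
    hh.integrable_sq.const_mul _
  have i2 : Integrable (fun s => 2 * T * D * ‖h s‖) (timeMeasure T) := hi.norm.const_mul _
  have i12 : Integrable (fun s => (T : ℝ) ^ 2 * h s ^ 2 - 2 * T * D * ‖h s‖) (timeMeasure T) :=
    i1.sub i2
  rw [integral_add i12 (integrable_const _), integral_sub i1 i2, integral_const_mul,
    integral_const_mul, integral_const, ← hD, Measure.real, timeMeasure_univ,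
    ENNReal.coe_toReal, smul_eq_mul] at h0
  rcases eq_or_lt_of_le T.2 with hT | hT
  · have hT' : (T : ℝ) = 0 := hT.symm
    have : timeMeasure T = 0 := by
      rw [← Measure.measure_univ_eq_zero, timeMeasure_univ]
      exact_mod_cast hT'
    rw [hD, this]
    simp
  · have hT' : 0 < (T : ℝ) := hT
    have h1 : 0 ≤ (T : ℝ) * (T * ∫ s, h s ^ 2 ∂timeMeasure T - D ^ 2) := by nlinarith
    have h2 := nonneg_of_mul_nonneg_right h1 hT'
    linarith

/-- The function `D = ∫ |a| ds` dominates the drift part and is square integrable. -/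
theorem exists_dominating_primitive {a : ℝ≥0 → Ω → ℝ}
    (haM : StronglyMeasurable fun p : Ω × ℝ≥0 => a p.2 p.1)
    (ha2 : MemLp (fun p : Ω × ℝ≥0 => a p.2 p.1) 2 (P.prod (timeMeasure T))) :
    ∃ D : Ω → ℝ, MemLp D 2 P ∧ ∀ᵐ ω ∂P, MemLp (fun s => a s ω) 2 (timeMeasure T) ∧
      ∀ s, ‖∫ r, (Set.Iic s).indicator (fun r => a r ω) r ∂timeMeasure T‖ ≤ D ω := by
  -- almost every path of `a` is square integrable
  have hpath : ∀ᵐ ω ∂P, MemLp (fun s => a s ω) 2 (timeMeasure T) := by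
    filter_upwards [ha2.integrable_sq.prod_right_ae] with ω hω
    exact (memLp_two_iff_integrable_sq
      (haM.comp_measurable measurable_prodMk_left).aestronglyMeasurable).2 hω
  set D : Ω → ℝ := fun ω => ∫ s, ‖a s ω‖ ∂timeMeasure T with hD
  have hDM : StronglyMeasurable D := StronglyMeasurable.integral_prod_right
    (f := fun ω s => ‖a s ω‖) haM.norm
  have hD2 : MemLp D 2 P := by
    rw [memLp_two_iff_integrable_sq hDM.aestronglyMeasurable]
    refine (ha2.integrable_sq.integral_prod_left.const_mul (T : ℝ)).mono'
      (hDM.pow 2).aestronglyMeasurable ?_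
    filter_upwards [hpath] with ω hω
    rw [Real.norm_of_nonneg (sq_nonneg _)]
    exact sq_integral_le hω
  refine ⟨D, hD2, ?_⟩
  filter_upwards [hpath] with ω hω
  refine ⟨hω, fun s => ?_⟩
  have hi : Integrable (fun r => a r ω) (timeMeasure T) := hω.integrable one_le_two
  refine (norm_integral_le_integral_norm _).trans ?_
  refine integral_mono (hi.indicator measurableSet_Iic).norm hi.norm fun r => ?_
  exact norm_indicator_le_norm_self _ _

theorem memLp_primitive {a : ℝ≥0 → Ω → ℝ}
    (haM : StronglyMeasurable fun p : Ω × ℝ≥0 => a p.2 p.1)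
    (ha2 : MemLp (fun p : Ω × ℝ≥0 => a p.2 p.1) 2 (P.prod (timeMeasure T))) (s : ℝ≥0) :
    MemLp (fun ω => ∫ r, (Set.Iic s).indicator (fun r => a r ω) r ∂timeMeasure T) 2 P := by
  obtain ⟨D, hD2, hDA⟩ := exists_dominating_primitive haM ha2
  refine hD2.of_le_mul (c := 1) ((stronglyMeasurable_primitive haM).comp_measurable
    measurable_prodMk_right).aestronglyMeasurable ?_
  filter_upwards [hDA] with ω hω
  rw [one_mul]
  exact (hω.2 s).trans (le_abs_self _)

/-- Itô's formula in expectation for the square of a scalar process `x = x₀ + ∫ a ds + ∫ b dW`. -/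
theorem integral_sq_process (hW : IsWienerProcess P F T W) {x a b M : ℝ≥0 → Ω → ℝ} {x₀ : Ω → ℝ}
    (hM : IsItoIntegral P F T W b M) (ha : IsStronglyPredictable F a)
    (ha2 : MemLp (fun p : Ω × ℝ≥0 => a p.2 p.1) 2 (P.prod (timeMeasure T)))
    (hx : MemLp (fun p : Ω × ℝ≥0 => x p.2 p.1) 2 (P.prod (timeMeasure T)))
    (hx₀ : StronglyMeasurable[F 0] x₀) (hx₀2 : MemLp x₀ 2 P)
    (heq : ∀ t ≤ T, ∀ᵐ ω ∂P, x t ω = x₀ ω + ∫ s, a s ω ∂timeMeasure t + M t ω)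
    {t : ℝ≥0} (ht : t ≤ T) :
    ∫ ω, x t ω ^ 2 ∂P = ∫ ω, x₀ ω ^ 2 ∂P +
      ∫ p : Ω × ℝ≥0, (2 * (x p.2 p.1 * a p.2 p.1) + b p.2 p.1 ^ 2) ∂(P.prod (timeMeasure t)) := by
  set Q := P.prod (timeMeasure t) with hQ
  have hQT : Q ≤ P.prod (timeMeasure T) := prod_timeMeasure_mono ht
  have haM : StronglyMeasurable fun p : Ω × ℝ≥0 => a p.2 p.1 := stronglyMeasurable_of_predictable ha
  set A : ℝ≥0 → Ω → ℝ := fun s ω =>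
    ∫ r, (Set.Iic s).indicator (fun r => a r ω) r ∂timeMeasure T with hA
  have hAeq : ∀ s ≤ T, ∀ ω, A s ω = ∫ r, a r ω ∂timeMeasure s := fun s hs ω => primitive_eq hs
  have hAM : StronglyMeasurable fun p : Ω × ℝ≥0 => A p.2 p.1 := stronglyMeasurable_primitive haM
  obtain ⟨D, hD2, hDA⟩ := exists_dominating_primitive haM ha2
  have hpath := hDA.mono fun ω h => h.1
  have hAD : ∀ᵐ ω ∂P, ∀ s, ‖A s ω‖ ≤ D ω := hDA.mono fun ω h => h.2
  have hA2 : ∀ s, MemLp (A s) 2 P := memLp_primitive haM ha2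
  have hAQ : MemLp (fun p : Ω × ℝ≥0 => A p.2 p.1) 2 Q := by
    refine (hD2.comp_fst (timeMeasure t)).of_le_mul (c := 1) hAM.aestronglyMeasurable ?_
    have h1 : ∀ᵐ p ∂Q, ∀ s, ‖A s p.1‖ ≤ D p.1 := Measure.quasiMeasurePreserving_fst.ae hAD
    filter_upwards [h1] with p hp
    rw [one_mul]
    exact (hp p.2).trans (le_abs_self _)
  have haQ := ha2.mono_measure hQT
  have hxQ := hx.mono_measure hQT
  have hbQ := hM.memLp_integrand.mono_measure hQT
  have hM2 := hM.memLp hW ht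
  have hx₀Q : MemLp (fun p : Ω × ℝ≥0 => x₀ p.1) 2 Q := hx₀2.comp_fst _
  have hMQ : MemLp (fun p : Ω × ℝ≥0 => M t p.1) 2 Q := hM2.comp_fst _
  have iax := integrable_mul_of_memLp haQ hxQ
  have iax₀ := integrable_mul_of_memLp haQ hx₀Q
  have iaA := integrable_mul_of_memLp haQ hAQ
  have iaM := integrable_mul_of_memLp haQ hMQ
  -- multiplication of the drift part by a function of `ω`
  have hmul : ∀ ξ : Ω → ℝ, Integrable (fun p : Ω × ℝ≥0 => a p.2 p.1 * ξ p.1) Q →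
      ∫ ω, A t ω * ξ ω ∂P = ∫ p : Ω × ℝ≥0, a p.2 p.1 * ξ p.1 ∂Q := by
    intro ξ hξ
    rw [hQ, integral_prod _ hξ]
    refine integral_congr_ae (Eventually.of_forall fun ω => ?_)
    simp only
    rw [hAeq t ht, integral_mul_const]
  -- the square of the drift part
  have hAA : ∫ ω, A t ω ^ 2 ∂P = 2 * ∫ p : Ω × ℝ≥0, a p.2 p.1 * A p.2 p.1 ∂Q := by
    rw [hQ, integral_prod _ iaA, ← integral_const_mul]
    refine integral_congr_ae ?_
    filter_upwards [hpath] with ω hω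
    have hi : Integrable (fun r => a r ω) (timeMeasure t) :=
      (hω.mono_measure (timeMeasure_mono ht)).integrable one_le_two
    rw [hAeq t ht, sq_integral_timeMeasure hi]
    congr 1
    refine integral_congr_ae ?_
    filter_upwards [ae_le_timeMeasure t] with s hs
    rw [hAeq s (hs.trans ht), mul_comm]
  -- the mixed term, by the martingale property at each time
  have hAM' : ∫ ω, A t ω * M t ω ∂P = ∫ p : Ω × ℝ≥0,
      (a p.2 p.1 * x p.2 p.1 - a p.2 p.1 * x₀ p.1 - a p.2 p.1 * A p.2 p.1) ∂Q := by
    have i1 : Integrable (fun p : Ω × ℝ≥0 =>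
      a p.2 p.1 * x p.2 p.1 - a p.2 p.1 * x₀ p.1 - a p.2 p.1 * A p.2 p.1) Q :=
      (iax.sub iax₀).sub iaA
    rw [hmul (M t) iaM, hQ, integral_prod_symm _ iaM, integral_prod_symm _ i1]
    refine integral_congr_ae ?_
    filter_upwards [ae_le_timeMeasure t, haQ.integrable_sq.prod_left_ae] with s hs h2
    have has : StronglyMeasurable[F s] (a s) := ha.stronglyAdapted s
    have ha2s : MemLp (a s) 2 P := (memLp_two_iff_integrable_sq
      (has.mono (F.le s)).aestronglyMeasurable).2 h2
    rw [hM.integral_mul_eq hW hs ht has ha2s]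
    refine integral_congr_ae ?_
    filter_upwards [heq s (hs.trans ht)] with ω hω
    rw [hω, hAeq s (hs.trans ht)]
    ring
  have hx₀M := hM.integral_mul_zero hW ht hx₀ hx₀2
  have hMM := hM.integral_sq hW ht
  have hx₀A := hmul x₀ iax₀
  have i00 := hx₀2.integrable_sq
  have iAA := (hA2 t).integrable_sq
  have iMM := hM2.integrable_sq
  have iA0 := integrable_mul_of_memLp (hA2 t) hx₀2
  have i0M := integrable_mul_of_memLp hx₀2 hM2
  have iAM := integrable_mul_of_memLp (hA2 t) hM2
  have e : ∫ ω, x t ω ^ 2 ∂P = ∫ ω, ((((((x₀ ω ^ 2 + A t ω ^ 2) + M t ω ^ 2) +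
      2 * (A t ω * x₀ ω)) + 2 * (x₀ ω * M t ω)) + 2 * (A t ω * M t ω))) ∂P := by
    refine integral_congr_ae ?_
    filter_upwards [heq t ht] with ω hω
    rw [hω, hAeq t ht]
    ring
  have j1 : Integrable (fun ω => x₀ ω ^ 2 + A t ω ^ 2) P := i00.add iAA
  have j2 : Integrable (fun ω => (x₀ ω ^ 2 + A t ω ^ 2) + M t ω ^ 2) P := j1.add iMM
  have j3 : Integrable (fun ω => ((x₀ ω ^ 2 + A t ω ^ 2) + M t ω ^ 2) +
    2 * (A t ω * x₀ ω)) P := j2.add (iA0.const_mul 2)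
  have j4 : Integrable (fun ω => (((x₀ ω ^ 2 + A t ω ^ 2) + M t ω ^ 2) +
    2 * (A t ω * x₀ ω)) + 2 * (x₀ ω * M t ω)) P := j3.add (i0M.const_mul 2)
  rw [e, integral_add j4 (iAM.const_mul 2), integral_add j3 (i0M.const_mul 2),
    integral_add j2 (iA0.const_mul 2), integral_add j1 iMM, integral_add i00 iAA,
    integral_const_mul, integral_const_mul, integral_const_mul, hx₀M, hMM, hx₀A, hAA, hAM']
  have ixa : Integrable (fun p : Ω × ℝ≥0 => 2 * (x p.2 p.1 * a p.2 p.1)) Q :=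
    (integrable_mul_of_memLp hxQ haQ).const_mul 2
  have iaxx₀ : Integrable (fun p : Ω × ℝ≥0 => a p.2 p.1 * x p.2 p.1 - a p.2 p.1 * x₀ p.1) Q :=
    iax.sub iax₀
  rw [integral_sub iaxx₀ iaA, integral_sub iax iax₀, integral_add ixa hbQ.integrable_sq,
    integral_const_mul]
  have hc : ∫ p : Ω × ℝ≥0, x p.2 p.1 * a p.2 p.1 ∂Q = ∫ p : Ω × ℝ≥0, a p.2 p.1 * x p.2 p.1 ∂Q :=
    integral_congr_ae (Eventually.of_forall fun p => mul_comm _ _)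
  rw [hc]
  ring

end GraphMCF

namespace GraphMCF

open ComplexConjugate

/-! ### The energy estimate for the viscous approximation -/

theorem hasSum_lapSymb {f : Torus2 → ℝ} {g : Torus2 → Plane} (hf : MemLp f 2 volume)
    (hg : MemLp g 2 volume) (h : IsWeakGradient f g) :
    HasSum (fun k => lapSymb k * ‖coef f k‖ ^ 2) (∫ x, ‖g x‖ ^ 2) := by
  have hp := (isWeakGradient_iff hf hg).1 h
  have hs := (hasSum_normSq_coef (memLp_coord hg 0)).add (hasSum_normSq_coef (memLp_coord hg 1))
  have e : ∫ x, ‖g x‖ ^ 2 = (∫ x, g x 0 ^ 2) + ∫ x, g x 1 ^ 2 := by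
    rw [← integral_add (memLp_coord hg 0).integrable_sq (memLp_coord hg 1).integrable_sq]
    simp only [norm_sq_plane, Fin.sum_univ_two]
  rw [e]
  refine hs.congr_fun fun k => ?_
  rw [hp 0 k, hp 1 k, lapSymb, Fin.sum_univ_two, norm_mul, norm_mul]
  ring

theorem lapSymb_nonneg (k : Fin 2 → ℤ) : 0 ≤ lapSymb k := Finset.sum_nonneg fun _ _ => sq_nonneg _

/-- The functions whose `L²` inner products with `f` are the real and imaginary part of the `k`-th
Fourier coefficient of `f`. -/
noncomputable def cosMode (k : Fin 2 → ℤ) : L2 ℝ :=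
  toL2 fun x => (UnitAddTorus.mFourier (-k) x).re

/-- See `cosMode`. -/
noncomputable def sinMode (k : Fin 2 → ℤ) : L2 ℝ :=
  toL2 fun x => (UnitAddTorus.mFourier (-k) x).im

theorem inner_toL2 {φ : Torus2 → ℝ} (hφ : MemLp φ 2 volume) (f : L2 ℝ) :
    inner ℝ (toL2 φ) f = ∫ x, f x * φ x := by
  rw [L2.inner_def]
  refine integral_congr_ae ?_
  filter_upwards [toL2_coeFn hφ] with x hx
  rw [hx]
  rfl

theorem coef_re (f : L2 ℝ) (k : Fin 2 → ℤ) : (coef f k).re = inner ℝ (cosMode k) f := by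
  rw [cosMode, inner_toL2 (memLp_of_continuous
    (continuous_of_smooth (isSmoothOnTorus_mFourier (-k)).1) 2)]
  exact (coef_eq_of_tests (memLp_L2 f) k).1

theorem coef_im (f : L2 ℝ) (k : Fin 2 → ℤ) : (coef f k).im = inner ℝ (sinMode k) f := by
  rw [sinMode, inner_toL2 (memLp_of_continuous
    (continuous_of_smooth (isSmoothOnTorus_mFourier (-k)).2) 2)]
  exact (coef_eq_of_tests (memLp_L2 f) k).2

variable {Ω : Type*} {mΩ : MeasurableSpace Ω} {P : Measure Ω} [IsProbabilityMeasure P]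
  {F : Filtration ℝ≥0 mΩ} {T : ℝ≥0} {W : ℝ≥0 → Ω → ℝ}

/-- The image of an elementary process under the functional `⟨φ, ·⟩`. -/
noncomputable def innerElementary {E : Type*} [NormedAddCommGroup E] [InnerProductSpace ℝ E] (φ : E)
    (S : ElementaryProcess F E) : ElementaryProcess F ℝ where
  size := S.size
  time := S.time
  time_mono := S.time_mono
  coeff i ω := inner ℝ φ (S.coeff i ω)
  coeff_meas i := (continuous_const.inner continuous_id).comp_stronglyMeasurable (S.coeff_meas i)
  coeff_bdd i := by
    obtain ⟨C, hC⟩ := S.coeff_bdd i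
    exact ⟨‖φ‖ * C, fun ω => (norm_inner_le_norm _ _).trans
      (mul_le_mul_of_nonneg_left (hC ω) (norm_nonneg _))⟩

theorem tendsto_of_le_const_mul {f g : ℕ → ℝ≥0∞} {c : ℝ≥0∞} (hc : c ≠ ∞) (h : ∀ k, f k ≤ c * g k)
    (hg : Tendsto g atTop (𝓝 0)) : Tendsto f atTop (𝓝 0) := by
  have h2 := ENNReal.Tendsto.const_mul (a := c) hg (Or.inr hc)
  rw [mul_zero] at h2
  exact tendsto_of_tendsto_of_tendsto_of_le_of_le tendsto_const_nhds h2 (fun _ => zero_le) h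

theorem _root_.IsItoIntegral.inner_left {E : Type*} [NormedAddCommGroup E] [InnerProductSpace ℝ E]
    {g M : ℝ≥0 → Ω → E} (hM : IsItoIntegral P F T W g M) (φ : E) :
    IsItoIntegral P F T W (fun t ω => inner ℝ φ (g t ω)) (fun t ω => inner ℝ φ (M t ω)) := by
  obtain ⟨hg, hm, S, h1, h2⟩ := hM
  have hle : ∀ v : E, ‖inner ℝ φ v‖ₑ ^ 2 ≤ ‖φ‖ₑ ^ 2 * ‖v‖ₑ ^ 2 := by
    intro v
    rw [← mul_pow]
    gcongr
    rw [← ofReal_norm, ← ofReal_norm, ← ofReal_norm, ← ENNReal.ofReal_mul (norm_nonneg _)]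
    exact ENNReal.ofReal_le_ofReal (norm_inner_le_norm _ _)
  have hv : ∀ k t ω, (innerElementary φ (S k)).val t ω = inner ℝ φ ((S k).val t ω) := by
    intro k t ω
    simp only [ElementaryProcess.val, inner_sum]
    refine Finset.sum_congr rfl fun i _ => ?_
    by_cases h : t ∈ Set.Ioc ((S k).time i) ((S k).time (i + 1))
    · rw [Set.indicator_of_mem h, Set.indicator_of_mem (by exact h)]
      rfl
    · rw [Set.indicator_of_notMem h, Set.indicator_of_notMem (by exact h), inner_zero_right]
  have hi : ∀ k t ω, (innerElementary φ (S k)).integral W t ω =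
      inner ℝ φ ((S k).integral W t ω) := by
    intro k t ω
    simp only [ElementaryProcess.integral, inner_sum, real_inner_smul_right]
    rfl
  have hc : ‖φ‖ₑ ^ 2 ≠ ∞ := ENNReal.pow_ne_top enorm_ne_top
  refine ⟨(continuous_const.inner continuous_id).comp_stronglyMeasurable hg,
    fun t ht => (continuous_const.inner continuous_id).comp_aestronglyMeasurable (hm t ht),
    fun k => innerElementary φ (S k), ?_, fun t ht => ?_⟩
  · refine tendsto_of_le_const_mul hc (fun k => ?_) h1
    rw [← lintegral_const_mul' _ _ hc]
    refine lintegral_mono fun ω => ?_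
    rw [← lintegral_const_mul' _ _ hc]
    refine lintegral_mono fun t => ?_
    simp only [hv, ← inner_sub_right]
    exact hle _
  · refine tendsto_of_le_const_mul hc (fun k => ?_) (h2 t ht)
    rw [← lintegral_const_mul' _ _ hc]
    refine lintegral_mono fun ω => ?_
    simp only [hi, ← inner_sub_right]
    exact hle _

section Solution

variable {ε : ℝ} {u₀ : Ω → H1} {u : ℝ≥0 → Ω → L2 ℝ} {U : ℝ≥0 → Ω → H2}

/-- Almost sure continuity of paths makes the solution equal to its representative almost
everywhere with respect to the product measure. -/
theorem representative_ae (h : IsViscousSolution P F T W ε u₀ u U) :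
    ∀ᵐ p ∂P.prod (timeMeasure T), u p.2 p.1 = (U p.2 p.1).fn := by
  obtain ⟨s, hs, hsm, hP⟩ := exists_measurable_superset_of_null
    (show P {ω | ¬ ContinuousOn (fun t => u t ω) (Set.Iic T)} = 0 from h.continuous)
  have hcont : ∀ ω ∉ s, ContinuousOn (fun t => u t ω) (Set.Iic T) := fun ω hω => by
    by_contra hc
    exact hω (hs hc)
  set v : ℝ≥0 → Ω → L2 ℝ := fun t => sᶜ.indicator (u (min t T)) with hv
  have hvc : ∀ ω, Continuous fun t => v t ω := by
    intro ω
    by_cases hω : ω ∈ s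
    · have : (fun t => v t ω) = fun _ => 0 := by
        funext t
        exact Set.indicator_of_notMem (by simpa using hω) _
      rw [this]
      exact continuous_const
    · have : (fun t => v t ω) = fun t => u (min t T) ω := by
        funext t
        exact Set.indicator_of_mem (by simpa using hω) _
      rw [this]
      exact (hcont ω hω).comp_continuous (by fun_prop) fun t => Set.mem_Iic.2 (min_le_right _ _)
  have hvm : ∀ t, StronglyMeasurable (v t) := fun t =>
    ((h.adapted _ (min_le_right _ _)).mono (F.le _)).indicator hsm.compl
  have hvj : StronglyMeasurable fun p : Ω × ℝ≥0 => v p.2 p.1 :=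
    (stronglyMeasurable_uncurry_of_continuous_of_stronglyMeasurable hvc hvm).comp_measurable
      measurable_swap
  have hUj : StronglyMeasurable fun p : Ω × ℝ≥0 => (U p.2 p.1).fn :=
    continuous_H2_fn.comp_stronglyMeasurable (stronglyMeasurable_of_predictable h.predictable)
  have hns : ∀ᵐ ω ∂P, ω ∉ s := measure_eq_zero_iff_ae_notMem.1 hP
  have hve : ∀ ω ∉ s, ∀ t ≤ T, v t ω = u t ω := by
    intro ω hω t ht
    simp only [hv]
    rw [Set.indicator_of_mem (by simpa using hω), min_eq_left ht]
  have h1 : ∀ᵐ p ∂P.prod (timeMeasure T), v p.2 p.1 = (U p.2 p.1).fn := by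
    rw [Measure.ae_prod_iff_ae_ae (hvj.measurableSet_eq_fun hUj)]
    filter_upwards [h.representative, hns] with ω hω hω'
    filter_upwards [hω, ae_le_timeMeasure T] with t h2 h3
    rw [hve ω hω' t h3, h2]
  have h2 : ∀ᵐ p ∂P.prod (timeMeasure T), p.1 ∉ s := Measure.quasiMeasurePreserving_fst.ae hns
  have h3 : ∀ᵐ p ∂P.prod (timeMeasure T), p.2 ≤ T :=
    Measure.quasiMeasurePreserving_snd.ae (ae_le_timeMeasure T)
  filter_upwards [h1, h2, h3] with p e1 e2 e3
  rw [← e1, hve _ e2 _ e3]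

theorem stronglyMeasurable_comp_solution {E : Type*} [TopologicalSpace E]
    (h : IsViscousSolution P F T W ε u₀ u U) {f : H2 → E} (hf : Continuous f) :
    StronglyMeasurable fun p : Ω × ℝ≥0 => f (U p.2 p.1) :=
  hf.comp_stronglyMeasurable (stronglyMeasurable_of_predictable h.predictable)

/-- Whatever is dominated by the squared `H²` norm is integrable along the solution. -/
theorem lintegral_le_sqNorm (h : IsViscousSolution P F T W ε u₀ u U) {f : H2 → ℝ≥0∞}
    (hf : Measurable fun p : Ω × ℝ≥0 => f (U p.2 p.1)) {c : ℝ≥0∞} (hc : c ≠ ∞)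
    (hle : ∀ z, f z ≤ c * z.sqNorm) :
    ∫⁻ p : Ω × ℝ≥0, f (U p.2 p.1) ∂(P.prod (timeMeasure T)) < ∞ := by
  rw [lintegral_prod _ hf.aemeasurable]
  refine lt_of_le_of_lt ?_ (ENNReal.mul_lt_top hc.lt_top h.sq_integrable)
  rw [← lintegral_const_mul' _ _ hc]
  refine lintegral_mono fun ω => ?_
  rw [← lintegral_const_mul' _ _ hc]
  exact lintegral_mono fun t => hle _

theorem memLp_comp_solution (h : IsViscousSolution P F T W ε u₀ u U) {E : Type*}
    [NormedAddCommGroup E] {f : H2 → E} (hf : Continuous f) {c : ℝ≥0∞} (hc : c ≠ ∞)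
    (hle : ∀ z, ‖f z‖ₑ ^ 2 ≤ c * z.sqNorm) :
    MemLp (fun p : Ω × ℝ≥0 => f (U p.2 p.1)) 2 (P.prod (timeMeasure T)) := by
  have hm := stronglyMeasurable_comp_solution h hf
  refine ⟨hm.aestronglyMeasurable, ?_⟩
  have h1 := lintegral_le_sqNorm h (f := fun z => ‖f z‖ₑ ^ 2) (hm.enorm.pow_const 2) hc hle
  rw [← eLpNorm_two_sq] at h1
  exact (ENNReal.pow_lt_top_iff.1 h1).resolve_right two_ne_zero

theorem enorm_sq_le_of_norm_sq_le {E : Type*} [NormedAddCommGroup E] {z : H2} {v : E}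
    (h : ‖v‖ ^ 2 ≤ 20 * ∑ i, ‖z.hess i‖ ^ 2) : ‖v‖ₑ ^ 2 ≤ 20 * z.sqNorm := by
  rw [← ofReal_norm, ← ENNReal.ofReal_pow (norm_nonneg _)]
  refine (ENNReal.ofReal_le_ofReal h).trans ?_
  rw [ENNReal.ofReal_mul (by norm_num), ENNReal.ofReal_ofNat]
  gcongr
  exact sum_norm_hess_le z

theorem norm_lap_sq_le (z : H2) : ‖z.lap‖ ^ 2 ≤ 20 * ∑ i, ‖z.hess i‖ ^ 2 := by
  have e : z.lap = toL2 (trHess z) := rfl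
  rw [e, norm_toL2_sq (memLp_trHess z)]
  refine le_trans (integral_mono (memLp_trHess z).integrable_sq
    (((memLp_trHess z).integrable_sq.add (memLp_drift 0 z).integrable_sq).add
    ((memLp_areaPartial z 0).integrable_sq.add (memLp_areaPartial z 1).integrable_sq)) fun x => ?_)
    (integral_energy_le le_rfl zero_le_one z)
  simp only [Pi.add_apply]
  nlinarith [sq_nonneg (drift 0 z x), sq_nonneg (areaPartial z 0 x), sq_nonneg (areaPartial z 1 x)]

theorem enorm_fn_sq_le (z : H2) : ‖z.fn‖ₑ ^ 2 ≤ 1 * z.sqNorm := by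
  rw [one_mul, H2.sqNorm, add_assoc]
  exact le_self_add

theorem enorm_grad_sq_le (z : H2) : ‖z.grad‖ₑ ^ 2 ≤ 1 * z.sqNorm := by
  rw [one_mul, H2.sqNorm, add_assoc]
  exact le_self_add.trans le_add_self

variable (h : IsViscousSolution P F T W ε u₀ u U) (hε : ε ∈ Set.Ioo (0 : ℝ) 1)

include h hε

theorem memLp_drift_process :
    MemLp (fun p : Ω × ℝ≥0 => toL2 (drift ε (U p.2 p.1))) 2 (P.prod (timeMeasure T)) :=
  memLp_comp_solution h (continuous_toL2_drift ε) (c := 20) (by simp)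
    fun z => enorm_sq_le_of_norm_sq_le (norm_drift_sq_le hε.1.le hε.2.le z)

omit hε in
theorem memLp_lap_process :
    MemLp (fun p : Ω × ℝ≥0 => (U p.2 p.1).lap) 2 (P.prod (timeMeasure T)) :=
  memLp_comp_solution h continuous_lap (c := 20) (by simp)
    fun z => enorm_sq_le_of_norm_sq_le (norm_lap_sq_le z)

theorem equation_drift : ∃ M : ℝ≥0 → Ω → L2 ℝ,
    IsItoIntegral P F T W (fun t ω => toL2 (U t ω).area) M ∧
    ∀ t ≤ T, ∀ᵐ ω ∂P,
      u t ω = u 0 ω + ∫ s, toL2 (drift ε (U s ω)) ∂timeMeasure t + M t ω := by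
  obtain ⟨M, hM, heq⟩ := h.equation
  refine ⟨M, hM, fun t ht => ?_⟩
  have hQ : P.prod (timeMeasure t) ≤ P.prod (timeMeasure T) := prod_timeMeasure_mono ht
  have i1 := (((memLp_drift_process h hε).mono_measure hQ).integrable one_le_two).prod_right_ae
  have i2 := (((memLp_lap_process h).mono_measure hQ).integrable one_le_two).prod_right_ae
  filter_upwards [heq t ht, i1, i2] with ω hω j1 j2
  have e : ∀ s, (1 / 2 : ℝ) • toL2 (fun x => (U s ω).area x * (U s ω).curv x) =
      toL2 (drift ε (U s ω)) - (1 / 2 + ε) • (U s ω).lap := by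
    intro s
    rw [toL2_drift, add_sub_cancel_left]
  rw [hω, ← integral_smul (1 / 2 : ℝ)]
  simp only [e]
  have j3 : Integrable (fun s => (1 / 2 + ε) • (U s ω).lap) (timeMeasure t) :=
    j2.smul (1 / 2 + ε : ℝ)
  rw [integral_sub j1 j3, integral_smul]
  abel

/-- Itô's formula in expectation for the component `⟨φ, u(t)⟩` of the solution. -/
theorem integral_inner_sq (hT : 0 < T) (φ : L2 ℝ) {t : ℝ≥0} (ht : t ≤ T) :
    MemLp (fun ω => inner ℝ φ (u 0 ω)) 2 P ∧
    ∫ ω, (inner ℝ φ (u t ω) : ℝ) ^ 2 ∂P = ∫ ω, (inner ℝ φ (u 0 ω) : ℝ) ^ 2 ∂P +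
      ∫ p : Ω × ℝ≥0, (2 * (inner ℝ φ (U p.2 p.1).fn * inner ℝ φ (toL2 (drift ε (U p.2 p.1)))) +
        (inner ℝ φ (toL2 (U p.2 p.1).area) : ℝ) ^ 2) ∂(P.prod (timeMeasure t)) := by
  obtain ⟨M, hM, heq⟩ := equation_drift h hε
  have hMφ := hM.inner_left φ
  have hcφ : Continuous fun v : L2 ℝ => inner ℝ φ v := continuous_const.inner continuous_id
  have ha : IsStronglyPredictable F fun s ω => (inner ℝ φ (toL2 (drift ε (U s ω))) : ℝ) :=
    (hcφ.comp (continuous_toL2_drift ε)).comp_stronglyMeasurable h.predictable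
  have hdr := memLp_drift_process h hε
  have ha2 : MemLp (fun p : Ω × ℝ≥0 => (inner ℝ φ (toL2 (drift ε (U p.2 p.1))) : ℝ)) 2
    (P.prod (timeMeasure T)) := hdr.const_inner φ
  have hrep := representative_ae h
  have hfn : MemLp (fun p : Ω × ℝ≥0 => (U p.2 p.1).fn) 2 (P.prod (timeMeasure T)) :=
    memLp_comp_solution h continuous_H2_fn ENNReal.one_ne_top enorm_fn_sq_le
  have hxU : (fun p : Ω × ℝ≥0 => (inner ℝ φ (U p.2 p.1).fn : ℝ)) =ᵐ[P.prod (timeMeasure T)]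
      fun p => inner ℝ φ (u p.2 p.1) := by
    filter_upwards [hrep] with p hp
    rw [hp]
  have hx : MemLp (fun p : Ω × ℝ≥0 => (inner ℝ φ (u p.2 p.1) : ℝ)) 2 (P.prod (timeMeasure T)) :=
    (memLp_congr_ae hxU).1 (hfn.const_inner φ)
  have hx₀ : StronglyMeasurable[F 0] fun ω => (inner ℝ φ (u 0 ω) : ℝ) :=
    hcφ.comp_stronglyMeasurable (h.adapted 0 zero_le)
  have heqφ : ∀ t ≤ T, ∀ᵐ ω ∂P, (inner ℝ φ (u t ω) : ℝ) = inner ℝ φ (u 0 ω) +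
      ∫ s, inner ℝ φ (toL2 (drift ε (U s ω))) ∂timeMeasure t + inner ℝ φ (M t ω) := by
    intro t ht
    have i1 := ((hdr.mono_measure (prod_timeMeasure_mono ht)).integrable one_le_two).prod_right_ae
    filter_upwards [heq t ht, i1] with ω hω j1
    rw [hω, inner_add_right, inner_add_right, integral_inner j1]
  -- the initial value is square integrable since the solution is so at almost every time
  have hx₀2 : MemLp (fun ω => (inner ℝ φ (u 0 ω) : ℝ)) 2 P := by
    have hne : (timeMeasure T) ≠ 0 := by
      rw [Ne, ← Measure.measure_univ_eq_zero, timeMeasure_univ]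
      exact_mod_cast hT.ne'
    have : (ae (timeMeasure T)).NeBot := ae_neBot.2 hne
    obtain ⟨s, hs, hsT⟩ := (hx.integrable_sq.prod_left_ae.and (ae_le_timeMeasure T)).exists
    have hxs : MemLp (fun ω => (inner ℝ φ (u s ω) : ℝ)) 2 P :=
      (memLp_two_iff_integrable_sq (hcφ.comp_stronglyMeasurable
        ((h.adapted s hsT).mono (F.le s))).aestronglyMeasurable).2 hs
    have hAs := memLp_primitive (stronglyMeasurable_of_predictable ha) ha2 s
    refine (memLp_congr_ae ?_).1 ((hxs.sub hAs).sub (hMφ.memLp h.wiener hsT))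
    filter_upwards [heqφ s hsT] with ω hω
    simp only [Pi.sub_apply]
    rw [hω, primitive_eq hsT]
    ring
  refine ⟨hx₀2, ?_⟩
  have hmain := integral_sq_process h.wiener hMφ ha ha2 hx hx₀ hx₀2 heqφ ht
  rw [hmain]
  congr 1
  refine integral_congr_ae ?_
  have hac : P.prod (timeMeasure t) ≤ P.prod (timeMeasure T) := prod_timeMeasure_mono ht
  filter_upwards [Measure.absolutelyContinuous_of_le hac hrep] with p hp
  rw [hp]

end Solution

end GraphMCF

namespace GraphMCF

open ComplexConjugate

/-! ### Summation of the energy balance over the Fourier modes -/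

variable {Ω : Type*} {mΩ : MeasurableSpace Ω} {P : Measure Ω} [IsProbabilityMeasure P]
  {F : Filtration ℝ≥0 mΩ} {T : ℝ≥0} {W : ℝ≥0 → Ω → ℝ}

/-- The integrand in the energy balance of `⟨φ, u⟩`. -/
noncomputable def modeTerm (ε : ℝ) (φ : L2 ℝ) (z : H2) : ℝ :=
  2 * (inner ℝ φ z.fn * inner ℝ φ (toL2 (drift ε z))) + (inner ℝ φ (toL2 z.area) : ℝ) ^ 2

theorem norm_coef_sq (f : L2 ℝ) (k : Fin 2 → ℤ) :
    ‖coef f k‖ ^ 2 = (inner ℝ (cosMode k) f : ℝ) ^ 2 + (inner ℝ (sinMode k) f : ℝ) ^ 2 := by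
  rw [← Complex.normSq_eq_norm_sq, Complex.normSq_apply, coef_re, coef_im]
  ring

theorem energyTerm_eq_modeTerm (ε : ℝ) (z : H2) (k : Fin 2 → ℤ) :
    energyTerm ε z k =
      lapSymb k * (modeTerm ε (cosMode k) z + modeTerm ε (sinMode k) z) := by
  have h1 : coef (drift ε z) k = coef (toL2 (drift ε z)) k :=
    coef_congr (toL2_coeFn (memLp_drift ε z)).symm k
  have h2 : coef (fun x => areaFn (z.grad x)) k = coef (toL2 z.area) k :=
    coef_congr (toL2_coeFn (memLp_area (memLp_L2 z.grad))).symm k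
  rw [energyTerm, h1, h2, norm_coef_sq, Complex.mul_re, Complex.conj_re, Complex.conj_im,
    coef_re, coef_im, coef_re, coef_im, modeTerm, modeTerm]
  ring

section Solution

variable {ε : ℝ} {u₀ : Ω → H1} {u : ℝ≥0 → Ω → L2 ℝ} {U : ℝ≥0 → Ω → H2}

theorem integrable_modeTerm (h : IsViscousSolution P F T W ε u₀ u U)
    (hε : ε ∈ Set.Ioo (0 : ℝ) 1) (φ : L2 ℝ) :
    Integrable (fun p : Ω × ℝ≥0 => modeTerm ε φ (U p.2 p.1)) (P.prod (timeMeasure T)) := by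
  obtain ⟨M, hM, -⟩ := h.equation
  have h1 : MemLp (fun p : Ω × ℝ≥0 => (U p.2 p.1).fn) 2 (P.prod (timeMeasure T)) :=
    memLp_comp_solution h continuous_H2_fn ENNReal.one_ne_top enorm_fn_sq_le
  have h2 := (memLp_drift_process h hε).const_inner (𝕜 := ℝ) φ
  have h3 := ((hM.inner_left φ).memLp_integrand).integrable_sq
  exact ((integrable_mul_of_memLp (h1.const_inner (𝕜 := ℝ) φ) h2).const_mul 2).add h3

theorem integrable_energyTerm (h : IsViscousSolution P F T W ε u₀ u U)
    (hε : ε ∈ Set.Ioo (0 : ℝ) 1) (k : Fin 2 → ℤ) :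
    Integrable (fun p : Ω × ℝ≥0 => energyTerm ε (U p.2 p.1) k) (P.prod (timeMeasure T)) := by
  simp only [energyTerm_eq_modeTerm]
  exact ((integrable_modeTerm h hε _).add (integrable_modeTerm h hε _)).const_mul _

/-- The energy balance of a single Fourier mode, at a time at which the solution is square
integrable. -/
theorem integral_norm_coef_sq (h : IsViscousSolution P F T W ε u₀ u U)
    (hε : ε ∈ Set.Ioo (0 : ℝ) 1) (hT : 0 < T) (k : Fin 2 → ℤ) {t : ℝ≥0} (ht : t ≤ T)
    (hut : MemLp (u t) 2 P) :
    Integrable (fun ω => ‖coef (u 0 ω) k‖ ^ 2) P ∧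
    lapSymb k * ∫ ω, ‖coef (u t ω) k‖ ^ 2 ∂P = lapSymb k * ∫ ω, ‖coef (u 0 ω) k‖ ^ 2 ∂P +
      ∫ p : Ω × ℝ≥0, energyTerm ε (U p.2 p.1) k ∂(P.prod (timeMeasure t)) := by
  obtain ⟨c1, c2⟩ := integral_inner_sq h hε hT (cosMode k) ht
  obtain ⟨s1, s2⟩ := integral_inner_sq h hε hT (sinMode k) ht
  have hle := prod_timeMeasure_mono (P := P) ht
  have i1 := (integrable_modeTerm h hε (cosMode k)).mono_measure hle
  have i2 := (integrable_modeTerm h hε (sinMode k)).mono_measure hle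
  simp only [norm_coef_sq, energyTerm_eq_modeTerm]
  refine ⟨c1.integrable_sq.add s1.integrable_sq, ?_⟩
  rw [integral_const_mul, integral_add i1 i2, ← mul_add,
    integral_add c1.integrable_sq s1.integrable_sq,
    integral_add (hut.const_inner (𝕜 := ℝ) _).integrable_sq (hut.const_inner (𝕜 := ℝ) _).integrable_sq, c2, s2]
  simp only [modeTerm]
  ring

theorem tendsto_integral_sum_energyTerm (h : IsViscousSolution P F T W ε u₀ u U)
    (hε : ε ∈ Set.Ioo (0 : ℝ) 1) {t : ℝ≥0} (ht : t ≤ T) :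
    Tendsto (fun K : Finset (Fin 2 → ℤ) =>
      ∫ p : Ω × ℝ≥0, ∑ k ∈ K, energyTerm ε (U p.2 p.1) k ∂(P.prod (timeMeasure t))) atTop
      (𝓝 (∫ p : Ω × ℝ≥0, ∑' k, energyTerm ε (U p.2 p.1) k ∂(P.prod (timeMeasure t)))) := by
  have hle := prod_timeMeasure_mono (P := P) ht
  have hm : Measurable fun p : Ω × ℝ≥0 => 20 * ∑ i, ‖(U p.2 p.1).hess i‖ ^ 2 := by
    refine Measurable.const_mul (Finset.measurable_sum _ fun i _ => ?_) _
    exact ((stronglyMeasurable_comp_solution h (continuous_H2_hess i)).norm.measurable).pow_const 2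
  have hb : Integrable (fun p : Ω × ℝ≥0 => 20 * ∑ i, ‖(U p.2 p.1).hess i‖ ^ 2)
      (P.prod (timeMeasure T)) := by
    refine ⟨hm.aestronglyMeasurable, ?_⟩
    rw [hasFiniteIntegral_iff_ofReal (ae_of_all _ fun p => by positivity)]
    refine lintegral_le_sqNorm h (f := fun z => ENNReal.ofReal (20 * ∑ i, ‖z.hess i‖ ^ 2))
      hm.ennreal_ofReal (c := 20) (by simp) fun z => ?_
    rw [ENNReal.ofReal_mul (by norm_num), ENNReal.ofReal_ofNat]
    gcongr
    exact sum_norm_hess_le z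
  refine tendsto_integral_filter_of_dominated_convergence _
    (Eventually.of_forall fun K => (integrable_finsetSum K fun k _ =>
      (integrable_energyTerm h hε k).mono_measure hle).aestronglyMeasurable)
    (Eventually.of_forall fun K => ae_of_all _ fun p => ?_) (hb.mono_measure hle)
    (ae_of_all _ fun p => ?_)
  · rw [Real.norm_eq_abs]
    exact (abs_sum_energyTerm_le ε _ K).trans (integral_energy_le hε.1.le hε.2.le _)
  · exact (hasSum_energyTerm ε (U p.2 p.1)).summable.hasSum

/-- Finite partial sums of the expected Dirichlet energy are bounded by the initial energy. For `K₀`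
fixed, the energy balance is used for larger and larger sets of modes, where the contribution of
the energy terms becomes nonpositive in the limit. -/
theorem sum_lapSymb_integral_le (h : IsViscousSolution P F T W ε u₀ u U)
    (hε : ε ∈ Set.Ioo (0 : ℝ) 1) (hT : 0 < T) {C : ℝ≥0}
    (hC : ∫⁻ ω, ‖(u₀ ω).grad‖ₑ ^ 2 ∂P ≤ C) {t : ℝ≥0} (ht : t ≤ T) (hut : MemLp (u t) 2 P)
    (K₀ : Finset (Fin 2 → ℤ)) :
    ∑ k ∈ K₀, lapSymb k * ∫ ω, ‖coef (u t ω) k‖ ^ 2 ∂P ≤ C := by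
  have hle := prod_timeMeasure_mono (P := P) ht
  -- the energy balance, with the initial energy bounded by `C`
  have hK : ∀ K : Finset (Fin 2 → ℤ),
      ∑ k ∈ K, lapSymb k * ∫ ω, ‖coef (u t ω) k‖ ^ 2 ∂P ≤
        C + ∫ p : Ω × ℝ≥0, ∑ k ∈ K, energyTerm ε (U p.2 p.1) k ∂(P.prod (timeMeasure t)) := by
    intro K
    rw [integral_finsetSum _ fun k _ => (integrable_energyTerm h hε k).mono_measure hle,
      Finset.sum_congr rfl fun k _ => (integral_norm_coef_sq h hε hT k ht hut).2,
      Finset.sum_add_distrib]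
    gcongr
    have hi : ∀ k, Integrable (fun ω => lapSymb k * ‖coef (u 0 ω) k‖ ^ 2) P := fun k =>
      (integral_norm_coef_sq h hε hT k ht hut).1.const_mul _
    simp only [← integral_const_mul]
    rw [← integral_finsetSum _ fun k _ => hi k,
      integral_eq_lintegral_of_nonneg_ae
        (ae_of_all _ fun ω => Finset.sum_nonneg fun k _ =>
          mul_nonneg (lapSymb_nonneg k) (sq_nonneg _))
        (integrable_finsetSum _ fun k _ => hi k).aestronglyMeasurable]
    refine ENNReal.toReal_le_coe_of_le_coe (le_trans (lintegral_mono_ae ?_) hC)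
    filter_upwards [h.initial] with ω hω
    rw [← ofReal_norm, ← ENNReal.ofReal_pow (norm_nonneg _), hω, norm_sq_L2]
    exact ENNReal.ofReal_le_ofReal (sum_le_hasSum K
      (fun k _ => mul_nonneg (lapSymb_nonneg k) (sq_nonneg _))
      (hasSum_lapSymb (memLp_L2 _) (memLp_L2 _) (u₀ ω).2))
  have hlim := (tendsto_integral_sum_energyTerm (P := P) h hε ht).const_add (C : ℝ)
  refine (ge_of_tendsto hlim (eventually_atTop.2 ⟨K₀, fun K hK₀ => le_trans ?_ (hK K)⟩)).trans ?_
  · exact Finset.sum_le_sum_of_subset_of_nonneg hK₀ fun k _ _ =>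
      mul_nonneg (lapSymb_nonneg k) (integral_nonneg fun ω => sq_nonneg _)
  · have : ∫ p : Ω × ℝ≥0, ∑' k, energyTerm ε (U p.2 p.1) k ∂(P.prod (timeMeasure t)) ≤ 0 :=
      integral_nonpos fun p => tsum_energyTerm_nonpos hε.1.le _
    linarith

/-- The energy estimate: the expected Dirichlet energy does not increase in time, hence it is
bounded by its initial value, uniformly in the viscosity. -/
theorem lintegral_grad_le (h : IsViscousSolution P F T W ε u₀ u U)
    (hε : ε ∈ Set.Ioo (0 : ℝ) 1) (hT : 0 < T) {C : ℝ≥0}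
    (hC : ∫⁻ ω, ‖(u₀ ω).grad‖ₑ ^ 2 ∂P ≤ C) :
    ∫⁻ ω, ∫⁻ t, ‖(U t ω).grad‖ₑ ^ 2 ∂timeMeasure T ∂P ≤ T * C := by
  have hm : Measurable fun p : Ω × ℝ≥0 => ‖(U p.2 p.1).grad‖ₑ ^ 2 :=
    (stronglyMeasurable_comp_solution h continuous_H2_grad).enorm.pow_const 2
  have hfn : MemLp (fun p : Ω × ℝ≥0 => (U p.2 p.1).fn) 2 (P.prod (timeMeasure T)) :=
    memLp_comp_solution h continuous_H2_fn ENNReal.one_ne_top enorm_fn_sq_le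
  have hswap : ∀ᵐ t ∂timeMeasure T, ∀ᵐ ω ∂P, u t ω = (U t ω).fn :=
    Measure.ae_ae_of_ae_prod (Measure.measurePreserving_swap.quasiMeasurePreserving.ae
      (representative_ae h))
  rw [lintegral_lintegral_swap hm.aemeasurable]
  have hmain : ∀ᵐ t ∂timeMeasure T, ∫⁻ ω, ‖(U t ω).grad‖ₑ ^ 2 ∂P ≤ C := by
    filter_upwards [hswap, hfn.integrable_norm_pow two_ne_zero |>.prod_left_ae,
      ae_le_timeMeasure T] with t h1 h2 ht
    -- second moments are finite only at almost every time, by integrability in time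
    have hut : MemLp (u t) 2 P := by
      have hsm : AEStronglyMeasurable (u t) P :=
        ((h.adapted t ht).mono (F.le t)).aestronglyMeasurable
      refine (memLp_two_iff_integrable_sq_norm hsm).2 (h2.congr ?_)
      filter_upwards [h1] with ω hω
      rw [hω]
    have hint : ∀ k, Integrable (fun ω => lapSymb k * ‖coef (u t ω) k‖ ^ 2) P := fun k => by
      simp only [norm_coef_sq]
      exact ((hut.const_inner (𝕜 := ℝ) _).integrable_sq.add (hut.const_inner (𝕜 := ℝ) _).integrable_sq).const_mul _
    have e : ∀ᵐ ω ∂P, ‖(U t ω).grad‖ₑ ^ 2 =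
        ∑' k, ENNReal.ofReal (lapSymb k * ‖coef (u t ω) k‖ ^ 2) := by
      filter_upwards [h1] with ω hω
      have hs := hasSum_lapSymb (memLp_L2 _) (memLp_L2 _) (U t ω).2.1
      rw [← ENNReal.ofReal_tsum_of_nonneg
        (fun k => mul_nonneg (lapSymb_nonneg k) (sq_nonneg _)), hω]
      · rw [← ofReal_norm, ← ENNReal.ofReal_pow (norm_nonneg _), norm_sq_L2]
        exact congrArg ENNReal.ofReal hs.tsum_eq.symm
      · rw [hω]
        exact hs.summable
    rw [lintegral_congr_ae e, lintegral_tsum fun k => (hint k).aemeasurable.ennreal_ofReal,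
      ENNReal.tsum_eq_iSup_sum]
    refine iSup_le fun K => ?_
    have e2 : ∀ k, ∫⁻ ω, ENNReal.ofReal (lapSymb k * ‖coef (u t ω) k‖ ^ 2) ∂P =
        ENNReal.ofReal (lapSymb k * ∫ ω, ‖coef (u t ω) k‖ ^ 2 ∂P) := fun k => by
      rw [← integral_const_mul, ofReal_integral_eq_lintegral_ofReal (hint k)
        (ae_of_all _ fun ω => mul_nonneg (lapSymb_nonneg k) (sq_nonneg _))]
    simp only [e2]
    rw [← ENNReal.ofReal_sum_of_nonneg fun k _ =>
      mul_nonneg (lapSymb_nonneg k) (integral_nonneg fun ω => sq_nonneg _)]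
    exact ENNReal.ofReal_le_of_le_toReal
      (by simpa using sum_lapSymb_integral_le h hε hT hC ht hut K)
  refine (lintegral_mono_ae hmain).trans ?_
  rw [lintegral_const, timeMeasure_univ, mul_comm]

end Solution

end GraphMCF

namespace GraphMCF

/-! ### Weak gradients and divergences of paths -/

/-- The classical gradient of a function on the torus. -/
noncomputable def torusGrad (φ : Torus2 → ℝ) (x : Torus2) : Plane :=
  WithLp.toLp 2 fun i => torusPartial i φ x

theorem continuous_torusGrad {φ : Torus2 → ℝ} (hφ : IsSmoothOnTorus φ) :
    Continuous (torusGrad φ) :=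
  (PiLp.continuous_toLp 2 _).comp (continuous_pi fun i => continuous_torusPartial hφ i)

theorem inner_toL2_plane {ψ : Torus2 → Plane} (hψ : MemLp ψ 2 volume) (f : L2 Plane) :
    inner ℝ (toL2 ψ) f = ∫ x, ∑ i, f x i * ψ x i := by
  rw [L2.inner_def]
  refine integral_congr_ae ?_
  filter_upwards [toL2_coeFn hψ] with x hx
  rw [hx]
  simp [PiLp.inner_apply]

/-- The constant field in the `i`-th coordinate direction, multiplied by `φ`. -/
noncomputable def axisField (φ : Torus2 → ℝ) (i : Fin 2) (x : Torus2) : Plane :=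
  φ x • EuclideanSpace.single i 1

/-- The weak gradient relation in `L²` is given by countably many linear functionals, the tests
against Fourier modes. -/
theorem exists_gradient_tests : ∃ (a : ((Fin 2 → ℤ) × Bool) × Fin 2 → L2 ℝ)
    (b : ((Fin 2 → ℤ) × Bool) × Fin 2 → L2 Plane), ∀ (f : L2 ℝ) (g : L2 Plane),
    IsWeakGradient f g ↔ ∀ j, (inner ℝ (a j) f : ℝ) = inner ℝ (b j) g := by
  refine ⟨fun j => toL2 (torusPartial j.2 (mode j.1)), fun j => -toL2 (axisField (mode j.1) j.2),
    fun f g => ?_⟩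
  rw [isWeakGradient_iff_mode (memLp_L2 f) (memLp_L2 g)]
  refine Iff.trans ?_ (Prod.forall (α := (Fin 2 → ℤ) × Bool) (β := Fin 2)).symm
  refine forall_congr' fun j => forall_congr' fun i => ?_
  have hs := isSmoothOnTorus_mode j
  have hc : Continuous (axisField (mode j) i) := (continuous_of_smooth hs).smul continuous_const
  rw [inner_neg_left, inner_toL2 (memLp_of_continuous (continuous_torusPartial hs i) 2),
    inner_toL2_plane (memLp_of_continuous hc 2)]
  have e : ∀ x, ∑ l, g x l * axisField (mode j) i x l = g x i * mode j x := fun x => by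
    fin_cases i <;> simp [axisField]
  simp only [e]

/-- The analogue of `exists_gradient_tests` for the weak divergence. -/
theorem exists_divergence_tests : ∃ (a : (Fin 2 → ℤ) × Bool → L2 Plane)
    (b : (Fin 2 → ℤ) × Bool → L2 ℝ), ∀ (f : L2 Plane) (v : L2 ℝ),
    IsWeakDivergence f v ↔ ∀ j, (inner ℝ (a j) f : ℝ) = inner ℝ (b j) v := by
  refine ⟨fun j => toL2 (torusGrad (mode j)), fun j => -toL2 (mode j), fun f v => ?_⟩
  rw [isWeakDivergence_iff_mode (memLp_L2 f) (memLp_L2 v)]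
  refine forall_congr' fun j => ?_
  have hs := isSmoothOnTorus_mode j
  rw [inner_neg_left, inner_toL2 (memLp_of_continuous (continuous_of_smooth hs) 2),
    inner_toL2_plane (memLp_of_continuous (continuous_torusGrad hs) 2)]
  rfl

/-- A relation between vector valued functions that holds pointwise almost everywhere and is given
by countably many linear functionals is itself given by linear functionals. -/
theorem ae_forall_inner_eq_iff {α : Type*} {mα : MeasurableSpace α} {τ : Measure α}
    [IsFiniteMeasure τ] {A B J : Type*} [NormedAddCommGroup A] [InnerProductSpace ℝ A]
    [NormedAddCommGroup B] [InnerProductSpace ℝ B] [Countable J] (a : J → A) (b : J → B)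
    (u : Lp A 2 τ) (g : Lp B 2 τ) :
    (∀ᵐ t ∂τ, ∀ j, (inner ℝ (a j) (u t) : ℝ) = inner ℝ (b j) (g t)) ↔
      ∀ (j : J) (s : Set α) (hs : MeasurableSet s),
        (inner ℝ (indicatorConstLp 2 hs (measure_ne_top τ s) (a j)) u : ℝ) =
          inner ℝ (indicatorConstLp 2 hs (measure_ne_top τ s) (b j)) g := by
  rw [ae_all_iff]
  refine forall_congr' fun j => ?_
  simp only [L2.inner_indicatorConstLp_eq_setIntegral_inner]
  have iu : Integrable (fun t => (inner ℝ (a j) (u t) : ℝ)) τ :=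
    ((Lp.memLp u).const_inner (𝕜 := ℝ) (a j)).integrable one_le_two
  have ig : Integrable (fun t => (inner ℝ (b j) (g t) : ℝ)) τ :=
    ((Lp.memLp g).const_inner (𝕜 := ℝ) (b j)).integrable one_le_two
  refine ⟨fun h s hs => ?_, fun h => ?_⟩
  · exact integral_congr_ae (ae_restrict_of_ae h)
  · exact Integrable.ae_eq_of_forall_setIntegral_eq _ _ iu ig fun s hs _ => h s hs

section Paths

variable {T : ℝ≥0}

/-- `g` is the spatial weak gradient of the path `u`. -/
def GradRel (u : L2L2 T ℝ) (g : L2L2 T Plane) : Prop :=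
  ∀ᵐ t ∂timeMeasure T, IsWeakGradient (u t) (g t)

/-- `v` is the spatial weak divergence of the path `f`. -/
def DivRel (f : L2L2 T Plane) (v : L2L2 T ℝ) : Prop :=
  ∀ᵐ t ∂timeMeasure T, IsWeakDivergence (f t) (v t)

/-- The gradient relation for paths is given by linear functionals, obtained from the spatial tests
by localisation to measurable sets of times. In particular it is closed. -/
theorem exists_gradRel_tests : ∃ (J : Type) (a : J → L2L2 T ℝ) (b : J → L2L2 T Plane),
    ∀ u g, GradRel u g ↔ ∀ j, (inner ℝ (a j) u : ℝ) = inner ℝ (b j) g := by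
  obtain ⟨a, b, h⟩ := exists_gradient_tests
  refine ⟨(((Fin 2 → ℤ) × Bool) × Fin 2) × {s : Set ℝ≥0 // MeasurableSet s},
    fun j => indicatorConstLp 2 j.2.2 (measure_ne_top _ _) (a j.1),
    fun j => indicatorConstLp 2 j.2.2 (measure_ne_top _ _) (b j.1), fun u g => ?_⟩
  simp only [GradRel, h]
  rw [ae_forall_inner_eq_iff]
  exact ⟨fun H j => H j.1 j.2.1 j.2.2, fun H j s hs => H (j, ⟨s, hs⟩)⟩

theorem exists_divRel_tests : ∃ (J : Type) (a : J → L2L2 T Plane) (b : J → L2L2 T ℝ),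
    ∀ f v, DivRel f v ↔ ∀ j, (inner ℝ (a j) f : ℝ) = inner ℝ (b j) v := by
  obtain ⟨a, b, h⟩ := exists_divergence_tests
  refine ⟨((Fin 2 → ℤ) × Bool) × {s : Set ℝ≥0 // MeasurableSet s},
    fun j => indicatorConstLp 2 j.2.2 (measure_ne_top _ _) (a j.1),
    fun j => indicatorConstLp 2 j.2.2 (measure_ne_top _ _) (b j.1), fun f v => ?_⟩
  simp only [DivRel, h]
  rw [ae_forall_inner_eq_iff]
  exact ⟨fun H j => H j.1 j.2.1 j.2.2, fun H j s hs => H (j, ⟨s, hs⟩)⟩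

/-- Closedness of the gradient relation for strong convergence of the functions and weak convergence
of the gradients. -/
theorem gradRel_of_tendsto {ι : Type*} {l : Filter ι} [l.NeBot] {u : ι → L2L2 T ℝ}
    {g : ι → L2L2 T Plane} {u₀ : L2L2 T ℝ} {g₀ : L2L2 T Plane} (hu : Tendsto u l (𝓝 u₀))
    (hg : ∀ φ, Tendsto (fun n => (inner ℝ φ (g n) : ℝ)) l (𝓝 (inner ℝ φ g₀)))
    (h : ∀ᶠ n in l, GradRel (u n) (g n)) : GradRel u₀ g₀ := by
  obtain ⟨J, a, b, hJ⟩ := exists_gradRel_tests (T := T)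
  rw [hJ]
  intro j
  refine tendsto_nhds_unique_of_eventuallyEq (tendsto_const_nhds.inner hu) (hg (b j)) ?_
  filter_upwards [h] with n hn
  exact (hJ _ _).1 hn j

theorem isClosed_gradRel : IsClosed {p : L2L2 T ℝ × L2L2 T Plane | GradRel p.1 p.2} := by
  obtain ⟨J, a, b, hJ⟩ := exists_gradRel_tests (T := T)
  simp only [hJ, Set.ofPred_forall]
  exact isClosed_iInter fun j => isClosed_eq (continuous_const.inner continuous_fst)
    (continuous_const.inner continuous_snd)

theorem GradRel.sub {u u' : L2L2 T ℝ} {g g' : L2L2 T Plane} (h : GradRel u g)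
    (h' : GradRel u' g') : GradRel (u - u') (g - g') := by
  obtain ⟨J, a, b, hJ⟩ := exists_gradRel_tests (T := T)
  rw [hJ] at h h' ⊢
  intro j
  rw [inner_sub_right, inner_sub_right, h j, h' j]

theorem GradRel.smul {u : L2L2 T ℝ} {g : L2L2 T Plane} (h : GradRel u g) (c : ℝ) :
    GradRel (c • u) (c • g) := by
  obtain ⟨J, a, b, hJ⟩ := exists_gradRel_tests (T := T)
  rw [hJ] at h ⊢
  intro j
  rw [real_inner_smul_right, real_inner_smul_right, h j]

theorem isWeakGradient_unique {f : L2 ℝ} {g g' : L2 Plane} (h : IsWeakGradient f g)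
    (h' : IsWeakGradient f g') : g = g' := by
  have e : ∀ i, (fun x => g x i) =ᵐ[volume] fun x => g' x i := fun i =>
    ae_eq_of_coef_eq (memLp_coord (memLp_L2 g) i) (memLp_coord (memLp_L2 g') i) fun k => by
      rw [(isWeakGradient_iff (memLp_L2 f) (memLp_L2 g)).1 h i k,
        (isWeakGradient_iff (memLp_L2 f) (memLp_L2 g')).1 h' i k]
  refine Lp.ext ?_
  filter_upwards [e 0, e 1] with x h0 h1
  ext i
  fin_cases i
  · exact h0
  · exact h1

theorem GradRel.unique {u : L2L2 T ℝ} {g g' : L2L2 T Plane} (h : GradRel u g)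
    (h' : GradRel u g') : g = g' := by
  refine Lp.ext ?_
  filter_upwards [h, h'] with t h1 h2
  exact isWeakGradient_unique h1 h2

/-- Integration by parts for paths. -/
theorem inner_eq_neg_of_gradRel {u v : L2L2 T ℝ} {f g : L2L2 T Plane} (h : GradRel u g)
    (h' : DivRel f v) : (inner ℝ g f : ℝ) = -inner ℝ u v := by
  rw [L2.inner_def, L2.inner_def, ← integral_neg]
  refine integral_congr_ae ?_
  filter_upwards [h, h'] with t h1 h2
  rw [L2.inner_def, L2.inner_def,
    integral_inner_weakGradient (memLp_L2 _) (memLp_L2 _) (memLp_L2 _) (memLp_L2 _) h1 h2]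
  rfl

/-- Bounded sets in a Hilbert space are weakly relatively compact. -/
theorem exists_weak_limit {E : Type*} [NormedAddCommGroup E] [InnerProductSpace ℝ E]
    [CompleteSpace E] {ι : Type*} (l : Ultrafilter ι) {g : ι → E} {R : ℝ}
    (hg : ∀ᶠ n in l, ‖g n‖ ≤ R) :
    ∃ g₀ : E, ‖g₀‖ ≤ R ∧ ∀ φ, Tendsto (fun n => (inner ℝ φ (g n) : ℝ)) l (𝓝 (inner ℝ φ g₀)) := by
  set d : ι → WeakDual ℝ E := fun n =>
    StrongDual.toWeakDual (InnerProductSpace.toDual ℝ E (g n)) with hd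
  obtain ⟨x, hx, hl⟩ := (WeakDual.isCompact_closedBall (𝕜 := ℝ) (E := E) 0 R).ultrafilter_le_nhds
    (l.map d) (by
      rw [le_principal_iff]
      refine mem_map.2 ?_
      filter_upwards [hg] with n hn
      change WeakDual.toStrongDual (d n) ∈ Metric.closedBall 0 R
      rw [mem_closedBall_zero_iff]
      exact ((InnerProductSpace.toDual ℝ E).norm_map (g n)).trans_le hn)
  have hx' : ‖WeakDual.toStrongDual x‖ ≤ R := by simpa using hx
  refine ⟨(InnerProductSpace.toDual ℝ E).symm (WeakDual.toStrongDual x), ?_, fun φ => ?_⟩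
  · rwa [LinearIsometryEquiv.norm_map]
  · have h1 : Tendsto (fun n => d n φ) l (𝓝 (x φ)) :=
      ((WeakBilin.eval_continuous _ φ).tendsto x).comp (show Tendsto d l (𝓝 x) from hl)
    rw [real_inner_comm, InnerProductSpace.toDual_symm_apply]
    refine h1.congr fun n => ?_
    rw [real_inner_comm]
    rfl

/-- Compactness: a bounded family of gradients of a convergent family of paths converges weakly,
along an ultrafilter, to the gradient of the limit. -/
theorem exists_gradRel_of_bounded {ι : Type*} (l : Ultrafilter ι) {u : ι → L2L2 T ℝ}
    {g : ι → L2L2 T Plane} {u₀ : L2L2 T ℝ} {R : ℝ} (hu : Tendsto u l (𝓝 u₀))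
    (h : ∀ᶠ n in l, GradRel (u n) (g n)) (hg : ∀ᶠ n in l, ‖g n‖ ≤ R) :
    ∃ g₀, GradRel u₀ g₀ ∧ ‖g₀‖ ≤ R ∧
      ∀ φ, Tendsto (fun n => (inner ℝ φ (g n) : ℝ)) l (𝓝 (inner ℝ φ g₀)) := by
  obtain ⟨g₀, h1, h2⟩ := exists_weak_limit l hg
  exact ⟨g₀, gradRel_of_tendsto hu h2 h, h1, h2⟩

end Paths

end GraphMCF

namespace GraphMCF

/-! ### The normal field: Lipschitz continuity and strict monotonicity -/

theorem normalFn_eq (p : Plane) : normalFn p = (areaFn p)⁻¹ • p := rfl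

theorem normalFn_zero : normalFn 0 = 0 := by rw [normalFn_eq, smul_zero]

theorem lipschitzWith_normalFn : LipschitzWith 2 normalFn := by
  refine LipschitzWith.of_dist_le_mul fun p q => ?_
  rw [dist_eq_norm, dist_eq_norm, NNReal.coe_ofNat]
  have hp := (areaFn_pos p).ne'
  have hq := (areaFn_pos q).ne'
  have e : normalFn p - normalFn q =
      (areaFn p)⁻¹ • (p - q) - ((areaFn p)⁻¹ * (areaFn p - areaFn q)) • normalFn q := by
    rw [normalFn_eq, normalFn_eq, smul_smul, smul_sub, sub_sub, ← add_smul]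
    congr 2
    field_simp
    ring
  have h1 : (areaFn p)⁻¹ ≤ 1 := inv_le_one_of_one_le₀ (one_le_areaFn p)
  have h0 : 0 ≤ (areaFn p)⁻¹ := inv_nonneg.2 (areaFn_pos p).le
  rw [e]
  refine (norm_sub_le _ _).trans ?_
  rw [norm_smul, norm_smul, norm_mul, Real.norm_of_nonneg h0, Real.norm_eq_abs]
  have h2 : (areaFn p)⁻¹ * |areaFn p - areaFn q| * ‖normalFn q‖ ≤ 1 * ‖p - q‖ * 1 := by
    gcongr
    · exact abs_areaFn_sub_le p q
    · exact norm_normalFn_le q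
  have h3 : (areaFn p)⁻¹ * ‖p - q‖ ≤ 1 * ‖p - q‖ := by gcongr
  linarith

/-- The monotonicity form of the normal field. -/
noncomputable def monoForm (p q : Plane) : ℝ := inner ℝ (p - q) (normalFn p - normalFn q)

/-- Quantitative monotonicity of `p ↦ p / √(1 + |p|²)`. -/
theorem norm_sub_sq_le_monoForm (p q : Plane) :
    ‖p - q‖ ^ 2 ≤ monoForm p q * (areaFn p * areaFn q) ^ 2 := by
  have hA := one_le_areaFn p
  have hB := one_le_areaFn q
  have hA2 : areaFn p ^ 2 = 1 + ‖p‖ ^ 2 := areaFn_sq p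
  have hB2 : areaFn q ^ 2 = 1 + ‖q‖ ^ 2 := areaFn_sq q
  have hs := abs_real_inner_le_norm p q
  have hd : ‖p - q‖ ^ 2 = ‖p‖ ^ 2 - 2 * inner ℝ p q + ‖q‖ ^ 2 := norm_sub_sq_real p q
  have hm : monoForm p q = (areaFn p)⁻¹ * ‖p‖ ^ 2 + (areaFn q)⁻¹ * ‖q‖ ^ 2 -
      ((areaFn p)⁻¹ + (areaFn q)⁻¹) * inner ℝ p q := by
    rw [monoForm, normalFn_eq, normalFn_eq, inner_sub_left, inner_sub_right, inner_sub_right,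
      real_inner_smul_right, real_inner_smul_right, real_inner_smul_right, real_inner_smul_right,
      real_inner_self_eq_norm_sq, real_inner_self_eq_norm_sq, real_inner_comm p q]
    ring
  set A := areaFn p
  set B := areaFn q
  set s : ℝ := inner ℝ p q
  have hA0 : 0 < A := by linarith
  have hB0 : 0 < B := by linarith
  have hs2 : s ^ 2 ≤ ‖p‖ ^ 2 * ‖q‖ ^ 2 := by
    rw [← mul_pow, ← sq_abs]
    gcongr
  -- the product of `D = AB - (1 + p·q)` with its conjugate dominates `|p - q|²`
  have hprod : ‖p - q‖ ^ 2 ≤ (A * B - (1 + s)) * (A * B + (1 + s)) := by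
    have : (A * B) ^ 2 = (1 + ‖p‖ ^ 2) * (1 + ‖q‖ ^ 2) := by rw [mul_pow, hA2, hB2]
    nlinarith
  have hAB : 0 < A * B := mul_pos hA0 hB0
  have hD : 0 ≤ A * B - (1 + s) := by
    have h0 : (1 + s) ^ 2 ≤ (A * B) ^ 2 := by nlinarith [sq_nonneg ‖p - q‖]
    linarith [(le_abs_self _).trans (abs_le_of_sq_le_sq h0 hAB.le)]
  have hprod2 : ‖p - q‖ ^ 2 ≤ (A * B - (1 + s)) * (2 * (A * B)) :=
    hprod.trans (mul_le_mul_of_nonneg_left (by linarith) hD)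
  have hm2 : monoForm p q * (A * B) ^ 2 = (A + B) * ((A * B - (1 + s)) * (A * B)) := by
    have h1 : ‖p‖ ^ 2 = A ^ 2 - 1 := by linarith
    have h2 : ‖q‖ ^ 2 = B ^ 2 - 1 := by linarith
    rw [hm, h1, h2]
    field_simp
    ring
  rw [hm2]
  nlinarith [mul_nonneg hD hAB.le]

theorem monoForm_nonneg (p q : Plane) : 0 ≤ monoForm p q := by
  have h := (sq_nonneg ‖p - q‖).trans (norm_sub_sq_le_monoForm p q)
  exact nonneg_of_mul_nonneg_left h (pow_pos (mul_pos (areaFn_pos p) (areaFn_pos q)) 2)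

theorem continuous_monoForm : Continuous fun x : Plane × Plane => monoForm x.1 x.2 := by
  have := continuous_normalFn
  unfold monoForm
  fun_prop

/-- The Nemytskii operator of the normal field on `L²(𝕋²; ℝ²)`. -/
noncomputable def normalL2 : L2 Plane → L2 Plane := lipschitzWith_normalFn.compLp normalFn_zero

theorem normalL2_coeFn (f : L2 Plane) : normalL2 f =ᵐ[volume] fun x => normalFn (f x) :=
  lipschitzWith_normalFn.coeFn_compLp normalFn_zero f

theorem toL2_normal (z : H2) : toL2 z.normal = normalL2 z.grad := by
  refine Lp.ext ((toL2_coeFn (memLp_z_normal z)).trans ?_)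
  exact (normalL2_coeFn z.grad).symm

theorem lipschitzWith_normalL2 : LipschitzWith 2 normalL2 :=
  lipschitzWith_normalFn.lipschitzWith_compLp normalFn_zero

theorem normalL2_zero : normalL2 0 = 0 := by
  have h := lipschitzWith_normalFn.norm_compLp_le normalFn_zero (0 : L2 Plane)
  rw [norm_zero, mul_zero] at h
  exact norm_le_zero_iff.1 h

theorem norm_normalL2_le (f : L2 Plane) : ‖normalL2 f‖ ≤ 1 := by
  have h : ‖normalL2 f‖ ≤ _ := Lp.norm_le_of_ae_bound zero_le_one (by
    filter_upwards [normalL2_coeFn f] with x hx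
    rw [hx]
    exact norm_normalFn_le _)
  simpa [measureUnivNNReal] using h

theorem inner_normalL2_sub_nonneg (f f' : L2 Plane) :
    0 ≤ (inner ℝ (f - f') (normalL2 f - normalL2 f') : ℝ) := by
  rw [L2.inner_def]
  refine integral_nonneg_of_ae ?_
  filter_upwards [Lp.coeFn_sub f f', Lp.coeFn_sub (normalL2 f) (normalL2 f'),
    normalL2_coeFn f, normalL2_coeFn f'] with x e1 e2 e3 e4
  rw [e1, e2, Pi.sub_apply, Pi.sub_apply, e3, e4]
  exact monoForm_nonneg _ _

section Paths

variable {T : ℝ≥0}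

/-- The Nemytskii operator of the normal field on paths. -/
noncomputable def normalPath : L2L2 T Plane → L2L2 T Plane :=
  lipschitzWith_normalL2.compLp normalL2_zero

theorem normalPath_coeFn (g : L2L2 T Plane) :
    normalPath g =ᵐ[timeMeasure T] fun t => normalL2 (g t) :=
  lipschitzWith_normalL2.coeFn_compLp normalL2_zero g

theorem continuous_normalPath : Continuous (normalPath (T := T)) :=
  lipschitzWith_normalL2.continuous_compLp normalL2_zero

theorem exists_norm_normalPath_le (T : ℝ≥0) : ∃ C : ℝ, ∀ g : L2L2 T Plane, ‖normalPath g‖ ≤ C :=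
  ⟨_, fun g => Lp.norm_le_of_ae_bound zero_le_one (by
    filter_upwards [normalPath_coeFn g] with t ht
    rw [ht]
    exact norm_normalL2_le _)⟩

theorem ofReal_inner_normalPath_sub (g g' : L2L2 T Plane) :
    ENNReal.ofReal (inner ℝ (g - g') (normalPath g - normalPath g')) =
      ∫⁻ t, ∫⁻ x, ENNReal.ofReal (monoForm (g t x) (g' t x)) ∂volume ∂timeMeasure T := by
  have e1 : ∀ᵐ t ∂timeMeasure T, ENNReal.ofReal
      (inner ℝ ((g - g') t) ((normalPath g - normalPath g') t)) =
        ∫⁻ x, ENNReal.ofReal (monoForm (g t x) (g' t x)) := by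
    filter_upwards [Lp.coeFn_sub g g', Lp.coeFn_sub (normalPath g) (normalPath g'),
      normalPath_coeFn g, normalPath_coeFn g'] with t h1 h2 h3 h4
    rw [h1, h2, Pi.sub_apply, Pi.sub_apply, h3, h4, L2.inner_def]
    have e2 : (fun x => (inner ℝ ((g t - g' t) x) ((normalL2 (g t) - normalL2 (g' t)) x) : ℝ))
        =ᵐ[volume] fun x => monoForm (g t x) (g' t x) := by
      filter_upwards [Lp.coeFn_sub (g t) (g' t), Lp.coeFn_sub (normalL2 (g t)) (normalL2 (g' t)),
        normalL2_coeFn (g t), normalL2_coeFn (g' t)] with x e1 e2 e3 e4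
      rw [e1, e2, Pi.sub_apply, Pi.sub_apply, e3, e4, monoForm]
    rw [integral_congr_ae e2, ofReal_integral_eq_lintegral_ofReal
      ((integrable_congr e2).1 (L2.integrable_inner _ _)) (ae_of_all _ fun x => monoForm_nonneg _ _)]
  rw [← lintegral_congr_ae e1, L2.inner_def, ofReal_integral_eq_lintegral_ofReal
    (L2.integrable_inner _ _)]
  filter_upwards [Lp.coeFn_sub g g', Lp.coeFn_sub (normalPath g) (normalPath g'),
    normalPath_coeFn g, normalPath_coeFn g'] with t h1 h2 h3 h4
  rw [h1, h2, Pi.sub_apply, Pi.sub_apply, h3, h4]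
  exact inner_normalL2_sub_nonneg _ _

/-- Gradients of paths tending to zero, normalised to be bounded, tend to zero weakly. -/
theorem tendsto_inner_of_gradRel {u : ℕ → L2L2 T ℝ} {g : ℕ → L2L2 T Plane} {R : ℝ}
    (hu : Tendsto u atTop (𝓝 0)) (h : ∀ n, GradRel (u n) (g n)) (hg : ∀ n, ‖g n‖ ≤ R)
    (φ : L2L2 T Plane) : Tendsto (fun n => (inner ℝ φ (g n) : ℝ)) atTop (𝓝 0) := by
  rw [tendsto_iff_ultrafilter]
  intro l hl
  obtain ⟨g₀, h1, -, h2⟩ := exists_gradRel_of_bounded l (hu.mono_left hl) (Eventually.of_forall h)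
    (Eventually.of_forall hg)
  have h3 : GradRel (0 : L2L2 T ℝ) (0 : L2L2 T Plane) := by
    simpa using (h 0).smul 0
  rw [h1.unique h3] at h2
  simpa using h2 φ

/-- The pathwise form of the monotonicity argument. Normalisation by `1 + ‖g n‖` makes up for
the lack of a pathwise bound on the gradients. -/
theorem tendsto_inner_normalPath_sub {u v : ℕ → L2L2 T ℝ} {g : ℕ → L2L2 T Plane}
    {u₀ : L2L2 T ℝ} {g₀ : L2L2 T Plane} {R : ℝ} (hu : Tendsto u atTop (𝓝 u₀))
    (hv : ∀ n, ‖v n‖ ≤ R) (hg : ∀ n, GradRel (u n) (g n)) (hg₀ : GradRel u₀ g₀)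
    (hd : ∀ n, DivRel (normalPath (g n)) (v n)) :
    Tendsto (fun n => (1 + ‖g n‖)⁻¹ *
      (inner ℝ (g n - g₀) (normalPath (g n) - normalPath g₀) : ℝ)) atTop (𝓝 0) := by
  have hpos : ∀ n, 0 < 1 + ‖g n‖ := fun n => by positivity
  have hinv : ∀ n, (1 + ‖g n‖)⁻¹ ≤ 1 := fun n =>
    inv_le_one_of_one_le₀ (by linarith [norm_nonneg (g n)])
  have hu0 : Tendsto (fun n => ‖u n - u₀‖) atTop (𝓝 0) := tendsto_iff_norm_sub_tendsto_zero.1 hu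
  -- the part with the divergence bound
  have h1 : Tendsto (fun n => (1 + ‖g n‖)⁻¹ * (inner ℝ (g n - g₀) (normalPath (g n)) : ℝ))
      atTop (𝓝 0) := by
    have hR : Tendsto (fun n => ‖u n - u₀‖ * R) atTop (𝓝 0) := by simpa using hu0.mul_const R
    refine squeeze_zero_norm (fun n => ?_) hR
    rw [inner_eq_neg_of_gradRel ((hg n).sub hg₀) (hd n), norm_mul, norm_neg,
      Real.norm_of_nonneg (inv_nonneg.2 (hpos n).le)]
    calc (1 + ‖g n‖)⁻¹ * ‖(inner ℝ (u n - u₀) (v n) : ℝ)‖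
        ≤ 1 * (‖u n - u₀‖ * R) := by
          gcongr
          · exact hinv n
          · exact (norm_inner_le_norm _ _).trans (by gcongr; exact hv n)
      _ = _ := one_mul _
  -- the part with the fixed field `normalPath g₀`
  have h2 : Tendsto (fun n => (inner ℝ (normalPath g₀) ((1 + ‖g n‖)⁻¹ • (g n - g₀)) : ℝ))
      atTop (𝓝 0) := by
    refine tendsto_inner_of_gradRel (u := fun n => (1 + ‖g n‖)⁻¹ • (u n - u₀)) (R := 1 + ‖g₀‖)
      ?_ (fun n => ((hg n).sub hg₀).smul _) (fun n => ?_) _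
    · refine squeeze_zero_norm (fun n => ?_) hu0
      rw [norm_smul, Real.norm_of_nonneg (inv_nonneg.2 (hpos n).le)]
      exact mul_le_of_le_one_left (norm_nonneg _) (hinv n)
    · rw [norm_smul, Real.norm_of_nonneg (inv_nonneg.2 (hpos n).le), inv_mul_le_iff₀ (hpos n)]
      have := norm_sub_le (g n) g₀
      nlinarith [norm_nonneg (g n), norm_nonneg g₀]
  have h3 := h1.sub h2
  rw [sub_zero] at h3
  refine h3.congr fun n => ?_
  rw [real_inner_smul_right, real_inner_comm (g n - g₀) (normalPath g₀), inner_sub_right]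
  ring

end Paths

end GraphMCF

namespace GraphMCF

/-! ### Measurability of the gradient and of the relations between the path components -/

instance : Fact ((2 : ℝ≥0∞) ≠ ∞) := ⟨by simp⟩

instance (E : Type) [NormedAddCommGroup E] [TopologicalSpace.SeparableSpace E] :
    SecondCountableTopology (L2 E) := inferInstance

instance (T : ℝ≥0) (E : Type) [NormedAddCommGroup E] [TopologicalSpace.SeparableSpace E] :
    SecondCountableTopology (L2L2 T E) := inferInstance

section GradOp

variable {T : ℝ≥0}

open Classical in
/-- The weak gradient of a path, with the value `0` if there is none. -/
noncomputable def gradOp (u : L2L2 T ℝ) : L2L2 T Plane :=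
  if h : ∃ g, GradRel u g then h.choose else 0

theorem gradRel_gradOp {u : L2L2 T ℝ} (h : ∃ g, GradRel u g) : GradRel u (gradOp u) := by
  rw [gradOp, dif_pos h]
  exact h.choose_spec

theorem GradRel.gradOp_eq {u : L2L2 T ℝ} {g : L2L2 T Plane} (h : GradRel u g) : gradOp u = g :=
  (gradRel_gradOp ⟨g, h⟩).unique h

/-- Images of measurable sets of gradients are measurable, by the Lusin–Souslin theorem, since the
gradient relation is a closed subset of a Polish space that is the graph of a function. -/
theorem measurableSet_exists_gradRel [MeasurableSpace (L2L2 T ℝ)] [BorelSpace (L2L2 T ℝ)]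
    [MeasurableSpace (L2L2 T Plane)] [BorelSpace (L2L2 T Plane)] {s : Set (L2L2 T Plane)}
    (hs : MeasurableSet s) : MeasurableSet {u : L2L2 T ℝ | ∃ g, GradRel u g ∧ g ∈ s} := by
  have hΓ : MeasurableSet ({p : L2L2 T ℝ × L2L2 T Plane | GradRel p.1 p.2} ∩ Prod.snd ⁻¹' s) :=
    isClosed_gradRel.measurableSet.inter (measurable_snd hs)
  have := hΓ.image_of_continuousOn_injOn (f := Prod.fst) continuous_fst.continuousOn (by
    rintro ⟨u, g⟩ ⟨h1, -⟩ ⟨u', g'⟩ ⟨h2, -⟩ (rfl : u = u')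
    exact Prod.ext rfl (GradRel.unique h1 h2))
  convert this
  ext u
  constructor
  · rintro ⟨g, h1, h2⟩
    exact ⟨(u, g), ⟨h1, h2⟩, rfl⟩
  · rintro ⟨⟨u', g⟩, ⟨h1, h2⟩, rfl⟩
    exact ⟨g, h1, h2⟩

theorem measurable_gradOp [MeasurableSpace (L2L2 T ℝ)] [BorelSpace (L2L2 T ℝ)]
    [MeasurableSpace (L2L2 T Plane)] [BorelSpace (L2L2 T Plane)] :
    Measurable (gradOp (T := T)) := by
  intro s hs
  have hdom := measurableSet_exists_gradRel (T := T) MeasurableSet.univ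
  have e : gradOp ⁻¹' s = {u : L2L2 T ℝ | ∃ g, GradRel u g ∧ g ∈ s} ∪
      ({u : L2L2 T ℝ | ∃ g, GradRel u g ∧ g ∈ Set.univ}ᶜ ∩ {_u | (0 : L2L2 T Plane) ∈ s}) := by
    ext u
    by_cases h : ∃ g, GradRel u g
    · constructor
      · exact fun hu => Or.inl ⟨_, gradRel_gradOp h, hu⟩
      · rintro (⟨g, h1, h2⟩ | ⟨h1, -⟩)
        · rwa [Set.mem_preimage, h1.gradOp_eq]
        · obtain ⟨g, hg⟩ := h
          exact absurd ⟨g, hg, trivial⟩ h1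
    · rw [Set.mem_preimage, gradOp, dif_neg h]
      constructor
      · exact fun hu => Or.inr ⟨fun ⟨g, hg, _⟩ => h ⟨g, hg⟩, hu⟩
      · rintro (⟨g, h1, -⟩ | ⟨-, h2⟩)
        · exact absurd ⟨g, h1⟩ h
        · exact h2
  rw [e]
  exact (measurableSet_exists_gradRel hs).union (hdom.compl.inter (MeasurableSet.const _))

theorem stronglyMeasurable_gradOp {α : Type*} {mα : MeasurableSpace α} {f : α → L2L2 T ℝ}
    (hf : StronglyMeasurable f) : StronglyMeasurable fun a => gradOp (f a) := by
  borelize (L2L2 T ℝ) (L2L2 T Plane)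
  exact (measurable_gradOp.comp hf.measurable).stronglyMeasurable

theorem measurableSet_exists_gradRel_comp {α : Type*} {mα : MeasurableSpace α} {f : α → L2L2 T ℝ}
    (hf : StronglyMeasurable f) : MeasurableSet {a | ∃ g, GradRel (f a) g} := by
  borelize (L2L2 T ℝ) (L2L2 T Plane)
  have h := hf.measurable (measurableSet_exists_gradRel (T := T) MeasurableSet.univ)
  simpa using h

end GradOp

section PathSpaceLemmas

variable {T : ℝ≥0}

theorem continuous_inner_weak {E : Type*} [NormedAddCommGroup E] [InnerProductSpace ℝ E] (φ : E) :
    Continuous fun x : WeakSpace ℝ E => (inner ℝ φ ((toWeakSpace ℝ E).symm x) : ℝ) :=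
  WeakBilin.eval_continuous (topDualPairing ℝ E).flip (innerSL ℝ φ)

theorem continuous_u : Continuous (PathSpace.u (T := T)) := continuous_fst

theorem continuous_inner_v (φ : L2L2 T ℝ) :
    Continuous fun X : PathSpace T => (inner ℝ φ X.v : ℝ) :=
  (continuous_inner_weak φ).comp (continuous_fst.comp continuous_snd)

theorem continuous_inner_ν (φ : L2L2 T Plane) :
    Continuous fun X : PathSpace T => (inner ℝ φ X.ν : ℝ) :=
  (continuous_inner_weak φ).comp (continuous_fst.comp (continuous_snd.comp continuous_snd))

theorem stronglyMeasurable_u : StronglyMeasurable (PathSpace.u (T := T)) :=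
  continuous_u.stronglyMeasurable

/-- The relations `ν = ∇u / H(∇u)` and `v = div ν` between the components of a path vector. -/
def IsConsistent (X : PathSpace T) : Prop :=
  (∃ g, GradRel X.u g) ∧ X.ν = normalPath (gradOp X.u) ∧ DivRel X.ν X.v

theorem measurableSet_isConsistent : MeasurableSet {X : PathSpace T | IsConsistent X} := by
  have h1 : MeasurableSet {X : PathSpace T | ∃ g, GradRel X.u g} :=
    measurableSet_exists_gradRel_comp stronglyMeasurable_u
  have h2 : MeasurableSet {X : PathSpace T | X.ν = normalPath (gradOp X.u)} := by
    have e : {X : PathSpace T | X.ν = normalPath (gradOp X.u)} =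
        ⋂ n : ℕ, {X : PathSpace T | (inner ℝ (TopologicalSpace.denseSeq (L2L2 T Plane) n) X.ν : ℝ) =
          inner ℝ (TopologicalSpace.denseSeq (L2L2 T Plane) n) (normalPath (gradOp X.u))} := by
      ext X
      rw [Set.mem_iInter]
      refine ⟨fun h n => congrArg _ h, fun h => ?_⟩
      refine ext_inner_left ℝ fun φ => ?_
      refine congrFun (Continuous.ext_on (TopologicalSpace.denseRange_denseSeq (L2L2 T Plane))
        (continuous_id.inner continuous_const) (continuous_id.inner continuous_const) ?_) φ
      rintro _ ⟨n, rfl⟩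
      exact h n
    rw [e]
    refine MeasurableSet.iInter fun n => measurableSet_eq_fun (continuous_inner_ν _).measurable ?_
    exact ((continuous_const.inner continuous_normalPath).comp_stronglyMeasurable
      (stronglyMeasurable_gradOp stronglyMeasurable_u)).measurable
  have h3 : MeasurableSet {X : PathSpace T | DivRel X.ν X.v} := by
    obtain ⟨J, a, b, hJ⟩ := exists_divRel_tests (T := T)
    simp only [hJ, Set.ofPred_forall]
    exact (isClosed_iInter fun j =>
      isClosed_eq (continuous_inner_ν _) (continuous_inner_v _)).measurableSet
  exact h1.inter (h2.inter h3)

/-- Weakly convergent sequences are bounded. -/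
theorem exists_norm_le_of_tendsto_inner {E : Type*} [NormedAddCommGroup E] [InnerProductSpace ℝ E]
    [CompleteSpace E] {v : ℕ → E} {v₀ : E}
    (h : ∀ φ, Tendsto (fun n => (inner ℝ φ (v n) : ℝ)) atTop (𝓝 (inner ℝ φ v₀))) :
    ∃ R, ∀ n, ‖v n‖ ≤ R := by
  obtain ⟨C, hC⟩ := banach_steinhaus (g := fun n => innerSL ℝ (v n)) fun φ => by
    obtain ⟨C, hC⟩ := (Metric.isBounded_range_of_tendsto _ (h φ)).exists_norm_le
    exact ⟨C, fun n => by
      rw [innerSL_apply_apply, real_inner_comm]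
      exact hC _ ⟨n, rfl⟩⟩
  exact ⟨C, fun n => by simpa using hC n⟩

/-- Strong compactness of the gradients of consistent path vectors, in the form given by
monotonicity. -/
theorem tendsto_of_isConsistent {Y : ℕ → PathSpace T} {Y₀ : PathSpace T}
    (hY : Tendsto Y atTop (𝓝 Y₀)) (hc : ∀ n, IsConsistent (Y n)) (h₀ : ∃ g, GradRel Y₀.u g) :
    Tendsto (fun n => (1 + ‖gradOp (Y n).u‖)⁻¹ *
      (inner ℝ (gradOp (Y n).u - gradOp Y₀.u)
        (normalPath (gradOp (Y n).u) - normalPath (gradOp Y₀.u)) : ℝ)) atTop (𝓝 0) := by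
  obtain ⟨R, hR⟩ := exists_norm_le_of_tendsto_inner fun φ =>
    ((continuous_inner_v φ).tendsto Y₀).comp hY
  refine tendsto_inner_normalPath_sub ((continuous_u.tendsto Y₀).comp hY) hR
    (fun n => gradRel_gradOp (hc n).1) (gradRel_gradOp h₀) fun n => ?_
  rw [← (hc n).2.1]
  exact (hc n).2.2

/-- The Dirichlet energy is lower semicontinuous. -/
theorem enorm_gradOp_le_liminf {u : ℕ → L2L2 T ℝ} {u₀ : L2L2 T ℝ} (hu : Tendsto u atTop (𝓝 u₀))
    (h : ∀ n, ∃ g, GradRel (u n) g)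
    (hfin : liminf (fun n => ‖gradOp (u n)‖ₑ ^ 2) atTop ≠ ∞) :
    (∃ g, GradRel u₀ g) ∧ ‖gradOp u₀‖ₑ ^ 2 ≤ liminf (fun n => ‖gradOp (u n)‖ₑ ^ 2) atTop := by
  have key : ∀ c : ℝ≥0, liminf (fun n => ‖gradOp (u n)‖ₑ ^ 2) atTop < c →
      (∃ g, GradRel u₀ g) ∧ ‖gradOp u₀‖ₑ ^ 2 ≤ c := by
    intro c hc
    have hfr := frequently_lt_of_liminf_lt (h := hc)
    have : (atTop ⊓ 𝓟 {n | ‖gradOp (u n)‖ₑ ^ 2 < c}).NeBot := by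
      rwa [← frequently_mem_iff_neBot]
    set l := Ultrafilter.of (atTop ⊓ 𝓟 {n | ‖gradOp (u n)‖ₑ ^ 2 < c})
    have hl : (l : Filter ℕ) ≤ atTop ⊓ 𝓟 {n | ‖gradOp (u n)‖ₑ ^ 2 < c} := Ultrafilter.of_le _
    obtain ⟨g, h1, h2, -⟩ := exists_gradRel_of_bounded (R := √c) l
      (hu.mono_left (hl.trans inf_le_left)) (Eventually.of_forall fun n => gradRel_gradOp (h n)) (by
        filter_upwards [(hl.trans inf_le_right) (mem_principal_self _)] with n hn
        refine Real.le_sqrt_of_sq_le ?_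
        have hn' : ‖gradOp (u n)‖ₑ ^ 2 < c := hn
        rw [← ofReal_norm, ← ENNReal.ofReal_pow (norm_nonneg _)] at hn'
        exact (ENNReal.ofReal_lt_coe_iff (by positivity)).1 hn' |>.le)
    refine ⟨⟨g, h1⟩, ?_⟩
    rw [h1.gradOp_eq, ← ofReal_norm, ← ENNReal.ofReal_pow (norm_nonneg _)]
    have h3 : ‖g‖ ^ 2 ≤ (c : ℝ) := by
      rw [← Real.sq_sqrt (NNReal.coe_nonneg c)]
      gcongr
    exact (ENNReal.ofReal_le_ofReal h3).trans (ENNReal.ofReal_coe_nnreal).le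
  obtain ⟨c, hc, -⟩ := ENNReal.lt_iff_exists_nnreal_btwn.1 (lt_top_iff_ne_top.2 hfin)
  refine ⟨(key c hc).1, le_of_forall_gt fun r hr => ?_⟩
  obtain ⟨c, hc, hcr⟩ := ENNReal.lt_iff_exists_nnreal_btwn.1 hr
  exact (key c hc).2.trans_lt hcr

end PathSpaceLemmas

end GraphMCF

namespace GraphMCF

/-! ### Jointly measurable representatives -/

/-- A measurable family of elements of `L²` has a jointly measurable representative. -/
theorem exists_representative {Ω α E : Type*} [MeasurableSpace Ω] [MeasurableSpace α]
    {μ : Measure α} [NormedAddCommGroup E] [CompleteSpace E] [SecondCountableTopology E]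
    [SecondCountableTopology (Lp E 2 μ)] {f : Ω → Lp E 2 μ} (hf : StronglyMeasurable f) :
    ∃ G : Ω × α → E, StronglyMeasurable G ∧ ∀ ω, (fun x => G (ω, x)) =ᵐ[μ] f ω := by
  set d := TopologicalSpace.denseSeq (Lp E 2 μ)
  have hex : ∀ (j : ℕ) (ω : Ω), ∃ n, ‖d n - f ω‖ < (1 / 2) ^ j := by
    intro j ω
    obtain ⟨n, hn⟩ := (TopologicalSpace.denseRange_denseSeq (Lp E 2 μ)).exists_dist_lt (f ω)
      (ε := (1 / 2) ^ j) (by positivity)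
    exact ⟨n, by rwa [dist_comm, dist_eq_norm] at hn⟩
  classical
  set N : ℕ → Ω → ℕ := fun j ω => Nat.find (hex j ω)
  have hN : ∀ j, Measurable (N j) := fun j => measurable_find (hex j) fun n =>
    (((stronglyMeasurable_const.sub hf).norm.measurable) measurableSet_Iio :)
  have hNs : ∀ j ω, ‖d (N j ω) - f ω‖ < (1 / 2) ^ j := fun j ω => Nat.find_spec (hex j ω)
  have hm : ∀ j, StronglyMeasurable fun p : Ω × α => d (N j p.1) p.2 := by
    intro j
    borelize E
    have h1 : Measurable fun q : ℕ × α => d q.1 q.2 :=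
      measurable_from_prod_countable_right fun n => (Lp.stronglyMeasurable (d n)).measurable
    exact (h1.comp (((hN j).comp measurable_fst).prodMk measurable_snd)).stronglyMeasurable
  refine ⟨fun p => limUnder atTop fun j => d (N j p.1) p.2, StronglyMeasurable.limUnder hm,
    fun ω => ?_⟩
  -- the approximation errors are square summable, hence tend to zero almost everywhere
  have hsum : ∫⁻ x, ∑' j, ‖(d (N j ω) - f ω : Lp E 2 μ) x‖ₑ ^ 2 ∂μ ≠ ∞ := by
    rw [lintegral_tsum fun j => (Lp.aestronglyMeasurable _).enorm.pow_const 2]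
    refine ne_top_of_le_ne_top (b := ∑' j : ℕ, (2⁻¹ : ℝ≥0∞) ^ j) ?_ (ENNReal.tsum_le_tsum fun j => ?_)
    · rw [ENNReal.tsum_geometric]
      simp
    · rw [← eLpNorm_two_sq, ← Lp.enorm_def]
      have h1 : ‖d (N j ω) - f ω‖ₑ ≤ 2⁻¹ ^ j := by
        rw [← ofReal_norm]
        refine (ENNReal.ofReal_le_ofReal (hNs j ω).le).trans ?_
        rw [ENNReal.ofReal_pow (by norm_num), one_div, ENNReal.ofReal_inv_of_pos two_pos,
          ENNReal.ofReal_ofNat]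
      have h2 : (2⁻¹ : ℝ≥0∞) ^ j ≤ 1 := pow_le_one₀ zero_le (by simp)
      exact (pow_le_of_le_one zero_le (h1.trans h2) two_ne_zero).trans h1
  have hae := ae_lt_top' (AEMeasurable.tsum fun j =>
    (Lp.aestronglyMeasurable (d (N j ω) - f ω)).enorm.pow_const 2) hsum
  have hsub : ∀ᵐ x ∂μ, ∀ j, (d (N j ω) - f ω : Lp E 2 μ) x = d (N j ω) x - f ω x :=
    ae_all_iff.2 fun j => Lp.coeFn_sub _ _
  filter_upwards [hae, hsub] with x hx hx'
  refine Tendsto.limUnder_eq ?_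
  have h1 := ENNReal.tendsto_atTop_zero_of_tsum_ne_top hx.ne
  simp only [hx'] at h1
  rw [tendsto_iff_edist_tendsto_0]
  have h2 := (ENNReal.continuous_rpow_const (y := (1 / 2 : ℝ))).tendsto 0 |>.comp h1
  rw [ENNReal.zero_rpow_of_pos (by norm_num)] at h2
  refine h2.congr fun j => ?_
  rw [Function.comp_apply, edist_eq_enorm_sub, ← ENNReal.rpow_natCast, ← ENNReal.rpow_mul]
  norm_num

/-- Measurable random paths in `L²(0, T; L²)` have representatives that are jointly measurable in
all variables. -/
theorem exists_path_representative {Ω : Type*} [MeasurableSpace Ω] {T : ℝ≥0}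
    {f : Ω → L2L2 T Plane} (hf : StronglyMeasurable f) :
    ∃ G : Ω × ℝ≥0 × Torus2 → Plane, StronglyMeasurable G ∧
      ∀ ω, ∀ᵐ t ∂timeMeasure T, (fun x => G (ω, t, x)) =ᵐ[volume] f ω t := by
  obtain ⟨G₁, h1, h1'⟩ := exists_representative hf
  obtain ⟨G₂, h2, h2'⟩ := exists_representative h1
  refine ⟨fun p => G₂ ((p.1, p.2.1), p.2.2), h2.comp_measurable (by fun_prop), fun ω => ?_⟩
  filter_upwards [h1' ω] with t ht
  rw [← ht]
  exact h2' (ω, t)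

/-! ### Monotonicity and convergence in `L^p` -/

section Convergence

variable {α : Type*} {mα : MeasurableSpace α} {μ : Measure α} [IsFiniteMeasure μ]

theorem lintegral_enorm_le {E : Type*} [NormedAddCommGroup E] {f : α → E} {B : ℝ≥0}
    (hf : AEStronglyMeasurable f μ) (h : eLpNorm f 2 μ ≤ B) :
    ∫⁻ x, ‖f x‖ₑ ∂μ ≤ B * μ Set.univ ^ (1 / 2 : ℝ) := by
  rw [← eLpNorm_one_eq_lintegral_enorm]
  refine (eLpNorm_le_eLpNorm_mul_rpow_measure_univ one_le_two hf).trans ?_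
  have e : 1 / ENNReal.toReal 1 - 1 / ENNReal.toReal 2 = (1 / 2 : ℝ) := by norm_num
  rw [e]
  gcongr

/-- On the set where all quantities are bounded by `M`, closeness in the monotonicity form implies
closeness. -/
theorem div_le_monoForm {p q : Plane} {a M δ : ℝ} (ha : 0 ≤ a) (hδ : 0 < δ)
    (hM : 1 + a + ‖p‖ + ‖q‖ ≤ M) (hd : δ ≤ ‖p - q‖) :
    δ ^ 2 / M ^ 5 ≤ (1 + a)⁻¹ * monoForm p q := by
  have hp := norm_nonneg p
  have hq := norm_nonneg q
  have hM0 : 0 < M := by linarith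
  have hm := monoForm_nonneg p q
  have h1 : δ ^ 2 ≤ monoForm p q * (M * M) ^ 2 := by
    calc δ ^ 2 ≤ ‖p - q‖ ^ 2 := by gcongr
      _ ≤ monoForm p q * (areaFn p * areaFn q) ^ 2 := norm_sub_sq_le_monoForm p q
      _ ≤ monoForm p q * (M * M) ^ 2 := by
        have hA := (areaFn_pos p).le
        have hB := (areaFn_pos q).le
        have := areaFn_le p
        have := areaFn_le q
        gcongr <;> linarith
  have h2 : M⁻¹ ≤ (1 + a)⁻¹ := inv_anti₀ (by linarith) (by linarith)
  calc δ ^ 2 / M ^ 5 ≤ monoForm p q * (M * M) ^ 2 / M ^ 5 := by gcongr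
    _ = M⁻¹ * monoForm p q := by field_simp
    _ ≤ _ := by gcongr

variable {g : ℕ → α → Plane} {g₀ : α → Plane} {a : ℕ → α → ℝ} {B : ℝ≥0}

/-- If the monotonicity form, normalised by functions `a n` bounded in `L²`, tends to zero in mean,
then the fields converge in measure. Outside a set of small measure, `a n`, `g n` and `g₀` are
bounded, and there `norm_sub_sq_le_monoForm` bounds the form from below. -/
theorem tendsto_measure_of_monoForm (hg : ∀ n, StronglyMeasurable (g n))
    (hg₀ : StronglyMeasurable g₀) (ha : ∀ n, StronglyMeasurable (a n)) (ha0 : ∀ n x, 0 ≤ a n x)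
    (hB : ∀ n, eLpNorm (g n) 2 μ ≤ B) (hB₀ : eLpNorm g₀ 2 μ ≤ B)
    (hBa : ∀ n, eLpNorm (a n) 2 μ ≤ B)
    (hm : Tendsto (fun n => ∫⁻ x, ENNReal.ofReal ((1 + a n x)⁻¹ * monoForm (g n x) (g₀ x)) ∂μ)
      atTop (𝓝 0)) {δ : ℝ} (hδ : 0 < δ) :
    Tendsto (fun n => μ {x | δ ≤ ‖g n x - g₀ x‖}) atTop (𝓝 0) := by
  set K : ℝ≥0∞ := μ Set.univ + 3 * (B * μ Set.univ ^ (1 / 2 : ℝ)) with hK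
  have hKtop : K ≠ ∞ := by
    have : μ Set.univ ^ (1 / 2 : ℝ) ≠ ∞ :=
      ENNReal.rpow_ne_top_of_nonneg (by norm_num) (measure_ne_top _ _)
    finiteness
  -- the weights are bounded in `L¹`, which makes them large only on small sets
  have hZ : ∀ n, ∫⁻ x, ENNReal.ofReal (1 + a n x + ‖g n x‖ + ‖g₀ x‖) ∂μ ≤ K := by
    intro n
    have e : ∀ x, ENNReal.ofReal (1 + a n x + ‖g n x‖ + ‖g₀ x‖) =
        1 + ‖a n x‖ₑ + ‖g n x‖ₑ + ‖g₀ x‖ₑ := fun x => by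
      have := ha0 n x
      rw [ENNReal.ofReal_add (by positivity) (by positivity),
        ENNReal.ofReal_add (by positivity) (by positivity), ENNReal.ofReal_add zero_le_one this,
        ofReal_norm, ofReal_norm, ENNReal.ofReal_one, Real.enorm_of_nonneg this]
    simp only [e]
    rw [lintegral_add_right _ hg₀.enorm, lintegral_add_right _ (hg n).enorm,
      lintegral_add_right _ (ha n).enorm, lintegral_const, one_mul, hK, add_assoc, add_assoc]
    gcongr
    have h1 := lintegral_enorm_le (ha n).aestronglyMeasurable (hBa n)
    have h2 := lintegral_enorm_le (hg n).aestronglyMeasurable (hB n)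
    have h3 := lintegral_enorm_le hg₀.aestronglyMeasurable hB₀
    calc _ ≤ B * μ Set.univ ^ (1 / 2 : ℝ) + (B * μ Set.univ ^ (1 / 2 : ℝ) +
          B * μ Set.univ ^ (1 / 2 : ℝ)) := add_le_add h1 (add_le_add h2 h3)
      _ = _ := by ring
  rw [ENNReal.tendsto_nhds_zero]
  intro η hη
  obtain ⟨M, hM0, hMη⟩ : ∃ M : ℝ, 0 < M ∧ K / ENNReal.ofReal M ≤ η / 2 := by
    have h1 : Tendsto (fun M : ℝ => K / ENNReal.ofReal M) atTop (𝓝 0) := by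
      have := ENNReal.Tendsto.const_div (a := K) ENNReal.tendsto_ofReal_atTop (Or.inr hKtop)
      simpa using this
    have h2 := (ENNReal.tendsto_nhds_zero.1 h1 (η / 2) (ENNReal.half_pos hη.ne'))
    exact ((eventually_gt_atTop 0).and h2).exists
  have hc : 0 < δ ^ 2 / M ^ 5 := by positivity
  have h3 : Tendsto (fun n => (∫⁻ x, ENNReal.ofReal ((1 + a n x)⁻¹ * monoForm (g n x) (g₀ x)) ∂μ) /
      ENNReal.ofReal (δ ^ 2 / M ^ 5)) atTop (𝓝 0) := by
    have := ENNReal.Tendsto.div_const (b := ENNReal.ofReal (δ ^ 2 / M ^ 5)) hm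
      (Or.inr (by simpa using hc))
    simpa using this
  filter_upwards [ENNReal.tendsto_nhds_zero.1 h3 (η / 2) (ENNReal.half_pos hη.ne')] with n hn
  -- either the weight `1 + a n + ‖g n‖ + ‖g₀‖` is large or the normalised form is
  have hsub : {x | δ ≤ ‖g n x - g₀ x‖} ⊆
      {x | ENNReal.ofReal M ≤ ENNReal.ofReal (1 + a n x + ‖g n x‖ + ‖g₀ x‖)} ∪
      {x | ENNReal.ofReal (δ ^ 2 / M ^ 5) ≤
        ENNReal.ofReal ((1 + a n x)⁻¹ * monoForm (g n x) (g₀ x))} := by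
    intro x hx
    rcases le_total M (1 + a n x + ‖g n x‖ + ‖g₀ x‖) with h | h
    · exact Or.inl (ENNReal.ofReal_le_ofReal h)
    · exact Or.inr (ENNReal.ofReal_le_ofReal (div_le_monoForm (ha0 n x) hδ h hx))
  have hmm : Measurable fun x => monoForm (g n x) (g₀ x) :=
    (continuous_monoForm.comp_stronglyMeasurable ((hg n).prodMk hg₀)).measurable
  refine (measure_mono hsub).trans ((measure_union_le _ _).trans ?_)
  rw [← ENNReal.add_halves η]
  refine add_le_add ?_ ?_
  · refine (meas_ge_le_lintegral_div ?_ (by simpa using hM0) ENNReal.ofReal_ne_top).trans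
      ((ENNReal.div_le_div_right (hZ n) _).trans hMη)
    exact ((((ha n).measurable.const_add 1).add (hg n).norm.measurable).add
      hg₀.norm.measurable).ennreal_ofReal.aemeasurable
  · refine (meas_ge_le_lintegral_div ?_ (by simpa using hc) ENNReal.ofReal_ne_top).trans hn
    exact ((((ha n).measurable.const_add 1).inv).mul hmm).ennreal_ofReal.aemeasurable

/-- Convergence in measure together with a bound in `L²` implies convergence in `L^p`, `p < 2`. -/
theorem tendsto_eLpNorm_of_measure {E : Type*} [NormedAddCommGroup E] {f : ℕ → α → E} {B : ℝ≥0}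
    (hf : ∀ n, StronglyMeasurable (f n)) (hB : ∀ n, eLpNorm (f n) 2 μ ≤ B)
    (h : ∀ δ : ℝ, 0 < δ → Tendsto (fun n => μ {x | δ ≤ ‖f n x‖}) atTop (𝓝 0))
    {p : ℝ≥0∞} (hp1 : 1 ≤ p) (hp2 : p < 2) :
    Tendsto (fun n => eLpNorm (f n) p μ) atTop (𝓝 0) := by
  have hptop : p ≠ ∞ := (hp2.trans ENNReal.ofNat_lt_top).ne
  have hp0 : 0 < p.toReal := ENNReal.toReal_pos (zero_lt_one.trans_le hp1).ne' hptop
  have hpr : p.toReal < 2 := by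
    rw [← ENNReal.toReal_ofNat]
    exact (ENNReal.toReal_lt_toReal hptop ENNReal.ofNat_ne_top).2 hp2
  have hexp : 0 < 1 / p.toReal - 1 / (2 : ℝ≥0∞).toReal := by
    rw [sub_pos, ENNReal.toReal_ofNat]
    exact one_div_lt_one_div_of_lt hp0 hpr
  set c : ℝ≥0∞ := μ Set.univ ^ p.toReal⁻¹ with hc
  have hctop : c ≠ ∞ := ENNReal.rpow_ne_top_of_nonneg (inv_nonneg.2 hp0.le) (measure_ne_top _ _)
  have hbound : ∀ n, ∀ δ : ℝ, 0 < δ → eLpNorm (f n) p μ ≤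
      B * μ {x | δ ≤ ‖f n x‖} ^ (1 / p.toReal - 1 / (2 : ℝ≥0∞).toReal) + c * ENNReal.ofReal δ := by
    intro n δ hδ
    have hs : MeasurableSet {x | δ ≤ ‖f n x‖} := (hf n).norm.measurable measurableSet_Ici
    set s := {x | δ ≤ ‖f n x‖}
    have e : f n = s.indicator (f n) + sᶜ.indicator (f n) := (Set.indicator_self_add_compl _ _).symm
    rw [e]
    refine (eLpNorm_add_le ((hf n).indicator hs).aestronglyMeasurable
      ((hf n).indicator hs.compl).aestronglyMeasurable hp1).trans (add_le_add ?_ ?_)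
    · rw [eLpNorm_indicator_eq_eLpNorm_restrict hs]
      refine (eLpNorm_le_eLpNorm_mul_rpow_measure_univ hp2.le
        (hf n).aestronglyMeasurable).trans ?_
      rw [Measure.restrict_apply_univ]
      gcongr
      exact (eLpNorm_restrict_le _ _ _ _).trans (hB n)
    · refine (eLpNorm_le_of_ae_bound (C := δ) (ae_of_all _ fun x => ?_)).trans le_rfl
      by_cases hx : x ∈ s
      · rw [Set.indicator_of_notMem (by simpa using hx), norm_zero]
        exact hδ.le
      · rw [Set.indicator_of_mem hx]
        exact (not_le.1 hx).le
  rw [ENNReal.tendsto_nhds_zero]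
  intro η hη
  obtain ⟨δ, hδ, hδη⟩ : ∃ δ : ℝ, 0 < δ ∧ c * ENNReal.ofReal δ ≤ η / 2 := by
    have h1 : Tendsto (fun δ : ℝ => c * ENNReal.ofReal δ) (𝓝[>] 0) (𝓝 0) := by
      have h2 : Tendsto (fun δ : ℝ => ENNReal.ofReal δ) (𝓝[>] 0) (𝓝 0) := by
        have := (ENNReal.continuous_ofReal.tendsto 0).mono_left
          (nhdsWithin_le_nhds (s := Set.Ioi (0 : ℝ)))
        rwa [ENNReal.ofReal_zero] at this
      simpa using ENNReal.Tendsto.const_mul h2 (Or.inr hctop)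
    exact ((eventually_mem_nhdsWithin (a := (0 : ℝ)) (s := Set.Ioi 0)).and
      (ENNReal.tendsto_nhds_zero.1 h1 (η / 2) (ENNReal.half_pos hη.ne'))).exists
  have h4 : Tendsto (fun n => B * μ {x | δ ≤ ‖f n x‖} ^
      (1 / p.toReal - 1 / (2 : ℝ≥0∞).toReal)) atTop (𝓝 0) := by
    have := ((ENNReal.continuous_rpow_const
      (y := 1 / p.toReal - 1 / (2 : ℝ≥0∞).toReal)).tendsto 0).comp (h δ hδ)
    rw [ENNReal.zero_rpow_of_pos hexp] at this
    simpa using ENNReal.Tendsto.const_mul (a := (B : ℝ≥0∞)) this (Or.inr ENNReal.coe_ne_top)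
  filter_upwards [ENNReal.tendsto_nhds_zero.1 h4 (η / 2) (ENNReal.half_pos hη.ne')] with n hn
  refine (hbound n δ hδ).trans ?_
  rw [← ENNReal.add_halves η]
  exact add_le_add hn hδη

/-- Convergence in `L^p`, `p < 2`, from convergence of the normalised monotonicity form. -/
theorem tendsto_eLpNorm_of_monoForm (hg : ∀ n, StronglyMeasurable (g n))
    (hg₀ : StronglyMeasurable g₀) (ha : ∀ n, StronglyMeasurable (a n)) (ha0 : ∀ n x, 0 ≤ a n x)
    (hB : ∀ n, eLpNorm (g n) 2 μ ≤ B) (hB₀ : eLpNorm g₀ 2 μ ≤ B)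
    (hBa : ∀ n, eLpNorm (a n) 2 μ ≤ B)
    (hm : Tendsto (fun n => ∫⁻ x, ENNReal.ofReal ((1 + a n x)⁻¹ * monoForm (g n x) (g₀ x)) ∂μ)
      atTop (𝓝 0)) {p : ℝ≥0∞} (hp1 : 1 ≤ p) (hp2 : p < 2) :
    Tendsto (fun n => eLpNorm (g n - g₀) p μ) atTop (𝓝 0) := by
  refine tendsto_eLpNorm_of_measure (B := B + B) (fun n => (hg n).sub hg₀) (fun n => ?_)
    (fun δ hδ => tendsto_measure_of_monoForm hg hg₀ ha ha0 hB hB₀ hBa hm hδ) hp1 hp2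
  rw [ENNReal.coe_add]
  exact (eLpNorm_sub_le (hg n).aestronglyMeasurable hg₀.aestronglyMeasurable one_le_two).trans
    (add_le_add (hB n) hB₀)

end Convergence

end GraphMCF

namespace GraphMCF

/-! ### Transfer of the estimates by equality of laws, and passage to the limit -/

section Transfer

variable {Ω : Type*} {mΩ : MeasurableSpace Ω} {P : Measure Ω} [IsProbabilityMeasure P]
  {F : Filtration ℝ≥0 mΩ} {T : ℝ≥0} {W : ℝ≥0 → Ω → ℝ} {ε : ℝ} {u₀ : Ω → H1}
  {u : ℝ≥0 → Ω → L2 ℝ} {U : ℝ≥0 → Ω → H2}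

theorem isWeakDivergence_congr_left {f f' : Torus2 → Plane} {v : Torus2 → ℝ}
    (h : f =ᵐ[volume] f') (hv : IsWeakDivergence f v) : IsWeakDivergence f' v := by
  intro φ hφ
  rw [← hv φ hφ]
  refine integral_congr_ae ?_
  filter_upwards [h] with x hx
  rw [hx]

theorem enorm_sq_eq_lintegral {α E : Type*} {mα : MeasurableSpace α} {μ : Measure α}
    [NormedAddCommGroup E] (g : Lp E 2 μ) : ‖g‖ₑ ^ 2 = ∫⁻ t, ‖g t‖ₑ ^ 2 ∂μ := by
  rw [Lp.enorm_def, eLpNorm_two_sq]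

/-- Path vectors built from an `H²` valued path are consistent, and `gradOp` recovers its gradient. -/
theorem isConsistent_of_isPathVector {θ : ℝ} {w : ℝ≥0 → ℝ} {z : H1} {u : ℝ≥0 → L2 ℝ}
    {U : ℝ≥0 → H2} {X : PathSpace T} (hX : IsPathVector θ w z u U X)
    (hu : ∀ᵐ t ∂timeMeasure T, u t = (U t).fn)
    (hU : MemLp (fun t => (U t).grad) 2 (timeMeasure T)) :
    IsConsistent X ∧ ‖gradOp X.u‖ₑ ^ 2 = ∫⁻ t, ‖(U t).grad‖ₑ ^ 2 ∂timeMeasure T := by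
  have hg : GradRel X.u (hU.toLp _) := by
    filter_upwards [hX.u_eq, hu, hU.coeFn_toLp] with t h1 h2 h3
    rw [h1, h2, h3]
    exact (U t).2.1
  refine ⟨⟨⟨_, hg⟩, ?_, ?_⟩, ?_⟩
  · rw [hg.gradOp_eq]
    refine Lp.ext ?_
    filter_upwards [hX.ν_eq, normalPath_coeFn (hU.toLp _), hU.coeFn_toLp] with t h1 h2 h3
    rw [h1, h2, h3, toL2_normal]
  · filter_upwards [hX.ν_eq, hX.v_eq] with t h1 h2
    rw [h1, h2]
    exact isWeakDivergence_congr_left (toL2_coeFn (memLp_z_normal (U t))).symm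
      (isWeakDivergence_curv (U t))
  · rw [hg.gradOp_eq, enorm_sq_eq_lintegral]
    refine lintegral_congr_ae ?_
    filter_upwards [hU.coeFn_toLp] with t h1
    rw [h1]

theorem ae_isConsistent (h : IsViscousSolution P F T W ε u₀ u U) {θ : ℝ} {X : Ω → PathSpace T}
    (hX : ∀ᵐ ω ∂P, IsPathVector θ (fun t => W t ω) (u₀ ω) (fun t => u t ω) (fun t => U t ω) (X ω)) :
    ∀ᵐ ω ∂P, IsConsistent (X ω) ∧
      ‖gradOp (X ω).u‖ₑ ^ 2 = ∫⁻ t, ‖(U t ω).grad‖ₑ ^ 2 ∂timeMeasure T := by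
  have hm : StronglyMeasurable fun p : Ω × ℝ≥0 => (U p.2 p.1).grad :=
    stronglyMeasurable_comp_solution h continuous_H2_grad
  have hgr : MemLp (fun p : Ω × ℝ≥0 => (U p.2 p.1).grad) 2 (P.prod (timeMeasure T)) :=
    memLp_comp_solution h continuous_H2_grad ENNReal.one_ne_top enorm_grad_sq_le
  filter_upwards [hX, h.representative, (hgr.integrable_norm_pow two_ne_zero).prod_right_ae]
    with ω h1 h2 h3
  refine isConsistent_of_isPathVector h1 h2 ?_
  exact (memLp_two_iff_integrable_sq_norm
    (hm.comp_measurable measurable_prodMk_left).aestronglyMeasurable).2 h3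

variable {Ω' : Type*} {mΩ' : MeasurableSpace Ω'} {P' : Measure Ω'}

theorem measurable_enorm_gradOp :
    Measurable fun X : PathSpace T => ‖gradOp X.u‖ₑ ^ 2 :=
  (stronglyMeasurable_gradOp stronglyMeasurable_u).enorm.pow_const 2

/-- The energy estimate and the relations between the components only depend on the law. -/
theorem ae_isConsistent_of_law (h : IsViscousSolution P F T W ε u₀ u U)
    (hε : ε ∈ Set.Ioo (0 : ℝ) 1) (hT : 0 < T) {C : ℝ≥0}
    (hC : ∫⁻ ω, ‖(u₀ ω).grad‖ₑ ^ 2 ∂P ≤ C) {θ : ℝ} {X : Ω → PathSpace T} (hXm : Measurable X)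
    (hX : ∀ᵐ ω ∂P, IsPathVector θ (fun t => W t ω) (u₀ ω) (fun t => u t ω) (fun t => U t ω) (X ω))
    {Y : Ω' → PathSpace T} (hYm : Measurable Y) (hlaw : P'.map Y = P.map X) :
    (∀ᵐ ω ∂P', IsConsistent (Y ω)) ∧ ∫⁻ ω, ‖gradOp (Y ω).u‖ₑ ^ 2 ∂P' ≤ T * C := by
  have hc := ae_isConsistent h hX
  constructor
  · have h1 : ∀ᵐ x ∂P.map X, IsConsistent x :=
      (ae_map_iff hXm.aemeasurable measurableSet_isConsistent).2 (hc.mono fun ω hω => hω.1)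
    rw [← hlaw] at h1
    exact ae_of_ae_map hYm.aemeasurable h1
  · rw [← lintegral_map (f := fun X : PathSpace T => ‖gradOp X.u‖ₑ ^ 2) measurable_enorm_gradOp hYm,
      hlaw, lintegral_map measurable_enorm_gradOp hXm, lintegral_congr_ae (hc.mono fun ω hω => hω.2)]
    exact lintegral_grad_le h hε hT hC

end Transfer

section Limit

variable {Ω' : Type*} {mΩ' : MeasurableSpace Ω'} {P' : Measure Ω'} [IsProbabilityMeasure P']
  {T : ℝ≥0} {Y : ℕ → Ω' → PathSpace T} {Ylim : Ω' → PathSpace T} {C : ℝ≥0}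

theorem stronglyMeasurable_gradOp_comp {Z : Ω' → PathSpace T} (hZ : Measurable Z) :
    StronglyMeasurable fun ω => gradOp (Z ω).u :=
  (stronglyMeasurable_gradOp stronglyMeasurable_u).comp_measurable hZ

/-- The limit path has a gradient, with the same bound on the mean Dirichlet energy: by Fatou's lemma
the lower limit of the energies is almost surely finite. -/
theorem ae_exists_gradRel_limit (hYm : ∀ n, Measurable (Y n))
    (hc : ∀ n, ∀ᵐ ω ∂P', IsConsistent (Y n ω))
    (hE : ∀ n, ∫⁻ ω, ‖gradOp (Y n ω).u‖ₑ ^ 2 ∂P' ≤ C)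
    (hconv : ∀ᵐ ω ∂P', Tendsto (fun n => Y n ω) atTop (𝓝 (Ylim ω))) :
    (∀ᵐ ω ∂P', ∃ g, GradRel (Ylim ω).u g) ∧ ∫⁻ ω, ‖gradOp (Ylim ω).u‖ₑ ^ 2 ∂P' ≤ C := by
  have hm : ∀ n, Measurable fun ω => ‖gradOp (Y n ω).u‖ₑ ^ 2 := fun n =>
    measurable_enorm_gradOp.comp (hYm n)
  have hF : ∫⁻ ω, liminf (fun n => ‖gradOp (Y n ω).u‖ₑ ^ 2) atTop ∂P' ≤ C :=
    (lintegral_liminf_le hm).trans (liminf_le_of_frequently_le' (Frequently.of_forall hE))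
  have hfin := ae_lt_top (Measurable.liminf hm) (ne_top_of_le_ne_top ENNReal.coe_ne_top hF)
  have key : ∀ᵐ ω ∂P', (∃ g, GradRel (Ylim ω).u g) ∧
      ‖gradOp (Ylim ω).u‖ₑ ^ 2 ≤ liminf (fun n => ‖gradOp (Y n ω).u‖ₑ ^ 2) atTop := by
    filter_upwards [hfin, hconv, ae_all_iff.2 hc] with ω h1 h2 h3
    exact enorm_gradOp_le_liminf ((continuous_u.tendsto _).comp h2) (fun n => (h3 n).1) h1.ne
  exact ⟨key.mono fun ω h => h.1, (lintegral_mono_ae (key.mono fun ω h => h.2)).trans hF⟩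

/-- The normalised monotonicity form tends to zero in mean. -/
theorem tendsto_lintegral_monotone (hYm : ∀ n, Measurable (Y n)) (hYlim : Measurable Ylim)
    (hc : ∀ n, ∀ᵐ ω ∂P', IsConsistent (Y n ω))
    (hconv : ∀ᵐ ω ∂P', Tendsto (fun n => Y n ω) atTop (𝓝 (Ylim ω)))
    (hlim : ∀ᵐ ω ∂P', ∃ g, GradRel (Ylim ω).u g)
    (hE : ∫⁻ ω, ‖gradOp (Ylim ω).u‖ₑ ^ 2 ∂P' ≤ C) :
    Tendsto (fun n => ∫⁻ ω, ENNReal.ofReal ((1 + ‖gradOp (Y n ω).u‖)⁻¹ *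
      (inner ℝ (gradOp (Y n ω).u - gradOp (Ylim ω).u)
        (normalPath (gradOp (Y n ω).u) - normalPath (gradOp (Ylim ω).u)) : ℝ)) ∂P')
      atTop (𝓝 0) := by
  obtain ⟨c, hcb⟩ := exists_norm_normalPath_le T
  have hc0 : 0 ≤ c := (norm_nonneg _).trans (hcb 0)
  have hs := fun n => stronglyMeasurable_gradOp_comp (hYm n)
  have hsl := stronglyMeasurable_gradOp_comp hYlim
  have hmem : MemLp (fun ω => gradOp (Ylim ω).u) 2 P' := by
    refine ⟨hsl.aestronglyMeasurable, ?_⟩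
    rw [← eLpNorm_two_sq] at hE
    exact (ENNReal.pow_lt_top_iff.1 (hE.trans_lt ENNReal.coe_lt_top)).resolve_right two_ne_zero
  have hbi : Integrable (fun ω => 2 * c * (1 + ‖gradOp (Ylim ω).u‖)) P' :=
    ((integrable_const 1).add (hmem.integrable one_le_two).norm).const_mul _
  have hlim0 : ∫⁻ _ω : Ω', (0 : ℝ≥0∞) ∂P' = 0 := lintegral_zero
  rw [← hlim0]
  refine tendsto_lintegral_of_dominated_convergence
    (fun ω => ENNReal.ofReal (2 * c * (1 + ‖gradOp (Ylim ω).u‖))) (fun n => ?_) (fun n => ?_)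
    hbi.lintegral_lt_top.ne ?_
  · refine Measurable.ennreal_ofReal ?_
    exact ((hs n).norm.measurable.const_add 1).inv.mul (((hs n).sub hsl).inner
      ((continuous_normalPath.comp_stronglyMeasurable (hs n)).sub
        (continuous_normalPath.comp_stronglyMeasurable hsl))).measurable
  · refine ae_of_all _ fun ω => ENNReal.ofReal_le_ofReal ?_
    set g := gradOp (Y n ω).u
    set g' := gradOp (Ylim ω).u
    have h0 : 0 < 1 + ‖g‖ := by positivity
    rw [inv_mul_le_iff₀ h0]
    calc (inner ℝ (g - g') (normalPath g - normalPath g') : ℝ)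
        ≤ ‖g - g'‖ * ‖normalPath g - normalPath g'‖ := real_inner_le_norm _ _
      _ ≤ (‖g‖ + ‖g'‖) * (c + c) := by
          gcongr
          · exact norm_sub_le _ _
          · exact (norm_sub_le _ _).trans (add_le_add (hcb _) (hcb _))
      _ ≤ (1 + ‖g‖) * (2 * c * (1 + ‖g'‖)) := by
          nlinarith [norm_nonneg g, norm_nonneg g', mul_nonneg hc0 (norm_nonneg g),
            mul_nonneg hc0 (mul_nonneg (norm_nonneg g) (norm_nonneg g'))]
  · filter_upwards [hconv, ae_all_iff.2 hc, hlim] with ω h1 h2 h3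
    have h4 := (ENNReal.continuous_ofReal.tendsto 0).comp (tendsto_of_isConsistent h1 h2 h3)
    rwa [ENNReal.ofReal_zero] at h4

/-- The representative of the gradient of a random path is its spatial gradient. -/
theorem isSpatialGradient_of_representative {Z : Ω' → PathSpace T}
    {G : Ω' × ℝ≥0 × Torus2 → Plane} (hG : StronglyMeasurable G)
    (hG' : ∀ ω, ∀ᵐ t ∂timeMeasure T, (fun x => G (ω, t, x)) =ᵐ[volume] gradOp (Z ω).u t)
    (hgr : ∀ᵐ ω ∂P', ∃ g, GradRel (Z ω).u g)
    (hE : ∫⁻ ω, ‖gradOp (Z ω).u‖ₑ ^ 2 ∂P' ≤ C) :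
    IsSpatialGradient P' T (fun ω => (Z ω).u) G ∧
      eLpNorm G 2 (spaceTimeMeasure P' T) ^ 2 ≤ C := by
  have hn : eLpNorm G 2 (spaceTimeMeasure P' T) ^ 2 ≤ C := by
    rw [eLpNorm_two_sq, spaceTimeMeasure, lintegral_prod _ (hG.enorm.pow_const 2).aemeasurable]
    refine le_trans (le_of_eq (lintegral_congr fun ω => ?_)) hE
    have hs : Measurable fun y => ‖G (ω, y)‖ₑ ^ 2 :=
      (hG.enorm.pow_const 2).comp measurable_prodMk_left
    rw [enorm_sq_eq_lintegral, lintegral_prod _ hs.aemeasurable]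
    refine lintegral_congr_ae ?_
    filter_upwards [hG' ω] with t ht
    rw [enorm_sq_eq_lintegral]
    refine lintegral_congr_ae ?_
    filter_upwards [ht] with x hx
    rw [← hx]
  refine ⟨⟨⟨hG.aestronglyMeasurable, ?_⟩, ?_⟩, hn⟩
  · exact (ENNReal.pow_lt_top_iff.1 (hn.trans_lt ENNReal.coe_lt_top)).resolve_right two_ne_zero
  · filter_upwards [hgr] with ω hω
    filter_upwards [hG' ω, gradRel_gradOp hω] with t h1 h2
    intro φ hφ i
    rw [h2 φ hφ i]
    congr 1
    refine integral_congr_ae ?_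
    filter_upwards [h1] with x hx
    rw [hx]

/-- The mean of the pathwise monotonicity forms as an integral of the pointwise one over
`Ω × [0, T] × 𝕋²`. -/
theorem lintegral_monoForm_eq {Z Z' : Ω' → PathSpace T} {G G' : Ω' × ℝ≥0 × Torus2 → Plane}
    (hZ : Measurable Z) (hG : StronglyMeasurable G) (hG' : StronglyMeasurable G')
    (h : ∀ ω, ∀ᵐ t ∂timeMeasure T, (fun x => G (ω, t, x)) =ᵐ[volume] gradOp (Z ω).u t)
    (h' : ∀ ω, ∀ᵐ t ∂timeMeasure T, (fun x => G' (ω, t, x)) =ᵐ[volume] gradOp (Z' ω).u t) :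
    ∫⁻ q, ENNReal.ofReal ((1 + ‖gradOp (Z q.1).u‖)⁻¹ * monoForm (G q) (G' q))
        ∂spaceTimeMeasure P' T =
      ∫⁻ ω, ENNReal.ofReal ((1 + ‖gradOp (Z ω).u‖)⁻¹ *
        (inner ℝ (gradOp (Z ω).u - gradOp (Z' ω).u)
          (normalPath (gradOp (Z ω).u) - normalPath (gradOp (Z' ω).u)) : ℝ)) ∂P' := by
  have hmm : Measurable fun q => monoForm (G q) (G' q) :=
    (continuous_monoForm.comp_stronglyMeasurable (hG.prodMk hG')).measurable
  have hm : Measurable fun q : Ω' × ℝ≥0 × Torus2 =>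
      ENNReal.ofReal ((1 + ‖gradOp (Z q.1).u‖)⁻¹ * monoForm (G q) (G' q)) :=
    ((((stronglyMeasurable_gradOp_comp hZ).norm.measurable.comp measurable_fst).const_add
      1).inv.mul hmm).ennreal_ofReal
  rw [spaceTimeMeasure, lintegral_prod _ hm.aemeasurable]
  refine lintegral_congr fun ω => ?_
  have h0 : 0 ≤ (1 + ‖gradOp (Z ω).u‖)⁻¹ := by positivity
  simp only [ENNReal.ofReal_mul h0]
  have hs : Measurable fun y => ENNReal.ofReal (monoForm (G (ω, y)) (G' (ω, y))) :=
    (hmm.comp measurable_prodMk_left).ennreal_ofReal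
  rw [lintegral_const_mul _ hs, ofReal_inner_normalPath_sub, lintegral_prod _ hs.aemeasurable]
  congr 1
  refine lintegral_congr_ae ?_
  filter_upwards [h ω, h' ω] with t h1 h2
  refine lintegral_congr_ae ?_
  filter_upwards [h1, h2] with x e1 e2
  rw [← e1, ← e2]

theorem eLpNorm_norm_gradOp_le {Z : Ω' → PathSpace T} (hZ : Measurable Z)
    (hE : ∫⁻ ω, ‖gradOp (Z ω).u‖ₑ ^ 2 ∂P' ≤ C) :
    eLpNorm (fun q : Ω' × ℝ≥0 × Torus2 => ‖gradOp (Z q.1).u‖) 2 (spaceTimeMeasure P' T) ^ 2 ≤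
      C * T := by
  have hm : Measurable fun q : Ω' × ℝ≥0 × Torus2 => ‖gradOp (Z q.1).u‖ₑ ^ 2 :=
    ((stronglyMeasurable_gradOp_comp hZ).enorm.pow_const 2).comp measurable_fst
  have h1 : ((timeMeasure T).prod (volume : Measure Torus2)) Set.univ = T := by
    rw [← Set.univ_prod_univ, Measure.prod_prod, timeMeasure_univ, measure_univ, mul_one]
  simp only [eLpNorm_norm, eLpNorm_two_sq]
  rw [spaceTimeMeasure, lintegral_prod _ hm.aemeasurable]
  simp only [lintegral_const, h1]
  rw [lintegral_mul_const' _ _ ENNReal.coe_ne_top]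
  gcongr

theorem le_one_add_of_sq_le {x : ℝ≥0∞} {c : ℝ≥0} (h : x ^ 2 ≤ c) : x ≤ (1 + c : ℝ≥0) := by
  rw [ENNReal.coe_add, ENNReal.coe_one]
  rcases le_total x 1 with hx | hx
  · exact hx.trans le_self_add
  · exact ((le_self_pow₀ hx two_ne_zero).trans h).trans le_add_self

instance : IsFiniteMeasure (spaceTimeMeasure P' T) := by
  unfold spaceTimeMeasure
  infer_instance

/-- Strong convergence of the gradients of almost surely convergent consistent path vectors with
bounded mean Dirichlet energy. -/
theorem exists_tendsto_spatialGradient (hYm : ∀ n, Measurable (Y n)) (hYlim : Measurable Ylim)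
    (hc : ∀ n, ∀ᵐ ω ∂P', IsConsistent (Y n ω))
    (hE : ∀ n, ∫⁻ ω, ‖gradOp (Y n ω).u‖ₑ ^ 2 ∂P' ≤ C)
    (hconv : ∀ᵐ ω ∂P', Tendsto (fun n => Y n ω) atTop (𝓝 (Ylim ω))) :
    ∃ (G : ℕ → Ω' × ℝ≥0 × Torus2 → Plane) (Glim : Ω' × ℝ≥0 × Torus2 → Plane),
      (∀ n, IsSpatialGradient P' T (fun ω => (Y n ω).u) (G n)) ∧
      IsSpatialGradient P' T (fun ω => (Ylim ω).u) Glim ∧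
      ∀ p : ℝ≥0∞, 1 ≤ p → p < 2 →
        Tendsto (fun n => eLpNorm (G n - Glim) p (spaceTimeMeasure P' T)) atTop (𝓝 0) := by
  obtain ⟨hlim, hElim⟩ := ae_exists_gradRel_limit hYm hc hE hconv
  choose G hGm hG using fun n => exists_path_representative
    (stronglyMeasurable_gradOp_comp (hYm n))
  obtain ⟨Glim, hGlimm, hGlim⟩ := exists_path_representative
    (stronglyMeasurable_gradOp_comp hYlim)
  have hsp := fun n => isSpatialGradient_of_representative (hGm n) (hG n)
    ((hc n).mono fun ω hω => hω.1) (hE n)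
  have hspl := isSpatialGradient_of_representative hGlimm hGlim hlim hElim
  refine ⟨G, Glim, fun n => (hsp n).1, hspl.1, fun p hp1 hp2 => ?_⟩
  have hcc : C ≤ C + C * T := le_self_add
  have ha : ∀ n, eLpNorm (fun q : Ω' × ℝ≥0 × Torus2 => ‖gradOp (Y n q.1).u‖) 2
      (spaceTimeMeasure P' T) ≤ (1 + (C + C * T) : ℝ≥0) := fun n =>
    le_one_add_of_sq_le ((eLpNorm_norm_gradOp_le (hYm n) (hE n)).trans
      (by exact_mod_cast (le_add_self : C * T ≤ C + C * T)))
  have ham : ∀ n, StronglyMeasurable fun q : Ω' × ℝ≥0 × Torus2 => ‖gradOp (Y n q.1).u‖ := fun n =>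
    (stronglyMeasurable_gradOp_comp (hYm n)).norm.comp_measurable measurable_fst
  refine tendsto_eLpNorm_of_monoForm hGm hGlimm ham (fun n q => norm_nonneg _)
    (fun n => le_one_add_of_sq_le ((hsp n).2.trans (ENNReal.coe_le_coe.2 hcc)))
    (le_one_add_of_sq_le (hspl.2.trans (ENNReal.coe_le_coe.2 hcc))) ha ?_ hp1 hp2
  refine (tendsto_lintegral_monotone hYm hYlim hc hconv hlim hElim).congr fun n => ?_
  exact (lintegral_monoForm_eq (hYm n) (hGm n) hGlimm (hG n) hGlim).symm

end Limit

end GraphMCF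

theorem mainTheorem6 {Ω Ω' : Type*} [mΩ : MeasurableSpace Ω] [MeasurableSpace Ω']
    (P : Measure Ω) [IsProbabilityMeasure P] (P' : Measure Ω') [IsProbabilityMeasure P']
    (T : ℝ≥0) (hT : 0 < T) (θ : ℝ) (hθ : θ ∈ Set.Ioo (0 : ℝ) 1)
    (F : Filtration ℝ≥0 mΩ) (W : ℝ≥0 → Ω → ℝ)
    (ε : ℕ → ℝ) (hε : ∀ n, ε n ∈ Set.Ioo (0 : ℝ) 1) (hε0 : Tendsto ε atTop (𝓝 0))
    (u₀ : ℕ → Ω → H1) (u : ℕ → ℝ≥0 → Ω → L2 ℝ) (U : ℕ → ℝ≥0 → Ω → H2)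
    (hsol : ∀ n, IsViscousSolution P F T W (ε n) (u₀ n) (u n) (U n))
    (hdata : ∃ C : ℝ≥0, ∀ n, ∫⁻ ω, ‖(u₀ n ω).grad‖ₑ ^ 2 ∂P ≤ C)
    (X : ℕ → Ω → PathSpace T) (hXmeas : ∀ n, Measurable (X n))
    (hX : ∀ n, ∀ᵐ ω ∂P,
      IsPathVector θ (fun t => W t ω) (u₀ n ω) (fun t => u n t ω) (fun t => U n t ω) (X n ω))
    (Y : ℕ → Ω' → PathSpace T) (hYmeas : ∀ n, Measurable (Y n))
    (Ylim : Ω' → PathSpace T) (hYlimmeas : Measurable Ylim)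
    (hlaw : ∀ n, P'.map (Y n) = P.map (X n))
    (hconv : ∀ᵐ ω ∂P', Tendsto (fun n => Y n ω) atTop (𝓝 (Ylim ω))) :
    ∃ (G : ℕ → Ω' × ℝ≥0 × Torus2 → Plane) (Glim : Ω' × ℝ≥0 × Torus2 → Plane),
      (∀ n, IsSpatialGradient P' T (fun ω => (Y n ω).u) (G n)) ∧
      IsSpatialGradient P' T (fun ω => (Ylim ω).u) Glim ∧
      ∀ p : ℝ≥0∞, 1 ≤ p → p < 2 →
        Tendsto (fun n => eLpNorm (G n - Glim) p (spaceTimeMeasure P' T)) atTop (𝓝 0) := by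
  obtain ⟨C, hC⟩ := hdata
  have htr := fun n => GraphMCF.ae_isConsistent_of_law (hsol n) (hε n) hT (hC n) (hXmeas n) (hX n)
    (hYmeas n) (hlaw n)
  exact GraphMCF.exists_tendsto_spatialGradient (C := T * C) hYmeas hYlimmeas
    (fun n => (htr n).1) (fun n => by rw [ENNReal.coe_mul]; exact (htr n).2) hconv
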